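/- Let $S^1=\mathbb R/\mathbb Z$, let $s>9/2$, let $H^s(S^1)$ denote the real Sobolev space and $H^s_0(S^1)=\{v\in H^s(S^1): v(0)=0\}$. For $f$ of zero mean let $A^{-1}f$ be the function $v$ on $S^1$ with $-v_{xx}=f$ and $v(0)=0$. For $T\in(0,\infty]$, a solution of the two-component Hunter–Saxton system (2HS) on $[0,T)$ is a pair $$(u,\rho)\in C\big([0,T);H^s_0(S^1)\times H^{s-1}(S^1)\big)\cap C^1\big([0,T);H^{s-1}_0(S^1)\times H^{s-2}(S^1)\big)$$ such that $$u_t+uu_x=-\tfrac12A^{-1}\partial_x(u_x^2+\rho^2),\qquad \rho_t+u\rho_x=-\rho u_x .$$ Such a $T$ is the maximal existence time of $(u,\rho)$ if $(u,\rho)$ does not extend to a solution on $[0,T')$ for any $T'>T$. Let $c\ge 0$ be the speed of the solution, defined by $c^2=\frac14\int_{S^1}\big(u_x(0,x)^2+\rho(0,x)^2\big)\,dx$. If $c>0$, then every solution is periodic in time with period $2\pi/c$ (that is, with period $2\pi$ with respect to the arc-length parameter $ct$): $(u,\rho)(t+2\pi/c)=(u,\rho)(t)$ for all $t\ge 0$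 with $t+2\pi/c<T$, and so for all $t\ge0$ if $T=\infty$. If moreover $T$ is the maximal existence time of $(u,\rho)$, then either $T=\infty$ or $T<\pi/c$. In particular, for solutions of unit speed, $c=1$, the period is $2\pi$, and either $T=\infty$ or $T<\pi$. If $c=0$, then $(u,\rho)\equiv(0,0)$ on $[0,T)$, and the maximal existence time is $T=\infty$. -/

import Mathlib

open Filter Topology
open scoped ENNReal

noncomputable section

namespace HunterSaxton

/-- Squared `H^s` norm of a function on the circle of length one, given as a 1-periodic function on
the line: the sum over `n : ℤ` of `(1 + n ^ 2) ^ s * |f̂ n| ^ 2`, with values in `[0, ∞]`. -/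
def sobolevNormSq (s : ℝ) (f : ℝ → ℝ) : ℝ≥0∞ :=
  ∑' n : ℤ, ENNReal.ofReal ((1 + (n : ℝ) ^ 2) ^ s) *
    ‖fourierCoeffOn (zero_lt_one : (0 : ℝ) < 1) (fun x => (f x : ℂ)) n‖ₑ ^ 2

/-- The real Sobolev space `H^s` of the circle of length one. Only orders `s > 1/2` are used, for
which every class has exactly one continuous representative; elements are those representatives. -/
def MemSobolev (s : ℝ) (f : ℝ → ℝ) : Prop :=
  Continuous f ∧ Function.Periodic f 1 ∧ sobolevNormSq s f < ⊤

/-- The closed subspace `H_0^s` of functions in `H^s` that vanish at the base point `0`. -/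
def MemSobolevZero (s : ℝ) (f : ℝ → ℝ) : Prop :=
  MemSobolev s f ∧ f 0 = 0

/-- The time interval `[0, T)`, where `T` may be `∞`. -/
def timeInterval (T : EReal) : Set ℝ :=
  {t | 0 ≤ t ∧ (t : EReal) < T}

/-- The curve `v` is continuous on `[0, T)` for the `H^s` norm. -/
def ContinuousInSobolev (s : ℝ) (T : EReal) (v : ℝ → ℝ → ℝ) : Prop :=
  ∀ t ∈ timeInterval T,
    Tendsto (fun τ => sobolevNormSq s (v τ - v t)) (𝓝[timeInterval T] t) (𝓝 0)

/-- The curve `v` has derivative `w` on `[0, T)` for the `H^s` norm (one-sided at `0`). -/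
def HasDerivInSobolev (s : ℝ) (T : EReal) (v w : ℝ → ℝ → ℝ) : Prop :=
  ∀ t ∈ timeInterval T,
    Tendsto (fun τ => sobolevNormSq s ((τ - t)⁻¹ • (v τ - v t) - w t))
      (𝓝[timeInterval T \ {t}] t) (𝓝 0)

/-- The inverse of `A = -∂ₓ²` on functions of zero mean, normalized to vanish at `0`. -/
def invA (f : ℝ → ℝ) (x : ℝ) : ℝ :=
  -(∫ y in (0 : ℝ)..x, ∫ z in (0 : ℝ)..y, f z) +
    x * ∫ y in (0 : ℝ)..1, ∫ z in (0 : ℝ)..y, f z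

/-- `(u, ρ)` is a solution on `[0, T)` of the two-component Hunter-Saxton system
`u_t + u u_x = -½ A⁻¹ ∂ₓ (u_x² + ρ²)`, `ρ_t + u ρ_x = -ρ u_x`, in the class
`C([0,T); H_0^s × H^{s-1}) ∩ C¹([0,T); H_0^{s-1} × H^{s-2})`.
The witnesses `ut` and `ρt` are the time derivatives of `u` and `ρ`. -/
def IsSolution (s : ℝ) (T : EReal) (u ρ : ℝ → ℝ → ℝ) : Prop :=
  (∀ t ∈ timeInterval T, MemSobolevZero s (u t) ∧ MemSobolev (s - 1) (ρ t)) ∧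
  ContinuousInSobolev s T u ∧ ContinuousInSobolev (s - 1) T ρ ∧
  ∃ ut ρt : ℝ → ℝ → ℝ,
    (∀ t ∈ timeInterval T, MemSobolevZero (s - 1) (ut t) ∧ MemSobolev (s - 2) (ρt t)) ∧
    ContinuousInSobolev (s - 1) T ut ∧ ContinuousInSobolev (s - 2) T ρt ∧
    HasDerivInSobolev (s - 1) T u ut ∧ HasDerivInSobolev (s - 2) T ρ ρt ∧
    ∀ t ∈ timeInterval T, ∀ x : ℝ,
      ut t x + u t x * deriv (u t) x =
        -(1 / 2) * invA (deriv fun y => deriv (u t) y ^ 2 + ρ t y ^ 2) x ∧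
      ρt t x + u t x * deriv (ρ t) x = -(ρ t x * deriv (u t) x)

/-- `T` is the maximal existence time of the solution `(u, ρ)`: the solution on `[0, T)` cannot be
extended to a solution on a longer interval `[0, T')`. -/
def IsMaximalSolution (s : ℝ) (T : EReal) (u ρ : ℝ → ℝ → ℝ) : Prop :=
  IsSolution s T u ρ ∧
  ∀ (T' : EReal) (v η : ℝ → ℝ → ℝ), T < T' → IsSolution s T' v η →
    ¬ ∀ t ∈ timeInterval T, v t = u t ∧ η t = ρ t

/-- The speed `c ≥ 0`, `c² = ¼ ∫ (u₀ₓ² + ρ₀²) dx`, of the geodesic with initial velocity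
`(u₀, ρ₀)`. -/
def speed (u₀ ρ₀ : ℝ → ℝ) : ℝ :=
  Real.sqrt (1 / 4 * ∫ x in (0 : ℝ)..1, (deriv u₀ x ^ 2 + ρ₀ x ^ 2))

end HunterSaxton

end

/-!
Write `φ(t, x)` for the flow of `u` and `z = u_x + i ρ`. Differentiating the equation for `u` once
in space turns the nonlocal term into the constant `½ ∫ (u_x² + ρ²) = 2 c²`, which is conserved
(`ClassicalSolution.energy_eq`), and the system becomes the Riccati equation `z_t + u z_x = -½ z² -
2 c²`. In Lagrangian coordinates it is linearized by `z(φ) = 2 w' / w`, where `w'' = -c² w`: the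
system is the geodesic flow of a sphere, and `w` runs on a great circle. So `w` is an explicit
combination of `cos (c t)` and `sin (c t)` (`oscillator`), the Jacobian of the flow is `φ_x = |w|²`
(`jac`), and `φ` itself is explicit (`flow`). That a given solution obeys these formulas is shown
without constructing its flow: the explicit `φ` and `w` are inserted into the solution, and the two
defects satisfy a linear system with zero initial values (`ClassicalSolution.defect_eq_zero`).

Since `w · z(φ) = 2 w'`, and `w` and `w'` have no common zero, `w` does not vanish and `φ` stays a
diffeomorphism while the solution exists (`ClassicalSolution.lagrangian`). The functions `φ`, `φ_t` and `φ_x` are quadratic in `cos (c t)`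
and `sin (c t)`, hence have period `π / c` in time, and so has the solution
(`ClassicalSolution.eq_add_period`). In particular it has period `2 π / c`.

A solution on `[0, T)` with `π / c ≤ T < ∞` is therefore extended to `[0, T + π / c)` by starting
again from the initial values at the time `π / c` (`StrongSolution.restart`). If `T = π / c`, this
needs that `u` and `ρ`, as well as their time derivatives, converge to their initial values in the
Sobolev norms as `t` tends to `π / c` from the left. Now `u_x` and `ρ` are compositions of explicit
functions, which converge, with `φ⁻¹`, which tends to the identity. Composition with diffeomorphisms
close to the identity is continuous in `H^σ` for real `σ > 1/2` (`HTendsto.comp`): for `σ < 2` it is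
bounded, by interpolation between `L²` and `H²` (`NearId.sobSq_comp_le`), so that it suffices to
consider trigonometric polynomials, and higher orders are reached by differentiation. The time
derivatives then converge by the equations, and the limit of the derivative is the one-sided
derivative (`HasDerivInSobolev.hTendsto_left`).

If `c = 0`, conservation of energy shows that the solution vanishes.
-/

open Filter Topology
open scoped ENNReal

noncomputable section

namespace HunterSaxton

open MeasureTheory Set

/-! ### Fourier coefficients of continuous 1-periodic functions -/

/-- The character `x ↦ exp (2 π i n x)` of the circle of length one. -/
def mode (n : ℤ) (x : ℝ) : ℂ := Complex.exp (2 * Real.pi * Complex.I * n * x)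

/-- The `n`-th Fourier coefficient of a function on `[0, 1]`. -/
def coeff (f : ℝ → ℂ) (n : ℤ) : ℂ := fourierCoeffOn (zero_lt_one : (0 : ℝ) < 1) f n

/-- Continuous 1-periodic functions, that is, continuous functions on the circle. -/
def PerCont (f : ℝ → ℂ) : Prop := Continuous f ∧ Function.Periodic f 1

theorem continuous_mode (n : ℤ) : Continuous (mode n) := by
  unfold mode; fun_prop

theorem norm_mode (n : ℤ) (x : ℝ) : ‖mode n x‖ = 1 := by
  unfold mode
  rw [show (2 * Real.pi * Complex.I * n * x : ℂ) = ((2 * Real.pi * n * x : ℝ) : ℂ) * Complex.I by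
    push_cast; ring, Complex.norm_exp_ofReal_mul_I]

theorem mode_mul (m n : ℤ) (x : ℝ) : mode m x * mode n x = mode (m + n) x := by
  unfold mode
  rw [← Complex.exp_add]; push_cast; congr 1; ring

theorem mode_zero (x : ℝ) : mode 0 x = 1 := by simp [mode]

theorem mode_periodic (n : ℤ) : Function.Periodic (mode n) 1 := by
  intro x
  have h := Complex.exp_int_mul_two_pi_mul_I n
  unfold mode
  rw [show (2 * Real.pi * Complex.I * n * ((x + 1 : ℝ) : ℂ) : ℂ) =
    2 * Real.pi * Complex.I * n * x + n * (2 * Real.pi * Complex.I) by push_cast; ring,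
    Complex.exp_add, h, mul_one]

theorem hasDerivAt_mode (n : ℤ) (x : ℝ) :
    HasDerivAt (mode n) (2 * Real.pi * Complex.I * n * mode n x) x := by
  unfold mode
  have h : HasDerivAt (fun y : ℝ => (2 * Real.pi * Complex.I * n * y : ℂ))
      (2 * Real.pi * Complex.I * n) x := by
    simpa using (Complex.ofRealCLM.hasDerivAt (x := x)).const_mul (2 * Real.pi * Complex.I * n : ℂ)
  simpa [mul_comm] using h.cexp

theorem coeff_eq (f : ℝ → ℂ) (n : ℤ) : coeff f n = ∫ x in (0 : ℝ)..1, mode (-n) x * f x := by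
  unfold coeff
  rw [fourierCoeffOn_eq_integral]
  simp only [sub_zero, div_one, one_smul]
  refine intervalIntegral.integral_congr fun x _ => ?_
  simp only [fourier_coe_apply]
  simp [mode]

theorem PerCont.add {f g : ℝ → ℂ} (hf : PerCont f) (hg : PerCont g) : PerCont (f + g) :=
  ⟨hf.1.add hg.1, hf.2.add hg.2⟩

theorem PerCont.sub {f g : ℝ → ℂ} (hf : PerCont f) (hg : PerCont g) : PerCont (f - g) :=
  ⟨hf.1.sub hg.1, hf.2.sub hg.2⟩

theorem PerCont.mul {f g : ℝ → ℂ} (hf : PerCont f) (hg : PerCont g) : PerCont (f * g) :=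
  ⟨hf.1.mul hg.1, hf.2.mul hg.2⟩

theorem PerCont.const (a : ℂ) : PerCont (fun _ => a) :=
  ⟨continuous_const, fun _ => rfl⟩

theorem PerCont.smul {f : ℝ → ℂ} (a : ℂ) (hf : PerCont f) : PerCont (a • f) :=
  ⟨hf.1.const_smul a, fun x => by simp [hf.2 x]⟩

/-- A continuous periodic function is bounded. -/
theorem PerCont.bounded {f : ℝ → ℂ} (hf : PerCont f) : ∃ C, ∀ x, ‖f x‖ ≤ C := by
  obtain ⟨C, hC⟩ := isCompact_Icc (a := (0 : ℝ)) (b := 1) |>.exists_bound_of_continuousOn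
    hf.1.continuousOn
  refine ⟨C, fun x => ?_⟩
  obtain ⟨y, hy, hxy⟩ := hf.2.exists_mem_Ico₀ one_pos x
  rw [hxy]
  exact hC y ⟨hy.1, hy.2.le⟩

theorem coeff_add {f g : ℝ → ℂ} (hf : Continuous f) (hg : Continuous g) (n : ℤ) :
    coeff (f + g) n = coeff f n + coeff g n := by
  simp only [coeff_eq, Pi.add_apply, mul_add]
  exact intervalIntegral.integral_add (((continuous_mode _).mul hf).intervalIntegrable _ _)
    (((continuous_mode _).mul hg).intervalIntegrable _ _)

theorem coeff_smul (a : ℂ) (f : ℝ → ℂ) (n : ℤ) : coeff (a • f) n = a * coeff f n := by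
  unfold coeff; rw [fourierCoeffOn.const_smul, smul_eq_mul]

theorem coeff_sub {f g : ℝ → ℂ} (hf : Continuous f) (hg : Continuous g) (n : ℤ) :
    coeff (f - g) n = coeff f n - coeff g n := by
  have : f - g = f + (-1 : ℂ) • g := by ext; simp [sub_eq_add_neg]
  rw [this, coeff_add hf (hg.const_smul _), coeff_smul]; ring

theorem norm_coeff_le {f : ℝ → ℂ} {C : ℝ} (h : ∀ x, ‖f x‖ ≤ C) (n : ℤ) : ‖coeff f n‖ ≤ C := by
  rw [coeff_eq]
  have := intervalIntegral.norm_integral_le_of_norm_le_const (a := (0 : ℝ)) (b := 1) (C := C)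
    (f := fun x => mode (-n) x * f x) (fun x _ => by rw [norm_mul, norm_mode, one_mul]; exact h x)
  simpa using this

theorem coeff_mode_mul (m n : ℤ) (f : ℝ → ℂ) :
    coeff (fun x => mode m x * f x) n = coeff f (n - m) := by
  simp only [coeff_eq, ← mul_assoc, mode_mul]
  congr 2; ext x; congr 2; ring

theorem coeff_mode (m n : ℤ) : coeff (mode m) n = if n = m then 1 else 0 := by
  rw [coeff_eq]
  simp only [mode_mul]
  split_ifs with h
  · subst h; simp [mode_zero]
  · have hk : (-n + m : ℤ) ≠ 0 := by lia
    set k := -n + m with hkdef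
    have hk' : (2 * Real.pi * Complex.I * k : ℂ) ≠ 0 := by
      simp [Real.pi_ne_zero, hk]
    have := intervalIntegral.integral_eq_sub_of_hasDerivAt (a := (0 : ℝ)) (b := 1)
      (fun x _ => hasDerivAt_mode k x)
      ((continuous_const.mul (continuous_mode k)).intervalIntegrable _ _)
    rw [intervalIntegral.integral_const_mul] at this
    have h1 : mode k 1 - mode k 0 = 0 := by
      have := mode_periodic k 0
      rw [zero_add] at this; rw [this, sub_self]
    rw [h1] at this
    exact (mul_eq_zero.mp this).resolve_left hk'

/-- Differentiation multiplies the `n`-th Fourier coefficient by `2 π i n`. -/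
theorem coeff_deriv {f f' : ℝ → ℂ} (hf : ∀ x, HasDerivAt f (f' x) x) (hp : Function.Periodic f 1)
    (hf' : Continuous f') (n : ℤ) : coeff f' n = 2 * Real.pi * Complex.I * n * coeff f n := by
  rw [coeff_eq, coeff_eq]
  have hfc : Continuous f := continuous_iff_continuousAt.2 fun x => (hf x).continuousAt
  have h := intervalIntegral.integral_deriv_mul_eq_sub (a := (0 : ℝ)) (b := 1)
    (u := mode (-n)) (v := f) (u' := fun x => 2 * Real.pi * Complex.I * (-n : ℤ) * mode (-n) x)
    (v' := f') (fun x _ => hasDerivAt_mode (-n) x) (fun x _ => hf x)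
    ((continuous_const.mul (continuous_mode (-n))).intervalIntegrable _ _)
    (hf'.intervalIntegrable _ _)
  have h0 : mode (-n) 1 * f 1 - mode (-n) 0 * f 0 = 0 := by
    have h1 := mode_periodic (-n) 0
    have h2 := hp 0
    rw [zero_add] at h1 h2; rw [h1, h2, sub_self]
  rw [h0, intervalIntegral.integral_add] at h
  · simp only [mul_assoc, intervalIntegral.integral_const_mul] at h ⊢
    push_cast at h
    linear_combination h
  · exact ((continuous_const.mul (continuous_mode (-n))).mul hfc).intervalIntegrable _ _
  · exact ((continuous_mode (-n)).mul hf').intervalIntegrable _ _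

/-- Parseval's identity. -/
theorem hasSum_sq_coeff {f : ℝ → ℂ} (hf : Continuous f) :
    HasSum (fun n => ‖coeff f n‖ ^ 2) (∫ x in (0 : ℝ)..1, ‖f x‖ ^ 2) := by
  have h : MemLp f 2 (volume.restrict (Ioc 0 1)) := by
    have := isCompact_Icc (a := (0 : ℝ)) (b := 1) |>.exists_bound_of_continuousOn hf.continuousOn
    obtain ⟨C, hC⟩ := this
    refine MemLp.of_bound hf.aestronglyMeasurable C ?_
    exact (ae_restrict_iff' measurableSet_Ioc).2 (ae_of_all _ fun x hx => hC x ⟨hx.1.le, hx.2⟩)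
  simpa [coeff] using hasSum_sq_fourierCoeffOn (zero_lt_one : (0 : ℝ) < 1) h

/-- A continuous periodic function is determined by its Fourier coefficients. -/
theorem PerCont.ext {f g : ℝ → ℂ} (hf : PerCont f) (hg : PerCont g)
    (h : ∀ n, coeff f n = coeff g n) : f = g := by
  have hd : Continuous (f - g) := hf.1.sub hg.1
  have h0 : ∫ x in (0 : ℝ)..1, ‖(f - g) x‖ ^ 2 = 0 := by
    refine (hasSum_sq_coeff hd).unique ?_
    simp only [coeff_sub hf.1 hg.1, h, sub_self, norm_zero]
    simp [hasSum_zero]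
  have h1 : ∀ x ∈ Icc (0 : ℝ) 1, f x = g x := by
    intro x hx
    by_contra hne
    have : 0 < ∫ x in (0 : ℝ)..1, ‖(f - g) x‖ ^ 2 :=
      intervalIntegral.integral_pos one_pos (hd.norm.pow 2).continuousOn
        (fun _ _ => by positivity) ⟨x, hx, by
          have : (f - g) x ≠ 0 := sub_ne_zero.2 hne
          positivity⟩
    linarith
  ext x
  obtain ⟨n, hn⟩ : ∃ n : ℤ, n = ⌊x⌋ := ⟨_, rfl⟩
  have e1 : f (x - n) = f x := by simpa using hf.2.sub_zsmul_eq n (x := x)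
  have e2 : g (x - n) = g x := by simpa using hg.2.sub_zsmul_eq n (x := x)
  rw [← e1, ← e2]
  refine h1 _ ⟨?_, ?_⟩ <;> subst hn
  · linarith [Int.floor_le x]
  · linarith [Int.lt_floor_add_one x]

/-- An absolutely convergent trigonometric series defines a continuous periodic function with the
given Fourier coefficients. -/
theorem synthesis {a : ℤ → ℂ} (ha : Summable fun n => ‖a n‖) :
    PerCont (fun x => ∑' n, a n * mode n x) ∧
      ∀ n, coeff (fun x => ∑' n, a n * mode n x) n = a n := by
  have hc : Continuous (fun x => ∑' n, a n * mode n x) :=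
    continuous_tsum (fun n => continuous_const.mul (continuous_mode n)) ha
      (fun n x => by rw [norm_mul, norm_mode, mul_one])
  refine ⟨⟨hc, fun x => ?_⟩, fun n => ?_⟩
  · simp only [mode_periodic _ x]
  · rw [coeff_eq]
    have hs : HasSum (fun m => ∫ x in (0 : ℝ)..1, mode (-n) x * (a m * mode m x))
        (∫ x in (0 : ℝ)..1, mode (-n) x * ∑' m, a m * mode m x) := by
      refine intervalIntegral.hasSum_integral_of_dominated_convergence (fun m _ => ‖a m‖)
        (fun m => (((continuous_mode _).mul
          (continuous_const.mul (continuous_mode m))).aestronglyMeasurable)) ?_ ?_ ?_ ?_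
      · exact fun m => ae_of_all _ fun x _ => by simp [norm_mode]
      · exact ae_of_all _ fun x _ => ha
      · exact intervalIntegrable_const
      · refine ae_of_all _ fun x _ => HasSum.mul_left _ (Summable.hasSum ?_)
        exact Summable.of_norm (by simpa [norm_mode] using ha)
    have hv : ∀ m, ∫ x in (0 : ℝ)..1, mode (-n) x * (a m * mode m x) =
        if m = n then a n else 0 := by
      intro m
      have := coeff_mode m n
      rw [coeff_eq] at this
      simp only [mul_left_comm _ (a m), intervalIntegral.integral_const_mul, this]
      by_cases h : n = m
      · simp [h]
      · simp [h, Ne.symm h]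
    simp only [hv] at hs
    exact hs.unique (hasSum_ite_eq n (a n))

/-- Fourier inversion for an absolutely convergent Fourier series. -/
theorem PerCont.hasSum {f : ℝ → ℂ} (hf : PerCont f) (hs : Summable fun n => ‖coeff f n‖) (x : ℝ) :
    HasSum (fun n => coeff f n * mode n x) (f x) := by
  obtain ⟨h1, h2⟩ := synthesis hs
  have := congrFun (hf.ext h1 fun n => (h2 n).symm) x
  rw [this]
  exact (Summable.of_norm (by simpa [norm_mode] using hs)).hasSum

/-- Termwise differentiation of a Fourier series. -/
theorem hasDerivAt_tsum_mode {a : ℤ → ℂ} (ha : Summable fun n => ‖a n‖)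
    (ha' : Summable fun n : ℤ => ‖2 * Real.pi * Complex.I * n * a n‖) (x : ℝ) :
    HasDerivAt (fun x => ∑' n, a n * mode n x)
      (∑' n : ℤ, 2 * Real.pi * Complex.I * n * a n * mode n x) x := by
  refine hasDerivAt_tsum (g := fun n x => a n * mode n x)
    (g' := fun n x => 2 * Real.pi * Complex.I * n * a n * mode n x) ha' (fun n y => ?_)
    (fun n y => by rw [norm_mul, norm_mode, mul_one]) (y₀ := 0)
    (Summable.of_norm (by simpa [norm_mode] using ha)) x
  exact ((hasDerivAt_mode n y).const_mul (a n)).congr_deriv (by ring)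

/-! ### Sobolev norms -/

/-- The weight `(1 + n²)^σ` of the `H^σ` norm. -/
def wt (σ : ℝ) (n : ℤ) : ℝ≥0∞ := ENNReal.ofReal ((1 + (n : ℝ) ^ 2) ^ σ)

/-- Squared `H^σ` norm of a complex-valued function; for real-valued functions it is
`sobolevNormSq`. -/
def sobSq (σ : ℝ) (f : ℝ → ℂ) : ℝ≥0∞ := ∑' n, wt σ n * ‖coeff f n‖ₑ ^ 2

theorem one_le_base (n : ℤ) : (1 : ℝ) ≤ 1 + (n : ℝ) ^ 2 := by nlinarith [sq_nonneg (n : ℝ)]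

theorem wt_add (σ τ : ℝ) (n : ℤ) : wt (σ + τ) n = wt σ n * wt τ n := by
  unfold wt
  have := one_le_base n
  rw [Real.rpow_add (by linarith), ENNReal.ofReal_mul (by positivity)]

theorem wt_zero (n : ℤ) : wt 0 n = 1 := by simp [wt]

theorem wt_ne_top (σ : ℝ) (n : ℤ) : wt σ n ≠ ⊤ := ENNReal.ofReal_ne_top

theorem wt_pos (σ : ℝ) (n : ℤ) : 0 < wt σ n := by
  unfold wt
  have := one_le_base n
  exact ENNReal.ofReal_pos.2 (by positivity)

theorem wt_mono {σ τ : ℝ} (h : σ ≤ τ) (n : ℤ) : wt σ n ≤ wt τ n :=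
  ENNReal.ofReal_le_ofReal (Real.rpow_le_rpow_of_exponent_le (one_le_base n) h)

theorem wt_one (n : ℤ) : wt 1 n = 1 + ‖(n : ℂ)‖ₑ ^ 2 := by
  unfold wt
  rw [Real.rpow_one, ENNReal.ofReal_add (by norm_num) (by positivity), ENNReal.ofReal_one,
    ← ofReal_norm, ← ENNReal.ofReal_pow (norm_nonneg _)]
  congr 2
  rw [Complex.norm_intCast, sq_abs]

theorem ennreal_add_sq_le (a b : ℝ≥0∞) : (a + b) ^ 2 ≤ 2 * (a ^ 2 + b ^ 2) := by
  by_cases ha : a = ⊤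
  · simp [ha]
  by_cases hb : b = ⊤
  · simp [hb]
  lift a to NNReal using ha
  lift b to NNReal using hb
  have := add_sq_le (a := a) (b := b)
  exact_mod_cast this

theorem enorm_add_sq_le (a b : ℂ) : ‖a + b‖ₑ ^ 2 ≤ 2 * ‖a‖ₑ ^ 2 + 2 * ‖b‖ₑ ^ 2 := by
  rw [← mul_add]
  refine le_trans ?_ (ennreal_add_sq_le _ _)
  gcongr
  exact enorm_add_le a b

theorem sobSq_add_le {f g : ℝ → ℂ} (hf : Continuous f) (hg : Continuous g) (σ : ℝ) :
    sobSq σ (f + g) ≤ 2 * sobSq σ f + 2 * sobSq σ g := by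
  unfold sobSq
  rw [← ENNReal.tsum_mul_left, ← ENNReal.tsum_mul_left, ← ENNReal.tsum_add]
  refine ENNReal.tsum_le_tsum fun n => ?_
  rw [coeff_add hf hg]
  calc _ ≤ wt σ n * (2 * ‖coeff f n‖ₑ ^ 2 + 2 * ‖coeff g n‖ₑ ^ 2) := by
        gcongr; exact enorm_add_sq_le _ _
    _ = _ := by ring

theorem sobSq_smul (σ : ℝ) (a : ℂ) (f : ℝ → ℂ) : sobSq σ (a • f) = ‖a‖ₑ ^ 2 * sobSq σ f := by
  unfold sobSq
  rw [← ENNReal.tsum_mul_left]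
  congr 1; ext n
  rw [coeff_smul, enorm_mul]; ring

theorem sobSq_sub_le {f g : ℝ → ℂ} (hf : Continuous f) (hg : Continuous g) (σ : ℝ) :
    sobSq σ (f - g) ≤ 2 * sobSq σ f + 2 * sobSq σ g := by
  have : f - g = f + (-1 : ℂ) • g := by ext; simp [sub_eq_add_neg]
  rw [this]
  refine (sobSq_add_le hf (hg.const_smul _) σ).trans ?_
  rw [sobSq_smul]; simp

theorem sobSq_mono {σ τ : ℝ} (h : σ ≤ τ) (f : ℝ → ℂ) : sobSq σ f ≤ sobSq τ f :=
  ENNReal.tsum_le_tsum fun n => by gcongr; exact wt_mono h n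

theorem sobSq_zero_eq {f : ℝ → ℂ} (hf : Continuous f) :
    sobSq 0 f = ENNReal.ofReal (∫ x in (0 : ℝ)..1, ‖f x‖ ^ 2) := by
  have h := hasSum_sq_coeff hf
  rw [← h.tsum_eq, ENNReal.ofReal_tsum_of_nonneg (fun _ => by positivity) h.summable]
  unfold sobSq
  congr 1; ext n
  rw [wt_zero, one_mul, ← ofReal_norm, ENNReal.ofReal_pow (norm_nonneg _)]

/-- The square of the factor `2 π` relating the norms of a function and its derivative. -/
def fourPiSq : ℝ≥0∞ := ‖(2 * Real.pi * Complex.I : ℂ)‖ₑ ^ 2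

theorem fourPiSq_ne_top : fourPiSq ≠ ⊤ := ENNReal.pow_ne_top enorm_ne_top

theorem fourPiSq_ne_zero : fourPiSq ≠ 0 := by simp [fourPiSq, Real.pi_ne_zero]

theorem sobSq_deriv {f f' : ℝ → ℂ} (hf : ∀ x, HasDerivAt f (f' x) x) (hp : Function.Periodic f 1)
    (hf' : Continuous f') (σ : ℝ) :
    sobSq σ f' = fourPiSq * ∑' n : ℤ, wt σ n * (‖(n : ℂ)‖ₑ ^ 2 * ‖coeff f n‖ₑ ^ 2) := by
  unfold sobSq fourPiSq
  rw [← ENNReal.tsum_mul_left]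
  congr 1; ext n
  rw [coeff_deriv hf hp hf', enorm_mul, enorm_mul]; ring

theorem sobSq_succ {f f' : ℝ → ℂ} (hf : ∀ x, HasDerivAt f (f' x) x) (hp : Function.Periodic f 1)
    (hf' : Continuous f') (σ : ℝ) :
    sobSq (σ + 1) f = sobSq σ f + fourPiSq⁻¹ * sobSq σ f' := by
  rw [sobSq_deriv hf hp hf', ← mul_assoc,
    ENNReal.inv_mul_cancel fourPiSq_ne_zero fourPiSq_ne_top, one_mul]
  unfold sobSq
  rw [← ENNReal.tsum_add]
  congr 1; ext n
  rw [wt_add, wt_one]; ring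

theorem sobSq_deriv_le {f f' : ℝ → ℂ} (hf : ∀ x, HasDerivAt f (f' x) x)
    (hp : Function.Periodic f 1) (hf' : Continuous f') (σ : ℝ) :
    sobSq σ f' ≤ fourPiSq * sobSq (σ + 1) f := by
  rw [sobSq_succ hf hp hf', mul_add, ← mul_assoc,
    ENNReal.mul_inv_cancel fourPiSq_ne_zero fourPiSq_ne_top, one_mul]
  exact le_add_self

/-! ### Summability of Fourier coefficients and the sup norm -/

/-- Cauchy-Schwarz for sums in `[0, ∞]`. -/
theorem tsum_mul_sq_le (a b : ℤ → ℝ≥0∞) :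
    (∑' n, a n * b n) ^ 2 ≤ (∑' n, a n ^ 2) * ∑' n, b n ^ 2 := by
  have h := ENNReal.lintegral_mul_le_Lp_mul_Lq (Measure.count : Measure ℤ)
    (p := 2) (q := 2) Real.HolderConjugate.two_two
    (f := a) (g := b) (measurable_of_countable _).aemeasurable
    (measurable_of_countable _).aemeasurable
  simp only [Pi.mul_apply, lintegral_count, ENNReal.rpow_two] at h
  calc _ ≤ ((∑' n, a n ^ 2) ^ (1 / 2 : ℝ) * (∑' n, b n ^ 2) ^ (1 / 2 : ℝ)) ^ 2 := by gcongr
    _ = _ := by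
      rw [mul_pow, ← ENNReal.rpow_two, ← ENNReal.rpow_two, ← ENNReal.rpow_mul, ← ENNReal.rpow_mul]
      norm_num

/-- The sum of `(1 + n²)^(-σ)`, the square of the constant of the embedding of `H^σ` into the
functions with absolutely convergent Fourier series. -/
def wienerConst (σ : ℝ) : ℝ≥0∞ := ∑' n, wt (-σ) n

theorem wienerConst_ne_top {σ : ℝ} (hσ : 1 / 2 < σ) : wienerConst σ ≠ ⊤ := by
  have h : Summable fun n : ℤ => (1 + (n : ℝ) ^ 2) ^ (-σ) := by
    refine Summable.of_norm_bounded_eventually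
      (Real.summable_abs_int_rpow (b := 2 * σ) (by linarith)) ?_
    filter_upwards [(Set.finite_singleton (0 : ℤ)).compl_mem_cofinite] with n hn
    have hn0 : (n : ℝ) ≠ 0 := by exact_mod_cast hn
    have h1 : (0 : ℝ) < |(n : ℝ)| := abs_pos.2 hn0
    have := one_le_base n
    rw [Real.norm_of_nonneg (by positivity)]
    calc (1 + (n : ℝ) ^ 2) ^ (-σ) ≤ (|(n : ℝ)| ^ 2) ^ (-σ) := by
          rw [sq_abs]
          exact Real.rpow_le_rpow_of_nonpos (by positivity) (by linarith) (by linarith)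
      _ = |(n : ℝ)| ^ (-(2 * σ)) := by
          rw [← Real.rpow_two, ← Real.rpow_mul h1.le]; congr 1; ring
  unfold wienerConst wt
  rw [← ENNReal.ofReal_tsum_of_nonneg (fun n => by
    have := one_le_base n; positivity) h]
  exact ENNReal.ofReal_ne_top

theorem tsum_enorm_sq_le (σ : ℝ) (a : ℤ → ℝ≥0∞) :
    (∑' n, a n) ^ 2 ≤ wienerConst σ * ∑' n, wt σ n * a n ^ 2 := by
  have h := tsum_mul_sq_le (fun n => wt (-σ / 2) n) (fun n => wt (σ / 2) n * a n)
  have h1 : ∀ n, wt (-σ / 2) n * (wt (σ / 2) n * a n) = a n := fun n => by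
    rw [← mul_assoc, ← wt_add]; norm_num [neg_div, wt_zero]
  have h2 : ∀ n, wt (-σ / 2) n ^ 2 = wt (-σ) n := fun n => by
    rw [sq, ← wt_add]; congr 1; ring
  have h3 : ∀ n, (wt (σ / 2) n * a n) ^ 2 = wt σ n * a n ^ 2 := fun n => by
    rw [mul_pow, sq, ← wt_add]; congr 2; ring
  simp only [h1, h2, h3] at h
  exact h

theorem tsum_enorm_coeff_sq_le (σ : ℝ) (f : ℝ → ℂ) :
    (∑' n, ‖coeff f n‖ₑ) ^ 2 ≤ wienerConst σ * sobSq σ f := tsum_enorm_sq_le σ _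

theorem summable_of_tsum_enorm {a : ℤ → ℂ} (h : ∑' n, ‖a n‖ₑ ≠ ⊤) : Summable fun n => ‖a n‖ := by
  have := ENNReal.summable_toReal h
  simpa using this

theorem summable_coeff {σ : ℝ} (hσ : 1 / 2 < σ) {f : ℝ → ℂ} (hf : sobSq σ f < ⊤) :
    Summable fun n => ‖coeff f n‖ := by
  refine summable_of_tsum_enorm fun h => ?_
  have h1 := tsum_enorm_coeff_sq_le σ f
  rw [h] at h1
  have : wienerConst σ * sobSq σ f < ⊤ := ENNReal.mul_lt_top (wienerConst_ne_top hσ).lt_top hf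
  simp at h1
  exact this.ne h1

/-- The embedding of `H^σ`, `σ > 1/2`, into the continuous functions. -/
theorem enorm_sq_le {σ : ℝ} (hσ : 1 / 2 < σ) {f : ℝ → ℂ} (hf : PerCont f) (x : ℝ) :
    ‖f x‖ₑ ^ 2 ≤ wienerConst σ * sobSq σ f := by
  by_cases hN : sobSq σ f = ⊤
  · have : wienerConst σ ≠ 0 := by
      intro h
      exact (wt_pos (-σ) 0).ne' (ENNReal.tsum_eq_zero.1 h 0)
    rw [hN, ENNReal.mul_top this]; exact le_top
  refine le_trans ?_ (tsum_enorm_coeff_sq_le σ f)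
  have h := hf.hasSum (summable_coeff hσ (lt_top_iff_ne_top.2 hN)) x
  gcongr
  rw [← h.tsum_eq]
  refine enorm_tsum_le_tsum_enorm.trans ?_
  refine ENNReal.tsum_le_tsum fun n => ?_
  rw [enorm_mul, ← ofReal_norm (mode n x), norm_mode, ENNReal.ofReal_one, mul_one]

/-- Functions in `H^σ`, `σ > 3/2`, are continuously differentiable. -/
theorem PerCont.exists_deriv {σ : ℝ} (hσ : 3 / 2 < σ) {f : ℝ → ℂ} (hf : PerCont f)
    (hN : sobSq σ f < ⊤) : ∃ f', PerCont f' ∧ ∀ x, HasDerivAt f (f' x) x := by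
  have h1 : ∑' n : ℤ, ‖2 * Real.pi * Complex.I * n * coeff f n‖ₑ ≠ ⊤ := by
    intro h
    have h1 := tsum_enorm_sq_le (σ - 1)
      (fun n : ℤ => ‖2 * Real.pi * Complex.I * n * coeff f n‖ₑ)
    have h2 : ∑' n : ℤ, wt (σ - 1) n * ‖2 * Real.pi * Complex.I * n * coeff f n‖ₑ ^ 2 ≤
        fourPiSq * sobSq σ f := by
      unfold sobSq fourPiSq
      rw [← ENNReal.tsum_mul_left]
      refine ENNReal.tsum_le_tsum fun n => ?_
      have : wt σ n = wt (σ - 1) n * (1 + ‖(n : ℂ)‖ₑ ^ 2) := by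
        rw [← wt_one, ← wt_add]; congr 1; ring
      rw [this, enorm_mul, enorm_mul]
      calc _ = ‖(2 * Real.pi * Complex.I : ℂ)‖ₑ ^ 2 *
            (wt (σ - 1) n * ‖(n : ℂ)‖ₑ ^ 2 * ‖coeff f n‖ₑ ^ 2) := by ring
        _ ≤ _ := by gcongr; exact le_add_self
    rw [h] at h1
    have h3 : wienerConst (σ - 1) * (fourPiSq * sobSq σ f) < ⊤ :=
      ENNReal.mul_lt_top (wienerConst_ne_top (by linarith)).lt_top
        (ENNReal.mul_lt_top fourPiSq_ne_top.lt_top hN)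
    have h4 := h1.trans (mul_le_mul_right h2 _)
    simp at h4
    exact h3.ne h4
  have hs := summable_coeff (by linarith) hN
  have hs' := summable_of_tsum_enorm h1
  have hfe : f = fun x => ∑' n, coeff f n * mode n x :=
    funext fun x => (hf.hasSum hs x).tsum_eq.symm
  refine ⟨_, (synthesis hs').1, fun x => ?_⟩
  have := hasDerivAt_tsum_mode hs hs' x
  rwa [← hfe] at this

/-! ### The algebra property -/

theorem coeff_mul {f g : ℝ → ℂ} (hf : PerCont f) (hg : Continuous g)
    (hs : Summable fun n => ‖coeff f n‖) (n : ℤ) :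
    HasSum (fun m => coeff f m * coeff g (n - m)) (coeff (f * g) n) := by
  obtain ⟨C, hC⟩ := isCompact_Icc (a := (0 : ℝ)) (b := 1) |>.exists_bound_of_continuousOn
    hg.continuousOn
  have h : HasSum (fun m => ∫ x in (0 : ℝ)..1, mode (-n) x * (coeff f m * mode m x * g x))
      (∫ x in (0 : ℝ)..1, mode (-n) x * (f * g) x) := by
    refine intervalIntegral.hasSum_integral_of_dominated_convergence
      (fun m _ => ‖coeff f m‖ * C)
      (fun m => (((continuous_mode _).mul
        ((continuous_const.mul (continuous_mode m)).mul hg)).aestronglyMeasurable)) ?_ ?_ ?_ ?_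
    · refine fun m => ae_of_all _ fun x hx => ?_
      rw [uIoc_of_le zero_le_one] at hx
      simp only [norm_mul, norm_mode, one_mul, mul_one]
      gcongr
      exact hC x ⟨hx.1.le, hx.2⟩
    · exact ae_of_all _ fun x _ => hs.mul_right C
    · exact intervalIntegrable_const
    · exact ae_of_all _ fun x _ => ((hf.hasSum hs x).mul_right (g x)).mul_left _
  rw [coeff_eq]
  convert h using 2 with m
  rw [← coeff_mode_mul, coeff_eq (fun x => mode m x * g x), ← intervalIntegral.integral_const_mul]
  congr 1; ext x; ring

/-- Young's inequality: convolution maps `ℓ¹ × ℓ²` into `ℓ²`. -/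
theorem tsum_conv_sq_le (a b : ℤ → ℝ≥0∞) :
    ∑' n, (∑' m, a m * b (n - m)) ^ 2 ≤ (∑' m, a m) ^ 2 * ∑' k, b k ^ 2 := by
  have h : ∀ n, (∑' m, a m * b (n - m)) ^ 2 ≤ (∑' m, a m) * ∑' m, a m * b (n - m) ^ 2 := by
    intro n
    have h := tsum_mul_sq_le (fun m => a m ^ (1 / 2 : ℝ)) (fun m => a m ^ (1 / 2 : ℝ) * b (n - m))
    have e : ∀ m, a m ^ (1 / 2 : ℝ) * a m ^ (1 / 2 : ℝ) = a m := fun m => by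
      rw [← ENNReal.rpow_add_of_nonneg _ _ (by norm_num) (by norm_num)]; norm_num
    simpa only [← mul_assoc, mul_pow, sq (_ ^ (1 / 2 : ℝ)), e] using h
  calc _ ≤ ∑' n, (∑' m, a m) * ∑' m, a m * b (n - m) ^ 2 := ENNReal.tsum_le_tsum h
    _ = (∑' m, a m) * ∑' m, a m * ∑' n, b (n - m) ^ 2 := by
      rw [ENNReal.tsum_mul_left, ENNReal.tsum_comm]
      simp only [ENNReal.tsum_mul_left]
    _ = _ := by
      have : ∀ m : ℤ, ∑' n, b (n - m) ^ 2 = ∑' k, b k ^ 2 := fun m =>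
        (Equiv.subRight m).tsum_eq (fun k => b k ^ 2)
      simp only [this, ENNReal.tsum_mul_right]
      ring

theorem conv_comm (a b : ℤ → ℝ≥0∞) (n : ℤ) : ∑' m, a m * b (n - m) = ∑' m, b m * a (n - m) := by
  rw [← (Equiv.subLeft n).tsum_eq]
  simp [mul_comm]

/-- The factor of the quasi-triangle inequality `wt_sub_le` for the weights `(1 + n²)^σ`. -/
def quasiConst (σ : ℝ) : ℝ≥0∞ := ENNReal.ofReal (4 ^ σ)

theorem wt_sub_le {σ : ℝ} (hσ : 0 ≤ σ) (n m : ℤ) :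
    wt σ n ≤ quasiConst σ * (wt σ m + wt σ (n - m)) := by
  unfold wt quasiConst
  have h1 := one_le_base m
  have h2 := one_le_base (n - m)
  have h3 := one_le_base n
  rw [← ENNReal.ofReal_add (by positivity) (by positivity), ← ENNReal.ofReal_mul (by positivity)]
  refine ENNReal.ofReal_le_ofReal ?_
  have key : 1 + (n : ℝ) ^ 2 ≤ 2 * (1 + (m : ℝ) ^ 2) + 2 * (1 + ((n - m : ℤ) : ℝ) ^ 2) := by
    push_cast
    nlinarith [sq_nonneg ((n : ℝ) - 2 * m)]
  rcases le_total (1 + (m : ℝ) ^ 2) (1 + ((n - m : ℤ) : ℝ) ^ 2) with h | h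
  · calc (1 + (n : ℝ) ^ 2) ^ σ ≤ (4 * (1 + ((n - m : ℤ) : ℝ) ^ 2)) ^ σ :=
          Real.rpow_le_rpow (by positivity) (by linarith) hσ
      _ = 4 ^ σ * (1 + ((n - m : ℤ) : ℝ) ^ 2) ^ σ := Real.mul_rpow (by norm_num) (by positivity)
      _ ≤ _ := by gcongr; linarith [show 0 ≤ (1 + (m : ℝ) ^ 2) ^ σ by positivity]
  · calc (1 + (n : ℝ) ^ 2) ^ σ ≤ (4 * (1 + (m : ℝ) ^ 2)) ^ σ :=
          Real.rpow_le_rpow (by positivity) (by linarith) hσ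
      _ = 4 ^ σ * (1 + (m : ℝ) ^ 2) ^ σ := Real.mul_rpow (by norm_num) (by positivity)
      _ ≤ _ := by
          gcongr; linarith [show 0 ≤ (1 + ((n - m : ℤ) : ℝ) ^ 2) ^ σ by positivity]

/-- The constant of the algebra property of `H^σ`. -/
def algConst (σ : ℝ) : ℝ≥0∞ := 4 * quasiConst (σ / 2) ^ 2 * wienerConst σ

theorem algConst_ne_top {σ : ℝ} (hσ : 1 / 2 < σ) : algConst σ ≠ ⊤ := by
  unfold algConst quasiConst
  exact ENNReal.mul_ne_top (ENNReal.mul_ne_top (by norm_num)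
    (ENNReal.pow_ne_top ENNReal.ofReal_ne_top)) (wienerConst_ne_top hσ)

/-- `H^σ` is an algebra for `σ > 1/2`. -/
theorem sobSq_mul_le {σ : ℝ} (hσ : 1 / 2 < σ) {f g : ℝ → ℂ} (hf : PerCont f) (hg : PerCont g)
    (hfN : sobSq σ f < ⊤) : sobSq σ (f * g) ≤ algConst σ * (sobSq σ f * sobSq σ g) := by
  set a : ℤ → ℝ≥0∞ := fun n => ‖coeff f n‖ₑ with ha
  set b : ℤ → ℝ≥0∞ := fun n => ‖coeff g n‖ₑ with hb
  set W : ℤ → ℝ≥0∞ := wt (σ / 2) with hW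
  have hW2 : ∀ n, wt σ n = W n ^ 2 := fun n => by rw [hW, sq, ← wt_add]; congr 1; ring
  have hC : ∀ n, ‖coeff (f * g) n‖ₑ ≤ ∑' m, a m * b (n - m) := fun n => by
    rw [← (coeff_mul hf hg.1 (summable_coeff hσ hfN) n).tsum_eq]
    refine enorm_tsum_le_tsum_enorm.trans ?_
    simp [ha, hb, enorm_mul]
  have hstep : ∀ n, wt σ n * ‖coeff (f * g) n‖ₑ ^ 2 ≤ 2 * quasiConst (σ / 2) ^ 2 *
      ((∑' m, b m * (W (n - m) * a (n - m))) ^ 2 + (∑' m, a m * (W (n - m) * b (n - m))) ^ 2) := by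
    intro n
    have h1 : W n * ‖coeff (f * g) n‖ₑ ≤ quasiConst (σ / 2) *
        ((∑' m, b m * (W (n - m) * a (n - m))) + ∑' m, a m * (W (n - m) * b (n - m))) := by
      calc _ ≤ W n * ∑' m, a m * b (n - m) := by gcongr; exact hC n
        _ = ∑' m, W n * (a m * b (n - m)) := ENNReal.tsum_mul_left.symm
        _ ≤ ∑' m, quasiConst (σ / 2) * (W m * a m * b (n - m) + a m * (W (n - m) * b (n - m))) := by
            refine ENNReal.tsum_le_tsum fun m => ?_
            calc _ ≤ quasiConst (σ / 2) * (W m + W (n - m)) * (a m * b (n - m)) := by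
                  gcongr; exact wt_sub_le (by linarith) n m
              _ = _ := by ring
        _ = _ := by
            rw [ENNReal.tsum_mul_left, ENNReal.tsum_add,
              conv_comm (fun m => W m * a m) b]
    calc _ = (W n * ‖coeff (f * g) n‖ₑ) ^ 2 := by rw [hW2]; ring
      _ ≤ (quasiConst (σ / 2) *
        ((∑' m, b m * (W (n - m) * a (n - m))) + ∑' m, a m * (W (n - m) * b (n - m)))) ^ 2 := by
          gcongr
      _ = quasiConst (σ / 2) ^ 2 *
        ((∑' m, b m * (W (n - m) * a (n - m))) + ∑' m, a m * (W (n - m) * b (n - m))) ^ 2 := by ring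
      _ ≤ quasiConst (σ / 2) ^ 2 * (2 * ((∑' m, b m * (W (n - m) * a (n - m))) ^ 2 +
            (∑' m, a m * (W (n - m) * b (n - m))) ^ 2)) := by
          gcongr
          exact ennreal_add_sq_le _ _
      _ = _ := by ring
  have hNa : ∑' k, (W k * a k) ^ 2 = sobSq σ f := by
    unfold sobSq; congr 1; ext n; rw [hW2, mul_pow]
  have hNb : ∑' k, (W k * b k) ^ 2 = sobSq σ g := by
    unfold sobSq; congr 1; ext n; rw [hW2, mul_pow]
  calc sobSq σ (f * g) ≤ ∑' n, 2 * quasiConst (σ / 2) ^ 2 *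
      ((∑' m, b m * (W (n - m) * a (n - m))) ^ 2 + (∑' m, a m * (W (n - m) * b (n - m))) ^ 2) :=
        ENNReal.tsum_le_tsum hstep
    _ = 2 * quasiConst (σ / 2) ^ 2 * (∑' n, (∑' m, b m * (W (n - m) * a (n - m))) ^ 2 +
          ∑' n, (∑' m, a m * (W (n - m) * b (n - m))) ^ 2) := by
        rw [ENNReal.tsum_mul_left, ENNReal.tsum_add]
    _ ≤ 2 * quasiConst (σ / 2) ^ 2 * ((∑' m, b m) ^ 2 * ∑' k, (W k * a k) ^ 2 +
          (∑' m, a m) ^ 2 * ∑' k, (W k * b k) ^ 2) := by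
        gcongr
        · exact tsum_conv_sq_le b (fun k => W k * a k)
        · exact tsum_conv_sq_le a (fun k => W k * b k)
    _ ≤ 2 * quasiConst (σ / 2) ^ 2 * ((wienerConst σ * sobSq σ g) * sobSq σ f +
          (wienerConst σ * sobSq σ f) * sobSq σ g) := by
        rw [hNa, hNb]
        gcongr
        · exact tsum_enorm_coeff_sq_le σ g
        · exact tsum_enorm_coeff_sq_le σ f
    _ = _ := by unfold algConst; ring

/-! ### Interpolation between `L²` and `H²` -/

theorem enorm_sq_eq (z : ℂ) : ‖z‖ₑ ^ 2 = ENNReal.ofReal (‖z‖ ^ 2) := by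
  rw [← ofReal_norm, ENNReal.ofReal_pow (norm_nonneg _)]

theorem wt_two (n : ℤ) : wt 2 n = ENNReal.ofReal ((1 + (n : ℝ) ^ 2) ^ 2) := by
  unfold wt; rw [Real.rpow_two]

/-- The `K`-functional `inf (‖f₀‖² + r⁻¹ ‖f₁‖²)` over the decompositions `f = f₀ + f₁` with
`f₀` in `L²` and `f₁` in `H²`, which is computed frequency by frequency. -/
def kFun (r : ℝ) (f : ℝ → ℂ) : ℝ≥0∞ :=
  ∑' n : ℤ, ENNReal.ofReal ((1 + (n : ℝ) ^ 2) ^ 2 / (r + (1 + (n : ℝ) ^ 2) ^ 2)) *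
    ‖coeff f n‖ₑ ^ 2

/-- The intermediate Sobolev norms are integrals of the `K`-functional. -/
theorem exists_sobSq_eq_lintegral {σ : ℝ} (h0 : 0 < σ) (h2 : σ < 2) :
    ∃ K : ℝ≥0∞, ∀ f, sobSq σ f =
      K * ∫⁻ r in Ioi (0 : ℝ), ENNReal.ofReal (r ^ (σ / 2 - 1)) * kFun r f := by
  have hp : σ / 2 ∈ Ioo (0 : ℝ) 1 := ⟨by linarith, by linarith⟩
  refine ⟨ENNReal.ofReal (∫ t in Ioi (0 : ℝ), Real.rpowIntegrand₀₁ (σ / 2) t 1)⁻¹, fun f => ?_⟩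
  set A := (∫ t in Ioi (0 : ℝ), Real.rpowIntegrand₀₁ (σ / 2) t 1)⁻¹ with hA
  have ha : ∀ n : ℤ, (0 : ℝ) ≤ (1 + (n : ℝ) ^ 2) ^ 2 := fun n => by positivity
  have hA0 : 0 ≤ A := by
    refine inv_nonneg.2 (setIntegral_nonneg measurableSet_Ioi fun t ht => ?_)
    exact Real.rpowIntegrand₀₁_nonneg hp.1 (le_of_lt ht) zero_le_one
  have hw : ∀ n : ℤ, wt σ n = ENNReal.ofReal A *
      ∫⁻ r in Ioi (0 : ℝ),
        ENNReal.ofReal (Real.rpowIntegrand₀₁ (σ / 2) r ((1 + (n : ℝ) ^ 2) ^ 2)) := by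
    intro n
    rw [← ofReal_integral_eq_lintegral_ofReal (Real.integrableOn_rpowIntegrand₀₁_Ioi hp (ha n))
      ((ae_restrict_iff' measurableSet_Ioi).2 (ae_of_all _ fun t ht =>
        Real.rpowIntegrand₀₁_nonneg hp.1 (le_of_lt ht) (ha n))), ← ENNReal.ofReal_mul hA0,
      ← Real.rpow_eq_const_mul_integral hp (ha n)]
    have := one_le_base n
    unfold wt
    rw [← Real.rpow_natCast (1 + (n : ℝ) ^ 2) 2, ← Real.rpow_mul (by linarith)]
    congr 2; push_cast; ring
  unfold sobSq
  simp only [hw, mul_assoc, ENNReal.tsum_mul_left]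
  congr 1
  have hmeas : ∀ n : ℤ, AEMeasurable (fun r => ENNReal.ofReal
      (Real.rpowIntegrand₀₁ (σ / 2) r ((1 + (n : ℝ) ^ 2) ^ 2))) (volume.restrict (Ioi 0)) :=
    fun n => (Real.aestronglyMeasurable_rpowIntegrand₀₁ hp (ha n)).aemeasurable.ennreal_ofReal
  have h1 : ∀ n : ℤ, (∫⁻ r in Ioi (0 : ℝ), ENNReal.ofReal
      (Real.rpowIntegrand₀₁ (σ / 2) r ((1 + (n : ℝ) ^ 2) ^ 2))) * ‖coeff f n‖ₑ ^ 2 =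
      ∫⁻ r in Ioi (0 : ℝ), ENNReal.ofReal
        (Real.rpowIntegrand₀₁ (σ / 2) r ((1 + (n : ℝ) ^ 2) ^ 2)) * ‖coeff f n‖ₑ ^ 2 := fun n =>
    (lintegral_mul_const'' _ (hmeas n)).symm
  simp only [h1]
  rw [← lintegral_tsum fun n => (hmeas n).mul_const _]
  refine setLIntegral_congr_fun measurableSet_Ioi fun r hr => ?_
  have hr' : (0 : ℝ) < r := hr
  unfold kFun
  rw [← ENNReal.tsum_mul_left]
  refine tsum_congr fun n => ?_
  rw [Real.rpowIntegrand₀₁_eq_pow_div hp hr'.le (ha n), mul_div_assoc,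
    ENNReal.ofReal_mul (by positivity), mul_assoc]

theorem summable_inv_base : Summable fun n : ℤ => (1 + (n : ℝ) ^ 2)⁻¹ := by
  have h := wienerConst_ne_top (σ := 1) (by norm_num)
  have := ENNReal.summable_toReal h
  refine this.congr fun n => ?_
  have := one_le_base n
  unfold wt
  rw [ENNReal.toReal_ofReal (by positivity), Real.rpow_neg_one]

theorem PerCont.comp_real {f : ℝ → ℂ} (hf : PerCont f) {ψ : ℝ → ℝ} (hψ : Continuous ψ)
    (hp : ∀ x, ψ (x + 1) = ψ x + 1) : PerCont (f ∘ ψ) :=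
  ⟨hf.1.comp hψ, fun x => by simp [hp x, hf.2 (ψ x)]⟩

/-- A bound for composition with `ψ` in `L²` and in `H²` gives the same bound for the
`K`-functional: split `f` into the parts which are optimal for `f`. -/
theorem kFun_comp_le {ψ : ℝ → ℝ} (hψ : Continuous ψ) {C : ℝ≥0∞}
    (h0 : ∀ f, PerCont f → sobSq 0 (f ∘ ψ) ≤ C * sobSq 0 f)
    (h2 : ∀ f f' f'', PerCont f → PerCont f' → PerCont f'' → (∀ x, HasDerivAt f (f' x) x) →
      (∀ x, HasDerivAt f' (f'' x) x) → sobSq 2 (f ∘ ψ) ≤ C * sobSq 2 f)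
    {f : ℝ → ℂ} (hf : PerCont f) {r : ℝ} (hr : 0 < r) : kFun r (f ∘ ψ) ≤ C * kFun r f := by
  obtain ⟨M, hM⟩ := hf.bounded
  have hM0 : 0 ≤ M := (norm_nonneg _).trans (hM 0)
  set a : ℤ → ℝ := fun n => (1 + (n : ℝ) ^ 2) ^ 2 with ha
  have ha1 : ∀ n, 0 < a n := fun n => by simp only [ha]; positivity
  set b : ℤ → ℂ := fun n => ((r / (r + a n) : ℝ) : ℂ) * coeff f n with hb
  have hb1 : ∀ n, ‖b n‖ ≤ r * M * ((1 + (n : ℝ) ^ 2) ^ 2)⁻¹ := by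
    intro n
    have hpos : 0 < r + a n := add_pos hr (ha1 n)
    rw [hb, norm_mul, Complex.norm_real, Real.norm_of_nonneg (by positivity)]
    calc r / (r + a n) * ‖coeff f n‖ ≤ r / (a n) * M := by
          gcongr
          · linarith [ha1 n]
          · exact norm_coeff_le hM n
      _ = _ := by simp only [ha]; ring
  have hsum : ∀ (d : ℤ → ℂ) (k : ℝ), (∀ n, ‖d n‖ ≤ k * (1 + (n : ℝ) ^ 2) * ‖b n‖) →
      Summable fun n => ‖d n‖ := by
    intro d k hd
    refine Summable.of_nonneg_of_le (fun _ => norm_nonneg _) (fun n => ?_)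
      (summable_inv_base.mul_left (|k| * (r * M)))
    have := one_le_base n
    calc ‖d n‖ ≤ k * (1 + (n : ℝ) ^ 2) * ‖b n‖ := hd n
      _ ≤ |k| * (1 + (n : ℝ) ^ 2) * (r * M * ((1 + (n : ℝ) ^ 2) ^ 2)⁻¹) := by
          gcongr
          · exact le_abs_self k
          · exact hb1 n
      _ = _ := by field_simp
  have hs0 : Summable fun n => ‖b n‖ := hsum b 1 fun n => by
    have := one_le_base n
    nlinarith [norm_nonneg (b n)]
  have hs1 : Summable fun n : ℤ => ‖2 * Real.pi * Complex.I * n * b n‖ :=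
      hsum _ (2 * Real.pi) fun n => by
    simp only [norm_mul, Complex.norm_real, Complex.norm_I, Complex.norm_intCast, mul_one,
      Complex.norm_ofNat, Real.norm_of_nonneg Real.pi_pos.le]
    gcongr
    nlinarith [sq_abs (n : ℝ), sq_nonneg (|(n : ℝ)| - 1), abs_nonneg (n : ℝ)]
  have hs2 : Summable fun n : ℤ =>
      ‖2 * Real.pi * Complex.I * n * (2 * Real.pi * Complex.I * n * b n)‖ :=
    hsum _ (4 * Real.pi ^ 2) fun n => by
      simp only [norm_mul, Complex.norm_real, Complex.norm_I, Complex.norm_intCast, mul_one,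
        Complex.norm_ofNat, Real.norm_of_nonneg Real.pi_pos.le]
      calc _ = 4 * Real.pi ^ 2 * (|(n : ℝ)| ^ 2) * ‖b n‖ := by ring
        _ ≤ _ := by rw [sq_abs]; gcongr; linarith
  obtain ⟨p1, c1⟩ := synthesis hs0
  obtain ⟨p1', -⟩ := synthesis hs1
  obtain ⟨p1'', -⟩ := synthesis hs2
  set f1 : ℝ → ℂ := fun x => ∑' n, b n * mode n x with hf1
  have p0 : PerCont (f - f1) := hf.sub p1
  have c0 : ∀ n, coeff (f - f1) n = ((a n / (r + a n) : ℝ) : ℂ) * coeff f n := by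
    intro n
    have hpos : r + a n ≠ 0 := (add_pos hr (ha1 n)).ne'
    rw [coeff_sub hf.1 p1.1, c1]
    have : ((a n / (r + a n) : ℝ) : ℂ) = 1 - ((r / (r + a n) : ℝ) : ℂ) := by
      rw [← Complex.ofReal_one, ← Complex.ofReal_sub]; congr 1; field_simp; ring
    rw [this]; simp only [hb]; ring
  have e1 : f ∘ ψ = (f - f1) ∘ ψ + f1 ∘ ψ := by ext x; simp
  have hstep : kFun r (f ∘ ψ) ≤ sobSq 0 ((f - f1) ∘ ψ) + ENNReal.ofReal r⁻¹ * sobSq 2 (f1 ∘ ψ) := by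
    unfold kFun sobSq
    rw [← ENNReal.tsum_mul_left, ← ENNReal.tsum_add]
    refine ENNReal.tsum_le_tsum fun n => ?_
    rw [e1, coeff_add (p0.1.comp hψ) (p1.1.comp hψ), wt_zero, one_mul, wt_two]
    set X := coeff ((f - f1) ∘ ψ) n
    set Y := coeff (f1 ∘ ψ) n
    have hpos : 0 < r + a n := add_pos hr (ha1 n)
    simp only [enorm_sq_eq]
    change ENNReal.ofReal (a n / (r + a n)) * _ ≤ _ + _ * (ENNReal.ofReal (a n) * _)
    rw [← ENNReal.ofReal_mul (by have := ha1 n; positivity), ← ENNReal.ofReal_mul (ha1 n).le,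
      ← ENNReal.ofReal_mul (by positivity),
      ← ENNReal.ofReal_add (by positivity) (by have := ha1 n; positivity)]
    refine ENNReal.ofReal_le_ofReal ?_
    have h3 : ‖X + Y‖ ^ 2 ≤ (‖X‖ + ‖Y‖) ^ 2 := by gcongr; exact norm_add_le X Y
    have h4 : a n * (‖X‖ + ‖Y‖) ^ 2 ≤ (‖X‖ ^ 2 + r⁻¹ * (a n * ‖Y‖ ^ 2)) * (r + a n) := by
      have : (‖X‖ ^ 2 + r⁻¹ * (a n * ‖Y‖ ^ 2)) * (r + a n) - a n * (‖X‖ + ‖Y‖) ^ 2 =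
          r⁻¹ * (r * ‖X‖ - a n * ‖Y‖) ^ 2 := by field_simp; ring
      have h5 : 0 ≤ r⁻¹ * (r * ‖X‖ - a n * ‖Y‖) ^ 2 := by positivity
      linarith
    rw [div_mul_eq_mul_div, div_le_iff₀ hpos]
    exact (mul_le_mul_of_nonneg_left h3 (ha1 n).le).trans h4
  refine hstep.trans ?_
  calc _ ≤ C * sobSq 0 (f - f1) + ENNReal.ofReal r⁻¹ * (C * sobSq 2 f1) := by
        gcongr
        · exact h0 _ p0
        · exact h2 f1 _ _ p1 p1' p1'' (hasDerivAt_tsum_mode hs0 hs1) (hasDerivAt_tsum_mode hs1 hs2)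
    _ = C * (sobSq 0 (f - f1) + ENNReal.ofReal r⁻¹ * sobSq 2 f1) := by ring
    _ = C * kFun r f := by
        congr 1
        unfold kFun sobSq
        rw [← ENNReal.tsum_mul_left, ← ENNReal.tsum_add]
        refine tsum_congr fun n => ?_
        rw [c0, c1, wt_zero, one_mul, wt_two]
        have hpos : 0 < r + a n := add_pos hr (ha1 n)
        have han := ha1 n
        simp only [enorm_sq_eq, hb, norm_mul, Complex.norm_real]
        change _ + _ * (ENNReal.ofReal (a n) * _) = ENNReal.ofReal (a n / (r + a n)) * _
        rw [← ENNReal.ofReal_mul (by positivity), ← ENNReal.ofReal_mul (by positivity),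
          ← ENNReal.ofReal_mul (by positivity),
          ← ENNReal.ofReal_add (by positivity) (by positivity)]
        congr 1
        rw [Real.norm_of_nonneg (by positivity), Real.norm_of_nonneg (by positivity)]
        field_simp
        ring

/-- Composition with `ψ` is bounded on the Sobolev spaces between `L²` and `H²`. -/
theorem sobSq_comp_le_of_interpolation {ψ : ℝ → ℝ} (hψ : Continuous ψ) {C : ℝ≥0∞} (hC : C ≠ ⊤)
    (h0 : ∀ f, PerCont f → sobSq 0 (f ∘ ψ) ≤ C * sobSq 0 f)
    (h2 : ∀ f f' f'', PerCont f → PerCont f' → PerCont f'' → (∀ x, HasDerivAt f (f' x) x) →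
      (∀ x, HasDerivAt f' (f'' x) x) → sobSq 2 (f ∘ ψ) ≤ C * sobSq 2 f)
    {σ : ℝ} (hσ0 : 0 < σ) (hσ2 : σ < 2) {f : ℝ → ℂ} (hf : PerCont f) :
    sobSq σ (f ∘ ψ) ≤ C * sobSq σ f := by
  obtain ⟨K, hK⟩ := exists_sobSq_eq_lintegral hσ0 hσ2
  rw [hK, hK, mul_left_comm]
  gcongr
  rw [← lintegral_const_mul' _ _ hC]
  refine setLIntegral_mono' measurableSet_Ioi fun r hr => ?_
  rw [mul_left_comm]
  gcongr
  exact kFun_comp_le hψ h0 h2 hf hr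

/-! ### Composition with diffeomorphisms close to the identity -/

/-- `ψ` is a diffeomorphism of the circle, given by its lift to the line, whose derivative is
`g ∘ ψ`; it is `δ`-close to the identity, and `g` is `δ`-close to `1` with its derivative `g'`.
Writing `ψ' = g ∘ ψ` is convenient since `g` is then the reciprocal of the derivative of `ψ⁻¹`. -/
structure NearId (δ : ℝ) (ψ g g' : ℝ → ℝ) : Prop where
  hasDerivAt : ∀ x, HasDerivAt ψ (g (ψ x)) x
  map_add_one : ∀ x, ψ (x + 1) = ψ x + 1
  hasDerivAt_g : ∀ x, HasDerivAt g (g' x) x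
  periodic_g : Function.Periodic g 1
  periodic_g' : Function.Periodic g' 1
  continuous_g' : Continuous g'
  abs_sub_id : ∀ x, |ψ x - x| ≤ δ
  abs_g : ∀ x, |g x - 1| ≤ δ
  abs_g' : ∀ x, |g' x| ≤ δ
  le_half : δ ≤ 1 / 2

namespace NearId

variable {δ : ℝ} {ψ g g' : ℝ → ℝ}

theorem continuous (h : NearId δ ψ g g') : Continuous ψ :=
  continuous_iff_continuousAt.2 fun x => (h.hasDerivAt x).continuousAt

theorem continuous_g (h : NearId δ ψ g g') : Continuous g :=
  continuous_iff_continuousAt.2 fun x => (h.hasDerivAt_g x).continuousAt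

theorem perCont_g (h : NearId δ ψ g g') : PerCont (fun x => (g x : ℂ)) :=
  ⟨Complex.continuous_ofReal.comp h.continuous_g, fun x => by simp [h.periodic_g x]⟩

theorem perCont_g' (h : NearId δ ψ g g') : PerCont (fun x => (g' x : ℂ)) :=
  ⟨Complex.continuous_ofReal.comp h.continuous_g', fun x => by simp [h.periodic_g' x]⟩

theorem perCont_comp (h : NearId δ ψ g g') {f : ℝ → ℂ} (hf : PerCont f) : PerCont (f ∘ ψ) :=
  hf.comp_real h.continuous h.map_add_one

theorem hasDerivAt_comp (h : NearId δ ψ g g') {f f' : ℝ → ℂ} (hf : ∀ x, HasDerivAt f (f' x) x)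
    (x : ℝ) : HasDerivAt (f ∘ ψ) (((f' * fun x => (g x : ℂ)) ∘ ψ) x) x := by
  have := (hf (ψ x)).scomp x (h.hasDerivAt x)
  refine this.congr_deriv ?_
  simp [mul_comm]

theorem half_le (h : NearId δ ψ g g') (x : ℝ) : 1 / 2 ≤ g x := by
  have := abs_le.1 (h.abs_g x); linarith [h.le_half]

theorem norm_g_le (h : NearId δ ψ g g') (x : ℝ) : ‖(g x : ℂ)‖ ≤ 2 := by
  rw [Complex.norm_real, Real.norm_eq_abs, abs_le]
  have := abs_le.1 (h.abs_g x)
  have := h.le_half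
  constructor <;> linarith

theorem norm_g'_le (h : NearId δ ψ g g') (x : ℝ) : ‖(g' x : ℂ)‖ ≤ δ := by
  rw [Complex.norm_real]; exact h.abs_g' x

end NearId

theorem sobSq_zero_mono {f h : ℝ → ℂ} (hf : Continuous f) (hh : Continuous h) {M : ℝ}
    (hle : ∀ x, ‖f x‖ ≤ M * ‖h x‖) :
    sobSq 0 f ≤ ENNReal.ofReal (M ^ 2) * sobSq 0 h := by
  rw [sobSq_zero_eq hf, sobSq_zero_eq hh, ← ENNReal.ofReal_mul (by positivity),
    ← intervalIntegral.integral_const_mul]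
  refine ENNReal.ofReal_le_ofReal ?_
  refine intervalIntegral.integral_mono_on zero_le_one
    ((hf.norm.pow 2).intervalIntegrable _ _)
    ((continuous_const.mul (hh.norm.pow 2)).intervalIntegrable _ _) fun x _ => ?_
  rw [← mul_pow]
  gcongr
  exact hle x

theorem sobSq_zero_le_of_bound {f : ℝ → ℂ} (hf : Continuous f) {M : ℝ}
    (hle : ∀ x, ‖f x‖ ≤ M) : sobSq 0 f ≤ ENNReal.ofReal (M ^ 2) := by
  refine (sobSq_zero_mono hf (continuous_const (y := (1 : ℂ))) (by simpa using hle)).trans ?_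
  rw [sobSq_zero_eq continuous_const]
  simp

/-- Composition with `ψ` is bounded on `L²`, by the change of variables `y = ψ x`. -/
theorem NearId.sobSq_zero_comp_le {δ : ℝ} {ψ g g' : ℝ → ℝ} (h : NearId δ ψ g g') {f : ℝ → ℂ}
    (hf : PerCont f) : sobSq 0 (f ∘ ψ) ≤ 2 * sobSq 0 f := by
  rw [sobSq_zero_eq (hf.1.comp h.continuous), sobSq_zero_eq hf.1, ← ENNReal.ofReal_ofNat 2,
    ← ENNReal.ofReal_mul (by norm_num)]
  refine ENNReal.ofReal_le_ofReal ?_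
  have hc : Continuous fun x => ‖f (ψ x)‖ ^ 2 := (hf.1.comp h.continuous).norm.pow 2
  have hgc : Continuous fun x => g (ψ x) := h.continuous_g.comp h.continuous
  have h1 : ∫ x in (0 : ℝ)..1, ‖(f ∘ ψ) x‖ ^ 2 ≤
      ∫ x in (0 : ℝ)..1, 2 * (‖f (ψ x)‖ ^ 2 * g (ψ x)) := by
    refine intervalIntegral.integral_mono_on zero_le_one (hc.intervalIntegrable _ _)
      ((continuous_const.mul (hc.mul hgc)).intervalIntegrable _ _) fun x _ => ?_
    have := h.half_le (ψ x)
    simp only [Function.comp_apply]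
    nlinarith [sq_nonneg ‖f (ψ x)‖]
  have h2 : ∫ x in (0 : ℝ)..1, (fun y => ‖f y‖ ^ 2) (ψ x) * g (ψ x) =
      ∫ y in ψ 0..ψ 1, ‖f y‖ ^ 2 :=
    intervalIntegral.integral_comp_mul_deriv (fun x _ => h.hasDerivAt x) hgc.continuousOn
      (hf.1.norm.pow 2)
  have h3 : ψ 1 = ψ 0 + 1 := by simpa using h.map_add_one 0
  have h4 : Function.Periodic (fun y => ‖f y‖ ^ 2) 1 := fun x => by simp [hf.2 x]
  have h5 := h4.intervalIntegral_add_eq (ψ 0) 0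
  rw [zero_add] at h5
  rw [h3, h5] at h2
  rw [intervalIntegral.integral_const_mul] at h1
  simp only at h2
  rw [h2] at h1
  exact h1

theorem fourPiSq_inv_le_one : fourPiSq⁻¹ ≤ 1 := by
  rw [ENNReal.inv_le_one]
  unfold fourPiSq
  rw [enorm_sq_eq, ← ENNReal.ofReal_one]
  refine ENNReal.ofReal_le_ofReal ?_
  simp only [norm_mul, Complex.norm_ofNat, Complex.norm_real, Complex.norm_I,
    Real.norm_of_nonneg Real.pi_pos.le]
  nlinarith [Real.pi_gt_three]

theorem sobSq_two_eq {f f' f'' : ℝ → ℂ} (hf : PerCont f) (hf' : PerCont f') (hf'' : Continuous f'')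
    (h1 : ∀ x, HasDerivAt f (f' x) x) (h2 : ∀ x, HasDerivAt f' (f'' x) x) :
    sobSq 2 f = sobSq 0 f + 2 * (fourPiSq⁻¹ * sobSq 0 f') +
      fourPiSq⁻¹ * (fourPiSq⁻¹ * sobSq 0 f'') := by
  have e1 : (2 : ℝ) = 0 + 1 + 1 := by norm_num
  rw [e1, sobSq_succ h1 hf.2 hf'.1, sobSq_succ h1 hf.2 hf'.1, sobSq_succ h2 hf'.2 hf'']
  ring

namespace NearId

variable {δ : ℝ} {ψ g g' : ℝ → ℝ}

theorem hasDerivAt_mul_g (h : NearId δ ψ g g') {f f' : ℝ → ℂ}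
    (hf : ∀ x, HasDerivAt f (f' x) x) (x : ℝ) :
    HasDerivAt (f * fun x => (g x : ℂ))
      ((f' * (fun x => (g x : ℂ)) + f * fun x => (g' x : ℂ)) x) x :=
  (hf x).mul (h.hasDerivAt_g x).ofReal_comp

/-- Composition with `ψ` is bounded on `H²`: the first two derivatives of `f ∘ ψ` are `(f' g) ∘ ψ`
and `((f'' g + f' g') g) ∘ ψ`. -/
theorem sobSq_two_comp_le (h : NearId δ ψ g g') {f f' f'' : ℝ → ℂ} (hf : PerCont f)
    (hf' : PerCont f') (hf'' : PerCont f'') (h1 : ∀ x, HasDerivAt f (f' x) x)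
    (h2 : ∀ x, HasDerivAt f' (f'' x) x) : sobSq 2 (f ∘ ψ) ≤ 100 * sobSq 2 f := by
  set G : ℝ → ℂ := fun x => (g x : ℂ) with hG
  set G' : ℝ → ℂ := fun x => (g' x : ℂ) with hG'
  have pG : PerCont G := h.perCont_g
  have pG' : PerCont G' := h.perCont_g'
  have p1 : PerCont (f' * G) := hf'.mul pG
  have p2 : PerCont (f'' * G + f' * G') := (hf''.mul pG).add (hf'.mul pG')
  have hδ : 0 ≤ δ := (abs_nonneg _).trans (h.abs_sub_id 0)
  have hδ2 := h.le_half
  have b1 : sobSq 0 (f' * G) ≤ 4 * sobSq 0 f' := by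
    have := sobSq_zero_mono p1.1 hf'.1 (M := 2) fun x => by
      rw [Pi.mul_apply, norm_mul, mul_comm]; gcongr; exact h.norm_g_le x
    norm_num at this
    exact this
  have b2 : sobSq 0 ((f'' * G + f' * G') * G) ≤ 32 * sobSq 0 f'' + 8 * sobSq 0 f' := by
    have a1 := sobSq_zero_mono (p2.mul pG).1 p2.1 (M := 2) fun x => by
      rw [Pi.mul_apply, norm_mul, mul_comm]; gcongr; exact h.norm_g_le x
    have a2 := sobSq_zero_mono (hf''.mul pG).1 hf''.1 (M := 2) fun x => by
      rw [Pi.mul_apply, norm_mul, mul_comm]; gcongr; exact h.norm_g_le x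
    have a3 := sobSq_zero_mono (hf'.mul pG').1 hf'.1 (M := 1) fun x => by
      rw [Pi.mul_apply, norm_mul, mul_comm]; gcongr; linarith [h.norm_g'_le x]
    norm_num at a1 a2 a3
    calc _ ≤ 4 * (2 * sobSq 0 (f'' * G) + 2 * sobSq 0 (f' * G')) :=
          a1.trans (by gcongr; exact sobSq_add_le (hf''.mul pG).1 (hf'.mul pG').1 0)
      _ ≤ 4 * (2 * (4 * sobSq 0 f'') + 2 * sobSq 0 f') := by gcongr
      _ = _ := by ring
  have b3 : sobSq 0 ((f' * G) ∘ ψ) ≤ 8 * sobSq 0 f' :=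
    (h.sobSq_zero_comp_le p1).trans (by
      calc _ ≤ 2 * (4 * sobSq 0 f') := by gcongr
        _ = _ := by ring)
  have b4 : sobSq 0 (((f'' * G + f' * G') * G) ∘ ψ) ≤ 64 * sobSq 0 f'' + 16 * sobSq 0 f' :=
    (h.sobSq_zero_comp_le (p2.mul pG)).trans (by
      calc _ ≤ 2 * (32 * sobSq 0 f'' + 8 * sobSq 0 f') := by gcongr
        _ = _ := by ring)
  have d1 := h.hasDerivAt_comp h1
  have d2 := h.hasDerivAt_comp (h.hasDerivAt_mul_g h2)
  rw [sobSq_two_eq hf hf' hf''.1 h1 h2, sobSq_two_eq (h.perCont_comp hf) (h.perCont_comp p1)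
    (h.perCont_comp (p2.mul pG)).1 d1 d2]
  set k := fourPiSq⁻¹ with hk
  calc _ ≤ 2 * sobSq 0 f + 2 * (k * (8 * sobSq 0 f')) +
        k * (k * (64 * sobSq 0 f'' + 16 * sobSq 0 f')) := by
        gcongr
        exact h.sobSq_zero_comp_le hf
    _ = 2 * sobSq 0 f + (16 * (k * sobSq 0 f') + k * (16 * (k * sobSq 0 f'))) +
        64 * (k * (k * sobSq 0 f'')) := by ring
    _ ≤ 100 * sobSq 0 f + (16 * (k * sobSq 0 f') + 1 * (184 * (k * sobSq 0 f'))) +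
        100 * (k * (k * sobSq 0 f'')) := by
        gcongr
        · norm_num
        · exact fourPiSq_inv_le_one
        · norm_num
        · norm_num
    _ = _ := by ring

/-- Composition with a diffeomorphism close to the identity is bounded on `H^σ`, `0 < σ < 2`. -/
theorem sobSq_comp_le (h : NearId δ ψ g g') {σ : ℝ} (h0 : 0 < σ) (h2 : σ < 2) {f : ℝ → ℂ}
    (hf : PerCont f) : sobSq σ (f ∘ ψ) ≤ 100 * sobSq σ f := by
  refine sobSq_comp_le_of_interpolation h.continuous (by norm_num)
    (fun f hf => (h.sobSq_zero_comp_le hf).trans ?_)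
    (fun f f' f'' p p' p'' d d' => h.sobSq_two_comp_le p p' p'' d d') h0 h2 hf
  gcongr
  norm_num

end NearId

/-! ### Convergence in Sobolev spaces -/

/-- The family `F` converges to `F₀` in `H^σ` along the filter `l`. -/
structure HTendsto {ι : Type*} (σ : ℝ) (F : ι → ℝ → ℂ) (l : Filter ι) (F₀ : ℝ → ℂ) : Prop where
  perCont : ∀ᶠ i in l, PerCont (F i)
  perCont_lim : PerCont F₀
  lt_top : sobSq σ F₀ < ⊤
  tendsto : Tendsto (fun i => sobSq σ (F i - F₀)) l (𝓝 0)

theorem ennreal_tendsto_zero_of_le {ι : Type*} {l : Filter ι} {f g : ι → ℝ≥0∞}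
    (hg : Tendsto g l (𝓝 0)) (h : ∀ᶠ i in l, f i ≤ g i) : Tendsto f l (𝓝 0) :=
  tendsto_of_tendsto_of_tendsto_of_le_of_le' tendsto_const_nhds hg
    (Eventually.of_forall fun _ => zero_le) h

theorem ennreal_tendsto_zero_mul {ι : Type*} {l : Filter ι} {f : ι → ℝ≥0∞}
    (hf : Tendsto f l (𝓝 0)) {c : ℝ≥0∞} (hc : c ≠ ⊤) : Tendsto (fun i => c * f i) l (𝓝 0) := by
  simpa using ENNReal.Tendsto.const_mul hf (Or.inr hc)

theorem ennreal_tendsto_zero_add {ι : Type*} {l : Filter ι} {f g : ι → ℝ≥0∞}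
    (hf : Tendsto f l (𝓝 0)) (hg : Tendsto g l (𝓝 0)) : Tendsto (fun i => f i + g i) l (𝓝 0) := by
  simpa using hf.add hg

theorem sobSq_mul_lt_top {σ : ℝ} (hσ : 1 / 2 < σ) {f g : ℝ → ℂ} (hf : PerCont f) (hg : PerCont g)
    (hfN : sobSq σ f < ⊤) (hgN : sobSq σ g < ⊤) : sobSq σ (f * g) < ⊤ :=
  (sobSq_mul_le hσ hf hg hfN).trans_lt
    (ENNReal.mul_lt_top (algConst_ne_top hσ).lt_top (ENNReal.mul_lt_top hfN hgN))

theorem sobSq_add_lt_top {σ : ℝ} {f g : ℝ → ℂ} (hf : PerCont f) (hg : PerCont g)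
    (hfN : sobSq σ f < ⊤) (hgN : sobSq σ g < ⊤) : sobSq σ (f + g) < ⊤ :=
  (sobSq_add_le hf.1 hg.1 σ).trans_lt (ENNReal.add_lt_top.2
    ⟨ENNReal.mul_lt_top (by norm_num) hfN, ENNReal.mul_lt_top (by norm_num) hgN⟩)

theorem sobSq_smul_lt_top {σ : ℝ} (a : ℂ) {f : ℝ → ℂ} (hfN : sobSq σ f < ⊤) :
    sobSq σ (a • f) < ⊤ := by
  rw [sobSq_smul]
  exact ENNReal.mul_lt_top (ENNReal.pow_lt_top enorm_lt_top) hfN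

theorem sobSq_const (σ : ℝ) (a : ℂ) : sobSq σ (fun _ => a) = ‖a‖ₑ ^ 2 := by
  have h : (fun _ => a : ℝ → ℂ) = a • mode 0 := by ext x; simp [mode_zero]
  rw [h, sobSq_smul]
  have : sobSq σ (mode 0) = 1 := by
    unfold sobSq
    rw [tsum_eq_single 0]
    · simp [coeff_mode, wt]
    · intro n hn; simp [coeff_mode, hn]
  rw [this, mul_one]

theorem sobSq_const_lt_top (σ : ℝ) (a : ℂ) : sobSq σ (fun _ => a) < ⊤ := by
  rw [sobSq_const]; exact ENNReal.pow_lt_top enorm_lt_top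

theorem sobSq_deriv_lt_top {σ : ℝ} {f f' : ℝ → ℂ} (hf : ∀ x, HasDerivAt f (f' x) x)
    (hp : Function.Periodic f 1) (hf' : Continuous f') (hN : sobSq (σ + 1) f < ⊤) :
    sobSq σ f' < ⊤ :=
  (sobSq_deriv_le hf hp hf' σ).trans_lt (ENNReal.mul_lt_top fourPiSq_ne_top.lt_top hN)

/-- The derivative of a periodic function is periodic. -/
theorem periodic_of_hasDerivAt {E : Type*} [NormedAddCommGroup E] [NormedSpace ℝ E]
    {f f' : ℝ → E} (hf : ∀ x, HasDerivAt f (f' x) x)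
    (hp : Function.Periodic f 1) : Function.Periodic f' 1 := by
  intro x
  have h1 := (hf (x + 1)).comp_add_const x 1
  have h2 : (fun y => f (y + 1)) = f := funext hp
  rw [h2] at h1
  exact h1.unique (hf x)

/-- A function vanishing at the base point is controlled by its derivative. -/
theorem sobSq_succ_le_of_zero {σ : ℝ} (hσ : 1 / 2 < σ) {f f' : ℝ → ℂ}
    (hf : ∀ x, HasDerivAt f (f' x) x) (hp : Function.Periodic f 1) (hf' : Continuous f')
    (h0 : f 0 = 0) : sobSq (σ + 1) f ≤ (wienerConst σ + 2) * sobSq σ f' := by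
  have pf' : PerCont f' := ⟨hf', periodic_of_hasDerivAt hf hp⟩
  by_cases hN : sobSq σ f' = ⊤
  · rw [hN, ENNReal.mul_top (by simp)]; exact le_top
  have hB : wienerConst σ * sobSq σ f' ≠ ⊤ := ENNReal.mul_ne_top (wienerConst_ne_top hσ) hN
  set B := wienerConst σ * sobSq σ f' with hBdef
  have hM : ∀ x, ‖f' x‖ ≤ √B.toReal := by
    intro x
    refine Real.le_sqrt_of_sq_le ?_
    rw [← ENNReal.ofReal_le_iff_le_toReal hB, ← enorm_sq_eq]
    exact enorm_sq_le hσ pf' x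
  have hfM : ∀ x, ‖f x‖ ≤ √B.toReal := by
    intro x
    obtain ⟨y, hy, hxy⟩ := hp.exists_mem_Ico₀ one_pos x
    rw [hxy]
    have := (convex_univ (𝕜 := ℝ) (E := ℝ)).norm_image_sub_le_of_norm_hasDerivWithin_le
      (f := f) (f' := f') (fun x _ => (hf x).hasDerivWithinAt) (fun x _ => hM x)
      (mem_univ 0) (mem_univ y)
    rw [h0, sub_zero, sub_zero, Real.norm_of_nonneg hy.1] at this
    nlinarith [hy.2, Real.sqrt_nonneg B.toReal, hy.1]
  have hc0 : ‖coeff f 0‖ₑ ^ 2 ≤ B := by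
    rw [enorm_sq_eq, ENNReal.ofReal_le_iff_le_toReal hB, ← Real.sq_sqrt ENNReal.toReal_nonneg]
    gcongr
    exact norm_coeff_le hfM 0
  have key : ∀ n : ℤ, wt (σ + 1) n * ‖coeff f n‖ₑ ^ 2 ≤ (if n = 0 then B else 0) +
      2 * (wt σ n * (‖(n : ℂ)‖ₑ ^ 2 * ‖coeff f n‖ₑ ^ 2)) := by
    intro n
    split_ifs with hn
    · subst hn
      have : wt (σ + 1) 0 = 1 := by simp [wt]
      rw [this, one_mul]
      exact hc0.trans le_self_add
    · rw [zero_add, wt_add, wt_one]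
      have : (1 : ℝ≥0∞) ≤ ‖(n : ℂ)‖ₑ ^ 2 := by
        rw [enorm_sq_eq, ← ENNReal.ofReal_one]
        refine ENNReal.ofReal_le_ofReal ?_
        rw [Complex.norm_intCast]
        have : (1 : ℝ) ≤ |(n : ℝ)| := by exact_mod_cast Int.one_le_abs hn
        nlinarith
      calc wt σ n * (1 + ‖(n : ℂ)‖ₑ ^ 2) * ‖coeff f n‖ₑ ^ 2
          ≤ wt σ n * (‖(n : ℂ)‖ₑ ^ 2 + ‖(n : ℂ)‖ₑ ^ 2) * ‖coeff f n‖ₑ ^ 2 := by gcongr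
        _ = _ := by ring
  have h1 : ∑' n : ℤ, wt σ n * (‖(n : ℂ)‖ₑ ^ 2 * ‖coeff f n‖ₑ ^ 2) ≤ sobSq σ f' := by
    rw [sobSq_deriv hf hp hf' σ]
    have : (1 : ℝ≥0∞) ≤ fourPiSq := by
      have := fourPiSq_inv_le_one
      rwa [ENNReal.inv_le_one] at this
    exact le_mul_of_one_le_left zero_le this
  calc sobSq (σ + 1) f ≤ ∑' n : ℤ, ((if n = 0 then B else 0) +
      2 * (wt σ n * (‖(n : ℂ)‖ₑ ^ 2 * ‖coeff f n‖ₑ ^ 2))) := ENNReal.tsum_le_tsum key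
    _ = B + 2 * ∑' n : ℤ, wt σ n * (‖(n : ℂ)‖ₑ ^ 2 * ‖coeff f n‖ₑ ^ 2) := by
      rw [ENNReal.tsum_add, tsum_ite_eq, ENNReal.tsum_mul_left]
    _ ≤ B + 2 * sobSq σ f' := by gcongr
    _ = _ := by rw [hBdef]; ring

/-- Fatou's lemma for Sobolev norms. -/
theorem sobSq_le_of_tendsto {σ : ℝ} {h : ℕ → ℝ → ℂ} {h₀ : ℝ → ℂ} {B : ℝ≥0∞}
    (hc : ∀ n, Tendsto (fun j => coeff (h j) n) atTop (𝓝 (coeff h₀ n)))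
    (hB : ∀ j, sobSq σ (h j) ≤ B) : sobSq σ h₀ ≤ B := by
  unfold sobSq
  rw [ENNReal.tsum_eq_iSup_sum]
  refine iSup_le fun S => ?_
  have : Tendsto (fun j => ∑ n ∈ S, wt σ n * ‖coeff (h j) n‖ₑ ^ 2) atTop
      (𝓝 (∑ n ∈ S, wt σ n * ‖coeff h₀ n‖ₑ ^ 2)) := by
    refine tendsto_finsetSum _ fun n _ => ?_
    refine ENNReal.Tendsto.const_mul ?_ (Or.inr (wt_ne_top σ n))
    exact ENNReal.Tendsto.pow (hc n).enorm
  exact le_of_tendsto' this fun j => (ENNReal.sum_le_tsum S).trans (hB j)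

/-- Inversion near the constant function `1`, by the Neumann series. -/
theorem sobSq_inv_sub_one_le {σ : ℝ} (hσ : 1 / 2 < σ) {M : ℝ → ℂ} (hM : PerCont M)
    (hk : ∀ x, ‖M x - 1‖ ≤ 1 / 2) (hsmall : 4 * algConst σ * sobSq σ (M - 1) ≤ 1)
    (hfin : sobSq σ (M - 1) < ⊤) :
    PerCont M⁻¹ ∧ sobSq σ (M⁻¹ - 1) ≤ 4 * sobSq σ (M - 1) := by
  have hM0 : ∀ x, M x ≠ 0 := fun x h0 => by
    have := hk x; rw [h0, zero_sub, norm_neg, norm_one] at this; norm_num at this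
  have pMi : PerCont M⁻¹ := ⟨hM.1.inv₀ hM0, fun x => by simp [hM.2 x]⟩
  refine ⟨pMi, ?_⟩
  have p1 : PerCont (1 : ℝ → ℂ) := PerCont.const 1
  set k : ℝ → ℂ := M - 1 with hkdef
  have pk : PerCont k := hM.sub p1
  have ph : PerCont (M⁻¹ - 1) := pMi.sub p1
  obtain ⟨B, hB⟩ := ph.bounded
  -- The partial sums of the Neumann series are the iterates of `h ↦ -k - k h`.
  set h : ℕ → ℝ → ℂ := fun j => Nat.rec (0 : ℝ → ℂ) (fun _ h => (-1 : ℂ) • k + (-1 : ℂ) • (k * h)) j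
    with hdef
  have hsucc : ∀ j, h (j + 1) = (-1 : ℂ) • k + (-1 : ℂ) • (k * h j) := fun j => rfl
  have pj : ∀ j, PerCont (h j) := by
    intro j
    induction j with
    | zero => exact PerCont.const 0
    | succ j ih => rw [hsucc]; exact (pk.smul _).add ((pk.mul ih).smul _)
  have hNj : ∀ j, sobSq σ (h j) ≤ 4 * sobSq σ k := by
    intro j
    induction j with
    | zero =>
      have : sobSq σ (h 0) = 0 := (sobSq_const σ 0).trans (by simp)
      rw [this]; exact zero_le
    | succ j ih =>
      rw [hsucc]
      have e1 : ∀ f : ℝ → ℂ, sobSq σ ((-1 : ℂ) • f) = sobSq σ f := fun f => by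
        rw [sobSq_smul]; simp
      calc _ ≤ 2 * sobSq σ k + 2 * sobSq σ (k * h j) := by
            have := sobSq_add_le (pk.smul (-1)).1 ((pk.mul (pj j)).smul (-1)).1 σ
            rwa [e1, e1] at this
        _ ≤ 2 * sobSq σ k + 2 * (algConst σ * (sobSq σ k * (4 * sobSq σ k))) := by
            gcongr
            exact (sobSq_mul_le hσ pk (pj j) hfin).trans (by gcongr)
        _ = 2 * sobSq σ k + 2 * (4 * algConst σ * sobSq σ k) * sobSq σ k := by ring
        _ ≤ 2 * sobSq σ k + 2 * 1 * sobSq σ k := by gcongr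
        _ = _ := by ring
  have hdiff : ∀ j x, ‖(h j - (M⁻¹ - 1)) x‖ ≤ (1 / 2) ^ j * B := by
    intro j
    induction j with
    | zero =>
      intro x
      have : (h 0 - (M⁻¹ - 1)) x = -((M⁻¹ - 1) x) := by simp [hdef]
      rw [this, norm_neg, pow_zero, one_mul]; exact hB x
    | succ j ih =>
      intro x
      have e : (h (j + 1) - (M⁻¹ - 1)) x = -(k x * (h j - (M⁻¹ - 1)) x) := by
        rw [hsucc]
        have := hM0 x
        simp only [hkdef, Pi.sub_apply, Pi.add_apply, Pi.smul_apply, Pi.mul_apply, Pi.inv_apply,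
          Pi.one_apply, smul_eq_mul]
        field_simp
        ring
      rw [e, norm_neg, norm_mul, pow_succ', mul_assoc]
      exact mul_le_mul (hk x) (ih x) (norm_nonneg _) (by norm_num)
  refine sobSq_le_of_tendsto (h := h) (fun n => ?_) hNj
  rw [tendsto_iff_norm_sub_tendsto_zero]
  refine squeeze_zero (fun _ => norm_nonneg _) (g := fun j => (1 / 2 : ℝ) ^ j * B) (fun j => ?_) ?_
  · rw [← coeff_sub (pj j).1 ph.1]
    exact norm_coeff_le (hdiff j) n
  · simpa using (tendsto_pow_atTop_nhds_zero_of_lt_one (r := (1 / 2 : ℝ)) (by norm_num)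
      (by norm_num)).mul_const B

namespace HTendsto

variable {ι : Type*} {l : Filter ι} {σ : ℝ} {F G : ι → ℝ → ℂ} {F₀ G₀ : ℝ → ℂ}

theorem congr' (hF : HTendsto σ F l F₀) (h : ∀ᶠ i in l, F i = G i) : HTendsto σ G l F₀ :=
  ⟨by filter_upwards [hF.perCont, h] with i hi e; rwa [← e], hF.perCont_lim, hF.lt_top,
    hF.tendsto.congr' (by filter_upwards [h] with i e; rw [e])⟩

theorem const (hF : PerCont F₀) (hN : sobSq σ F₀ < ⊤) : HTendsto σ (fun _ => F₀) l F₀ :=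
  ⟨Eventually.of_forall fun _ => hF, hF, hN, by
    have := sobSq_const σ 0
    simp only [sub_self]
    have e : (0 : ℝ → ℂ) = fun _ => 0 := rfl
    rw [e, this]; simp [tendsto_const_nhds]⟩

theorem mono {τ : ℝ} (hF : HTendsto τ F l F₀) (h : σ ≤ τ) : HTendsto σ F l F₀ :=
  ⟨hF.perCont, hF.perCont_lim, (sobSq_mono h _).trans_lt hF.lt_top,
    ennreal_tendsto_zero_of_le hF.tendsto (Eventually.of_forall fun _ => sobSq_mono h _)⟩

theorem mono_filter {l' : Filter ι} (hF : HTendsto σ F l F₀) (h : l' ≤ l) : HTendsto σ F l' F₀ :=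
  ⟨hF.perCont.filter_mono h, hF.perCont_lim, hF.lt_top, hF.tendsto.mono_left h⟩

theorem add (hF : HTendsto σ F l F₀) (hG : HTendsto σ G l G₀) :
    HTendsto σ (fun i => F i + G i) l (F₀ + G₀) := by
  refine ⟨?_, hF.perCont_lim.add hG.perCont_lim,
    sobSq_add_lt_top hF.perCont_lim hG.perCont_lim hF.lt_top hG.lt_top, ?_⟩
  · filter_upwards [hF.perCont, hG.perCont] with i h1 h2 using h1.add h2
  · refine ennreal_tendsto_zero_of_le (ennreal_tendsto_zero_add
      (ennreal_tendsto_zero_mul hF.tendsto (c := 2) (by norm_num))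
      (ennreal_tendsto_zero_mul hG.tendsto (c := 2) (by norm_num))) ?_
    filter_upwards [hF.perCont, hG.perCont] with i h1 h2
    have : F i + G i - (F₀ + G₀) = (F i - F₀) + (G i - G₀) := by ring
    rw [this]
    exact sobSq_add_le (h1.sub hF.perCont_lim).1 (h2.sub hG.perCont_lim).1 σ

theorem mul (hσ : 1 / 2 < σ) (hF : HTendsto σ F l F₀) (hG : HTendsto σ G l G₀) :
    HTendsto σ (fun i => F i * G i) l (F₀ * G₀) := by
  refine ⟨?_, hF.perCont_lim.mul hG.perCont_lim,
    sobSq_mul_lt_top hσ hF.perCont_lim hG.perCont_lim hF.lt_top hG.lt_top, ?_⟩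
  · filter_upwards [hF.perCont, hG.perCont] with i h1 h2 using h1.mul h2
  · have hC := algConst_ne_top hσ
    have t1 : Tendsto (fun i => sobSq σ (F i - F₀) * sobSq σ (G i - G₀)) l (𝓝 0) := by
      simpa using ENNReal.Tendsto.mul hF.tendsto (Or.inr (by simp)) hG.tendsto (Or.inr (by simp))
    have t2 := ennreal_tendsto_zero_mul hG.tendsto hF.lt_top.ne
    have t3 := ennreal_tendsto_zero_mul hF.tendsto hG.lt_top.ne
    refine ennreal_tendsto_zero_of_le (ennreal_tendsto_zero_add
      (ennreal_tendsto_zero_mul (ennreal_tendsto_zero_add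
        (ennreal_tendsto_zero_mul (ennreal_tendsto_zero_mul t1 hC) (c := 2) (by norm_num))
        (ennreal_tendsto_zero_mul (ennreal_tendsto_zero_mul t2 hC) (c := 2) (by norm_num)))
        (c := 2) (by norm_num))
      (ennreal_tendsto_zero_mul (ennreal_tendsto_zero_mul t3 hC) (c := 2) (by norm_num))) ?_
    have hfin : ∀ᶠ i in l, sobSq σ (F i - F₀) < ⊤ :=
      hF.tendsto.eventually_lt_const ENNReal.zero_lt_top
    filter_upwards [hF.perCont, hG.perCont, hfin] with i h1 h2 h3
    have p1 := h1.sub hF.perCont_lim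
    have p2 := h2.sub hG.perCont_lim
    have : F i * G i - F₀ * G₀ = ((F i - F₀) * (G i - G₀) + F₀ * (G i - G₀)) + (F i - F₀) * G₀ := by
      ring
    rw [this]
    refine (sobSq_add_le ((p1.mul p2).add (hF.perCont_lim.mul p2)).1
      (p1.mul hG.perCont_lim).1 σ).trans ?_
    gcongr
    · refine (sobSq_add_le (p1.mul p2).1 (hF.perCont_lim.mul p2).1 σ).trans ?_
      gcongr
      · exact sobSq_mul_le hσ p1 p2 h3
      · exact sobSq_mul_le hσ hF.perCont_lim p2 hF.lt_top
    · refine (sobSq_mul_le hσ p1 hG.perCont_lim h3).trans ?_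
      rw [mul_comm (sobSq σ G₀)]

theorem of_scalar {a : ι → ℂ} {a₀ : ℂ} (ha : Tendsto a l (𝓝 a₀)) :
    HTendsto σ (fun i _ => a i) l (fun _ => a₀) := by
  refine ⟨Eventually.of_forall fun i => PerCont.const _, PerCont.const _,
    sobSq_const_lt_top σ a₀, ?_⟩
  have : ∀ i, (fun _ => a i : ℝ → ℂ) - (fun _ => a₀) = fun _ => a i - a₀ := fun i => rfl
  simp only [this, sobSq_const]
  have h1 := (ha.sub_const a₀).enorm
  rw [sub_self, enorm_zero] at h1
  simpa using ENNReal.Tendsto.pow h1 (n := 2)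

theorem smul (hσ : 1 / 2 < σ) {a : ι → ℂ} {a₀ : ℂ} (ha : Tendsto a l (𝓝 a₀))
    (hF : HTendsto σ F l F₀) : HTendsto σ (fun i => a i • F i) l (a₀ • F₀) :=
  (of_scalar ha).mul hσ hF

theorem inv (hσ : 1 / 2 < σ) (hF : HTendsto σ F l 1) : HTendsto σ (fun i => (F i)⁻¹) l 1 := by
  have key : ∀ᶠ i in l, PerCont (F i)⁻¹ ∧ sobSq σ ((F i)⁻¹ - 1) ≤ 4 * sobSq σ (F i - 1) := by
    have hw := wienerConst_ne_top hσ
    have t1 := ennreal_tendsto_zero_mul hF.tendsto hw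
    have t2 := ennreal_tendsto_zero_mul hF.tendsto
      (c := 4 * algConst σ) (ENNReal.mul_ne_top (by norm_num) (algConst_ne_top hσ))
    filter_upwards [hF.perCont, hF.tendsto.eventually_lt_const ENNReal.zero_lt_top,
      t1.eventually_lt_const (u := ENNReal.ofReal ((1 / 2) ^ 2)) (by norm_num),
      t2.eventually_lt_const (u := 1) (by norm_num)] with i h1 h2 h3 h4
    refine sobSq_inv_sub_one_le hσ h1 (fun x => ?_) h4.le h2
    have h5 := (enorm_sq_le hσ (h1.sub hF.perCont_lim) x).trans h3.le
    rw [enorm_sq_eq, ENNReal.ofReal_le_ofReal_iff (by norm_num)] at h5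
    exact abs_le_of_sq_le_sq' h5 (by norm_num) |>.2
  refine ⟨key.mono fun i h => h.1, hF.perCont_lim, hF.lt_top, ?_⟩
  exact ennreal_tendsto_zero_of_le (ennreal_tendsto_zero_mul hF.tendsto (c := 4) (by norm_num))
    (key.mono fun i h => h.2)

theorem deriv {F' : ι → ℝ → ℂ} {F₀' : ℝ → ℂ} (hF : HTendsto (σ + 1) F l F₀)
    (hd : ∀ᶠ i in l, Continuous (F' i) ∧ ∀ x, HasDerivAt (F i) (F' i x) x)
    (hc₀ : Continuous F₀') (hd₀ : ∀ x, HasDerivAt F₀ (F₀' x) x) : HTendsto σ F' l F₀' := by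
  refine ⟨?_, ⟨hc₀, periodic_of_hasDerivAt hd₀ hF.perCont_lim.2⟩,
    sobSq_deriv_lt_top hd₀ hF.perCont_lim.2 hc₀ hF.lt_top, ?_⟩
  · filter_upwards [hF.perCont, hd] with i h1 h2
    exact ⟨h2.1, periodic_of_hasDerivAt h2.2 h1.2⟩
  · refine ennreal_tendsto_zero_of_le (ennreal_tendsto_zero_mul hF.tendsto fourPiSq_ne_top) ?_
    filter_upwards [hF.perCont, hd] with i h1 h2
    exact sobSq_deriv_le (fun x => (h2.2 x).sub (hd₀ x)) (h1.sub hF.perCont_lim).2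
      (h2.1.sub hc₀) σ

/-- Convergence of the derivatives in `H^σ`, together with that of the functions, gives
convergence in `H^{σ+1}`. -/
theorem succ_of_deriv {F' : ι → ℝ → ℂ} {F₀' : ℝ → ℂ} (hF : HTendsto σ F l F₀)
    (hF' : HTendsto σ F' l F₀') (hd : ∀ᶠ i in l, ∀ x, HasDerivAt (F i) (F' i x) x)
    (hd₀ : ∀ x, HasDerivAt F₀ (F₀' x) x) : HTendsto (σ + 1) F l F₀ := by
  have hk : fourPiSq⁻¹ ≠ ⊤ := ENNReal.inv_ne_top.2 fourPiSq_ne_zero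
  refine ⟨hF.perCont, hF.perCont_lim, ?_, ?_⟩
  · rw [sobSq_succ hd₀ hF.perCont_lim.2 hF'.perCont_lim.1]
    exact ENNReal.add_lt_top.2 ⟨hF.lt_top, ENNReal.mul_lt_top hk.lt_top hF'.lt_top⟩
  · refine ennreal_tendsto_zero_of_le (ennreal_tendsto_zero_add hF.tendsto
      (ennreal_tendsto_zero_mul hF'.tendsto hk)) ?_
    filter_upwards [hF.perCont, hF'.perCont, hd] with i h1 h2 h3
    exact (sobSq_succ (fun x => (h3 x).sub (hd₀ x)) (h1.sub hF.perCont_lim).2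
      (h2.1.sub hF'.perCont_lim.1) σ).le

/-- Convergence of the derivatives in `H^σ` gives convergence in `H^{σ+1}` for functions which
vanish at the base point. -/
theorem succ_of_deriv_of_zero (hσ : 1 / 2 < σ) {F' : ι → ℝ → ℂ} {F₀' : ℝ → ℂ}
    (hF' : HTendsto σ F' l F₀')
    (hd : ∀ᶠ i in l, Function.Periodic (F i) 1 ∧ F i 0 = 0 ∧ ∀ x, HasDerivAt (F i) (F' i x) x)
    (hp₀ : Function.Periodic F₀ 1) (h0 : F₀ 0 = 0) (hd₀ : ∀ x, HasDerivAt F₀ (F₀' x) x) :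
    HTendsto (σ + 1) F l F₀ := by
  have hC : wienerConst σ + 2 ≠ ⊤ := ENNReal.add_ne_top.2 ⟨wienerConst_ne_top hσ, by norm_num⟩
  refine ⟨?_, ⟨continuous_iff_continuousAt.2 fun x => (hd₀ x).continuousAt, hp₀⟩, ?_, ?_⟩
  · filter_upwards [hd] with i h
    exact ⟨continuous_iff_continuousAt.2 fun x => (h.2.2 x).continuousAt, h.1⟩
  · exact (sobSq_succ_le_of_zero hσ hd₀ hp₀ hF'.perCont_lim.1 h0).trans_lt
      (ENNReal.mul_lt_top hC.lt_top hF'.lt_top)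
  · refine ennreal_tendsto_zero_of_le (ennreal_tendsto_zero_mul hF'.tendsto hC) ?_
    filter_upwards [hF'.perCont, hd] with i h1 h2
    exact sobSq_succ_le_of_zero hσ (fun x => (h2.2.2 x).sub (hd₀ x)) (h2.1.sub hp₀)
      (h1.1.sub hF'.perCont_lim.1) (by simp [h2.2.1, h0])

/-- Convergence in `H^σ`, `σ > 1/2`, is uniform. -/
theorem eventually_norm_le (hσ : 1 / 2 < σ) (hF : HTendsto σ F l F₀) {ε : ℝ} (hε : 0 < ε) :
    ∀ᶠ i in l, ∀ x, ‖F i x - F₀ x‖ ≤ ε := by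
  have t1 := ennreal_tendsto_zero_mul hF.tendsto (wienerConst_ne_top hσ)
  filter_upwards [hF.perCont, t1.eventually_lt_const (u := ENNReal.ofReal (ε ^ 2))
    (by positivity)] with i h1 h2 x
  have h5 := (enorm_sq_le hσ (h1.sub hF.perCont_lim) x).trans h2.le
  rw [enorm_sq_eq, ENNReal.ofReal_le_ofReal_iff (by positivity)] at h5
  exact abs_le_of_sq_le_sq' h5 hε.le |>.2

end HTendsto

/-! ### Continuity of composition in Sobolev spaces -/

/-- The trigonometric polynomial with frequencies in `S` and coefficients `a`. -/
def trigPoly (S : Finset ℤ) (a : ℤ → ℂ) (x : ℝ) : ℂ := ∑ n ∈ S, a n * mode n x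

theorem perCont_trigPoly (S : Finset ℤ) (a : ℤ → ℂ) : PerCont (trigPoly S a) := by
  refine ⟨?_, fun x => ?_⟩
  · unfold trigPoly
    exact continuous_finsetSum _ fun n _ => continuous_const.mul (continuous_mode n)
  · unfold trigPoly
    simp only [mode_periodic _ x]

theorem hasDerivAt_trigPoly (S : Finset ℤ) (a : ℤ → ℂ) (x : ℝ) :
    HasDerivAt (trigPoly S a) (trigPoly S (fun n => a n * (2 * Real.pi * Complex.I * n)) x) x := by
  unfold trigPoly
  refine HasDerivAt.fun_sum fun n _ => ?_
  exact ((hasDerivAt_mode n x).const_mul (a n)).congr_deriv (by ring)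

theorem coeff_trigPoly (S : Finset ℤ) (a : ℤ → ℂ) (n : ℤ) :
    coeff (trigPoly S a) n = if n ∈ S then a n else 0 := by
  have h : ∀ m, ∫ x in (0 : ℝ)..1, mode (-n) x * (a m * mode m x) = if m = n then a n else 0 := by
    intro m
    have := coeff_mode m n
    rw [coeff_eq] at this
    simp only [mul_left_comm _ (a m), intervalIntegral.integral_const_mul, this]
    by_cases h : n = m
    · simp [h]
    · simp [h, Ne.symm h]
  rw [coeff_eq]
  unfold trigPoly
  simp only [Finset.mul_sum]
  have hi : ∀ m ∈ S, IntervalIntegrable (fun x => mode (-n) x * (a m * mode m x)) volume 0 1 :=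
    fun m _ => ((continuous_mode _).mul
      (continuous_const.mul (continuous_mode m))).intervalIntegrable _ _
  rw [intervalIntegral.integral_finsetSum hi]
  simp [h]

/-- Trigonometric polynomials are dense in `H^σ`. -/
theorem exists_trigPoly_near {σ : ℝ} {f : ℝ → ℂ} (hf : PerCont f) (hN : sobSq σ f < ⊤) {ε : ℝ≥0∞}
    (hε : 0 < ε) : ∃ S a, sobSq σ (f - trigPoly S a) < ε := by
  have h := ENNReal.tendsto_tsum_compl_atTop_zero hN.ne
  obtain ⟨S, hS⟩ := (h.eventually_lt_const hε).exists
  refine ⟨S, coeff f, lt_of_le_of_lt (le_of_eq ?_) hS⟩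
  unfold sobSq
  have e := tsum_subtype ({n | n ∉ S} : Set ℤ) (fun n => wt σ n * ‖coeff f n‖ₑ ^ 2)
  refine Eq.trans ?_ e.symm
  refine tsum_congr fun n => ?_
  rw [coeff_sub hf.1 (perCont_trigPoly S _).1, coeff_trigPoly]
  by_cases hn : n ∈ S <;> simp [hn]

theorem NearId.norm_comp_sub_le {δ : ℝ} {ψ g g' : ℝ → ℝ} (h : NearId δ ψ g g') {f f' : ℝ → ℂ}
    (hf : ∀ x, HasDerivAt f (f' x) x) {M : ℝ} (hM : ∀ x, ‖f' x‖ ≤ M) (x : ℝ) :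
    ‖f (ψ x) - f x‖ ≤ M * δ := by
  have := (convex_univ (𝕜 := ℝ) (E := ℝ)).norm_image_sub_le_of_norm_hasDerivWithin_le
    (f := f) (f' := f') (fun x _ => (hf x).hasDerivWithinAt) (fun x _ => hM x)
    (mem_univ x) (mem_univ (ψ x))
  refine this.trans ?_
  have hM0 : 0 ≤ M := (norm_nonneg _).trans (hM 0)
  gcongr
  exact h.abs_sub_id x

/-- For a fixed trigonometric polynomial `G`, the difference `G ∘ ψ - G` is small in `H²`. -/
theorem exists_sobSq_two_trigPoly_comp_sub_le (S : Finset ℤ) (a : ℤ → ℂ) :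
    ∃ M : ℝ, ∀ {δ : ℝ} {ψ g g' : ℝ → ℝ}, NearId δ ψ g g' →
      sobSq 2 (trigPoly S a ∘ ψ - trigPoly S a) ≤ 4 * ENNReal.ofReal ((M * δ) ^ 2) := by
  set D : (ℤ → ℂ) → ℤ → ℂ := fun a n => a n * (2 * Real.pi * Complex.I * n) with hD
  set f0 := trigPoly S a with hf0
  set f1 := trigPoly S (D a) with hf1
  set f2 := trigPoly S (D (D a)) with hf2
  set f3 := trigPoly S (D (D (D a))) with hf3
  have p0 : PerCont f0 := perCont_trigPoly S _
  have p1 : PerCont f1 := perCont_trigPoly S _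
  have p2 : PerCont f2 := perCont_trigPoly S _
  have p3 : PerCont f3 := perCont_trigPoly S _
  have d0 : ∀ x, HasDerivAt f0 (f1 x) x := hasDerivAt_trigPoly S a
  have d1 : ∀ x, HasDerivAt f1 (f2 x) x := hasDerivAt_trigPoly S (D a)
  have d2 : ∀ x, HasDerivAt f2 (f3 x) x := hasDerivAt_trigPoly S (D (D a))
  obtain ⟨M1, hM1⟩ := p1.bounded
  obtain ⟨M2, hM2⟩ := p2.bounded
  obtain ⟨M3, hM3⟩ := p3.bounded
  have n1 := (norm_nonneg _).trans (hM1 0)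
  have n2 := (norm_nonneg _).trans (hM2 0)
  have n3 := (norm_nonneg _).trans (hM3 0)
  set M := M1 + M2 + M3 with hM
  refine ⟨6 * M, fun {δ ψ g g'} h => ?_⟩
  have hδ : 0 ≤ δ := (abs_nonneg _).trans (h.abs_sub_id 0)
  set G : ℝ → ℂ := fun x => (g x : ℂ) with hG
  set G' : ℝ → ℂ := fun x => (g' x : ℂ) with hG'
  have pG : PerCont G := h.perCont_g
  have pG' : PerCont G' := h.perCont_g'
  have q1 : PerCont (f1 * G) := p1.mul pG
  have q2 : PerCont ((f2 * G + f1 * G') * G) := ((p2.mul pG).add (p1.mul pG')).mul pG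
  have c1 := h.hasDerivAt_comp d0
  have c2 := h.hasDerivAt_comp (h.hasDerivAt_mul_g d1)
  have hG1 : ∀ y, ‖G y - 1‖ ≤ δ := fun y => by
    have := h.abs_g y
    rw [hG, ← Complex.ofReal_one, ← Complex.ofReal_sub, Complex.norm_real]
    exact this
  have k0 : ∀ x, ‖(f0 ∘ ψ - f0) x‖ ≤ 6 * M * δ := fun x =>
    (h.norm_comp_sub_le d0 (M := M1) hM1 x).trans (by gcongr; linarith)
  have k1 : ∀ x, ‖((f1 * G) ∘ ψ - f1) x‖ ≤ 6 * M * δ := fun x => by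
    have e : ((f1 * G) ∘ ψ - f1) x = f1 (ψ x) * (G (ψ x) - 1) + (f1 (ψ x) - f1 x) := by
      simp only [Pi.sub_apply, Function.comp_apply, Pi.mul_apply]; ring
    have a1 := h.norm_comp_sub_le d1 (M := M2) hM2 x
    have a2 : ‖f1 (ψ x) * (G (ψ x) - 1)‖ ≤ M1 * δ := by
      rw [norm_mul]; gcongr
      · exact hM1 _
      · exact hG1 _
    rw [e]
    refine (norm_add_le _ _).trans ?_
    nlinarith
  have k2 : ∀ x, ‖(((f2 * G + f1 * G') * G) ∘ ψ - f2) x‖ ≤ 6 * M * δ := fun x => by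
    have e : (((f2 * G + f1 * G') * G) ∘ ψ - f2) x = f2 (ψ x) * (G (ψ x) + 1) * (G (ψ x) - 1) +
        f1 (ψ x) * G (ψ x) * G' (ψ x) + (f2 (ψ x) - f2 x) := by
      simp only [Pi.sub_apply, Function.comp_apply, Pi.mul_apply, Pi.add_apply]; ring
    have a1 := h.norm_comp_sub_le d2 (M := M3) hM3 x
    have a2 : ‖f2 (ψ x) * (G (ψ x) + 1) * (G (ψ x) - 1)‖ ≤ M2 * 3 * δ := by
      rw [norm_mul, norm_mul]; gcongr
      · exact hM2 _
      · refine (norm_add_le _ _).trans ?_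
        have := h.norm_g_le (ψ x)
        rw [norm_one]; linarith
      · exact hG1 _
    have a3 : ‖f1 (ψ x) * G (ψ x) * G' (ψ x)‖ ≤ M1 * 2 * δ := by
      rw [norm_mul, norm_mul]; gcongr
      · exact hM1 _
      · exact h.norm_g_le _
      · exact h.norm_g'_le _
    rw [e]
    refine (norm_add_le _ _).trans ((add_le_add_left (norm_add_le _ _) _).trans ?_)
    nlinarith
  rw [sobSq_two_eq ((h.perCont_comp p0).sub p0) ((h.perCont_comp q1).sub p1)
    ((h.perCont_comp q2).sub p2).1 (fun x => (c1 x).sub (d0 x)) (fun x => (c2 x).sub (d1 x))]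
  have b0 := sobSq_zero_le_of_bound ((h.perCont_comp p0).sub p0).1 k0
  have b1 := sobSq_zero_le_of_bound ((h.perCont_comp q1).sub p1).1 k1
  have b2 := sobSq_zero_le_of_bound ((h.perCont_comp q2).sub p2).1 k2
  set B := ENNReal.ofReal ((6 * M * δ) ^ 2)
  calc _ ≤ B + 2 * (1 * B) + 1 * (1 * B) := by
        gcongr
        · exact fourPiSq_inv_le_one
        · exact fourPiSq_inv_le_one
        · exact fourPiSq_inv_le_one
    _ = 4 * B := by ring

variable {ι : Type*} {l : Filter ι} {δ : ι → ℝ} {ψ g g' : ι → ℝ → ℝ}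

/-- Continuity of composition at the identity in `H^σ` for small `σ`, by density of trigonometric
polynomials. -/
theorem HTendsto.comp_of_lt_two (h : ∀ᶠ i in l, NearId (δ i) (ψ i) (g i) (g' i))
    (hδ : Tendsto δ l (𝓝 0)) {σ : ℝ} (h0 : 0 < σ) (h2 : σ < 2) {F : ι → ℝ → ℂ} {F₀ : ℝ → ℂ}
    (hF : HTendsto σ F l F₀) : HTendsto σ (fun i => F i ∘ ψ i) l F₀ := by
  refine ⟨?_, hF.perCont_lim, hF.lt_top, ?_⟩
  · filter_upwards [h, hF.perCont] with i h1 h2 using h1.perCont_comp h2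
  rw [ENNReal.tendsto_nhds_zero]
  intro ε hε
  have hη : 0 < ε / 1000 := ENNReal.div_pos hε.ne' (by norm_num)
  obtain ⟨S, a, hG⟩ := exists_trigPoly_near hF.perCont_lim hF.lt_top hη
  obtain ⟨M, hM⟩ := exists_sobSq_two_trigPoly_comp_sub_le S a
  have t : Tendsto (fun i => 4 * ENNReal.ofReal ((M * δ i) ^ 2)) l (𝓝 0) := by
    have : Tendsto (fun i => (M * δ i) ^ 2) l (𝓝 ((M * 0) ^ 2)) := (hδ.const_mul M).pow 2
    have := ENNReal.tendsto_ofReal this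
    rw [mul_zero, zero_pow two_ne_zero, ENNReal.ofReal_zero] at this
    exact ennreal_tendsto_zero_mul this (by norm_num)
  filter_upwards [h, hF.perCont, hF.tendsto.eventually_lt_const hη, t.eventually_lt_const hη]
    with i hi pF h3 h4
  set G := trigPoly S a
  have pG : PerCont G := perCont_trigPoly S a
  have p0 := hF.perCont_lim
  have q1 : PerCont ((F i - F₀) ∘ ψ i) := hi.perCont_comp (pF.sub p0)
  have q2 : PerCont ((F₀ - G) ∘ ψ i) := hi.perCont_comp (p0.sub pG)
  have q3 : PerCont (G ∘ ψ i - G) := (hi.perCont_comp pG).sub pG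
  have q4 : PerCont (F₀ - G) := p0.sub pG
  have e : F i ∘ ψ i - F₀ = ((F i - F₀) ∘ ψ i + (F₀ - G) ∘ ψ i) + ((G ∘ ψ i - G) - (F₀ - G)) := by
    ext x; simp
  have b1 := hi.sobSq_comp_le h0 h2 (pF.sub p0)
  have b2 := hi.sobSq_comp_le h0 h2 q4
  have b3 : sobSq σ (G ∘ ψ i - G) ≤ ε / 1000 := (sobSq_mono h2.le _).trans ((hM hi).trans h4.le)
  rw [e]
  calc _ ≤ 2 * (2 * sobSq σ ((F i - F₀) ∘ ψ i) + 2 * sobSq σ ((F₀ - G) ∘ ψ i)) +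
        2 * (2 * sobSq σ (G ∘ ψ i - G) + 2 * sobSq σ (F₀ - G)) := by
        refine (sobSq_add_le (q1.add q2).1 (q3.sub q4).1 σ).trans ?_
        gcongr
        · exact sobSq_add_le q1.1 q2.1 σ
        · exact sobSq_sub_le q3.1 q4.1 σ
    _ ≤ 2 * (2 * (100 * (ε / 1000)) + 2 * (100 * (ε / 1000))) +
        2 * (2 * (ε / 1000) + 2 * (ε / 1000)) := by
        gcongr
        · exact b1.trans (by gcongr)
        · exact b2.trans (by gcongr)
    _ = 808 * (ε / 1000) := by ring
    _ ≤ 1000 * (ε / 1000) := by gcongr; norm_num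
    _ = ε := ENNReal.mul_div_cancel (by norm_num) (by norm_num)

theorem HTendsto.eventually_lt_top {σ : ℝ} {F : ι → ℝ → ℂ} {F₀ : ℝ → ℂ} (hF : HTendsto σ F l F₀) :
    ∀ᶠ i in l, sobSq σ (F i) < ⊤ := by
  filter_upwards [hF.tendsto.eventually_lt_const ENNReal.zero_lt_top, hF.perCont] with i h1 h2
  have e : F i = (F i - F₀) + F₀ := by ring
  rw [e]
  exact sobSq_add_lt_top (h2.sub hF.perCont_lim) hF.perCont_lim h1 hF.lt_top

/-- Continuity of composition at the identity in `H^σ` for all `σ > 1/2`: the derivative of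
`F ∘ ψ` is `(F' g) ∘ ψ`, so that the order can be raised by one. -/
theorem HTendsto.comp_add_nat (h : ∀ᶠ i in l, NearId (δ i) (ψ i) (g i) (g' i))
    (hδ : Tendsto δ l (𝓝 0)) {σ : ℝ} (h0 : 1 / 2 < σ) (h2 : σ < 2) (k : ℕ) {F : ι → ℝ → ℂ}
    {F₀ : ℝ → ℂ} (hg : HTendsto (σ + k) (fun i x => (g i x : ℂ)) l 1)
    (hF : HTendsto (σ + k) F l F₀) :
    HTendsto (σ + k) (fun i => F i ∘ ψ i) l F₀ := by
  induction k generalizing F F₀ with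
  | zero =>
    simp only [Nat.cast_zero, add_zero] at hF ⊢
    exact HTendsto.comp_of_lt_two h hδ (by linarith) h2 hF
  | succ k ih =>
    have ek : σ + ((k + 1 : ℕ) : ℝ) = σ + k + 1 := by push_cast; ring
    rw [ek] at hg hF ⊢
    have hk : (0 : ℝ) ≤ k := k.cast_nonneg
    have hg' : HTendsto (σ + k) (fun i x => (g i x : ℂ)) l 1 := hg.mono (by linarith)
    have hN : ∀ᶠ i in l, PerCont (F i) ∧ sobSq (σ + k + 1) (F i) < ⊤ :=
      hF.perCont.and hF.eventually_lt_top
    obtain ⟨F₀', p0', d0'⟩ := hF.perCont_lim.exists_deriv (by linarith) hF.lt_top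
    have hex : ∀ i, ∃ f', (PerCont (F i) ∧ sobSq (σ + k + 1) (F i) < ⊤) →
        PerCont f' ∧ ∀ x, HasDerivAt (F i) (f' x) x := fun i => by
      by_cases hi : PerCont (F i) ∧ sobSq (σ + k + 1) (F i) < ⊤
      · obtain ⟨f', h1, h2⟩ := hi.1.exists_deriv (by linarith) hi.2
        exact ⟨f', fun _ => ⟨h1, h2⟩⟩
      · exact ⟨0, fun h => absurd h hi⟩
    choose F' hF' using hex
    have hFd : ∀ᶠ i in l, Continuous (F' i) ∧ ∀ x, HasDerivAt (F i) (F' i x) x := by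
      filter_upwards [hN] with i hi using ⟨(hF' i hi).1.1, (hF' i hi).2⟩
    have tF' : HTendsto (σ + k) F' l F₀' := hF.deriv hFd p0'.1 d0'
    have tm := tF'.mul (by linarith) hg'
    rw [mul_one] at tm
    have i1 := ih hg' (hF.mono (by linarith))
    have i2 := ih hg' tm
    refine i1.succ_of_deriv i2 ?_ d0'
    filter_upwards [h, hFd] with i hi hd x using hi.hasDerivAt_comp hd.2 x

/-- Continuity of composition at the identity in `H^σ`, `σ > 1/2`. -/
theorem HTendsto.comp (h : ∀ᶠ i in l, NearId (δ i) (ψ i) (g i) (g' i))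
    (hδ : Tendsto δ l (𝓝 0)) {σ : ℝ} (hσ : 1 / 2 < σ) {F : ι → ℝ → ℂ}
    {F₀ : ℝ → ℂ} (hg : HTendsto σ (fun i x => (g i x : ℂ)) l 1) (hF : HTendsto σ F l F₀) :
    HTendsto σ (fun i => F i ∘ ψ i) l F₀ := by
  -- `σ` differs by an integer from a number in `(1/2, 3/2]`.
  obtain ⟨k, hk1, hk2⟩ : ∃ k : ℕ, 1 / 2 < σ - k ∧ σ - k < 2 := by
    refine ⟨⌈σ - 1 / 2⌉₊ - 1, ?_⟩
    have h1 : 1 ≤ ⌈σ - 1 / 2⌉₊ := Nat.one_le_ceil_iff.2 (by linarith)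
    have h2 := Nat.le_ceil (σ - 1 / 2)
    have h3 := Nat.ceil_lt_add_one (show 0 ≤ σ - 1 / 2 by linarith)
    rw [Nat.cast_sub h1]
    push_cast
    constructor <;> linarith
  have e : σ = (σ - k) + k := by ring
  rw [e] at hg hF ⊢
  exact HTendsto.comp_add_nat h hδ hk1 hk2 k hg hF

/-! ### Real-valued Sobolev functions -/

/-- A real-valued function, regarded as complex-valued. -/
def cx (f : ℝ → ℝ) (x : ℝ) : ℂ := (f x : ℂ)

theorem sobolevNormSq_eq_cx (σ : ℝ) (f : ℝ → ℝ) : sobolevNormSq σ f = sobSq σ (cx f) := rfl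

theorem cx_sub (f g : ℝ → ℝ) : cx (f - g) = cx f - cx g := by ext x; simp [cx]

theorem cx_add (f g : ℝ → ℝ) : cx (f + g) = cx f + cx g := by ext x; simp [cx]

theorem cx_mul (f g : ℝ → ℝ) : cx (f * g) = cx f * cx g := by ext x; simp [cx]

theorem cx_smul (a : ℝ) (f : ℝ → ℝ) : cx (a • f) = (a : ℂ) • cx f := by ext x; simp [cx]

theorem hasDerivAt_cx {f : ℝ → ℝ} {f' x : ℝ} (h : HasDerivAt f f' x) :
    HasDerivAt (cx f) (f' : ℂ) x := h.ofReal_comp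

namespace MemSobolev

variable {σ : ℝ} {f g : ℝ → ℝ}

theorem perCont (h : MemSobolev σ f) : PerCont (cx f) :=
  ⟨Complex.continuous_ofReal.comp h.1, fun x => by simp [cx, h.2.1 x]⟩

theorem lt_top (h : MemSobolev σ f) : sobSq σ (cx f) < ⊤ := h.2.2

theorem mono {τ : ℝ} (h : MemSobolev τ f) (hστ : σ ≤ τ) : MemSobolev σ f :=
  ⟨h.1, h.2.1, (sobSq_mono hστ (cx f)).trans_lt h.2.2⟩

theorem add (hf : MemSobolev σ f) (hg : MemSobolev σ g) : MemSobolev σ (f + g) :=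
  ⟨hf.1.add hg.1, hf.2.1.add hg.2.1, by
    rw [sobolevNormSq_eq_cx, cx_add]
    exact sobSq_add_lt_top hf.perCont hg.perCont hf.lt_top hg.lt_top⟩

theorem smul (a : ℝ) (hf : MemSobolev σ f) : MemSobolev σ (a • f) :=
  ⟨hf.1.const_smul a, fun x => by simp [hf.2.1 x], by
    rw [sobolevNormSq_eq_cx, cx_smul]
    exact sobSq_smul_lt_top _ hf.lt_top⟩

theorem sub (hf : MemSobolev σ f) (hg : MemSobolev σ g) : MemSobolev σ (f - g) := by
  have : f - g = f + (-1 : ℝ) • g := by ext; simp [sub_eq_add_neg]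
  rw [this]
  exact hf.add (hg.smul _)

theorem mul (hσ : 1 / 2 < σ) (hf : MemSobolev σ f) (hg : MemSobolev σ g) : MemSobolev σ (f * g) :=
  ⟨hf.1.mul hg.1, hf.2.1.mul hg.2.1, by
    rw [sobolevNormSq_eq_cx, cx_mul]
    exact sobSq_mul_lt_top hσ hf.perCont hg.perCont hf.lt_top hg.lt_top⟩

theorem hasDerivAt_and_continuous (hσ : 3 / 2 < σ) (hf : MemSobolev σ f) :
    (∀ x, HasDerivAt f (deriv f x) x) ∧ Continuous (deriv f) := by
  obtain ⟨f', hf', hd⟩ := hf.perCont.exists_deriv hσ hf.lt_top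
  have h1 : ∀ x, HasDerivAt f (f' x).re x := fun x => by
    have := (Complex.reCLM.hasFDerivAt.comp_hasDerivAt x (hd x))
    exact this
  have h2 : deriv f = fun x => (f' x).re := funext fun x => (h1 x).deriv
  rw [h2]
  exact ⟨h1, Complex.continuous_re.comp hf'.1⟩

theorem hasDerivAt (hσ : 3 / 2 < σ) (hf : MemSobolev σ f) (x : ℝ) : HasDerivAt f (deriv f x) x :=
  (hf.hasDerivAt_and_continuous hσ).1 x

theorem deriv (hσ : 3 / 2 < σ) (hf : MemSobolev σ f) : MemSobolev (σ - 1) (deriv f) := by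
  have hd := hf.hasDerivAt hσ
  have hc : ∀ x, HasDerivAt (cx f) (cx (_root_.deriv f) x) x := fun x => hasDerivAt_cx (hd x)
  have hcont := (hf.hasDerivAt_and_continuous hσ).2
  refine ⟨hcont, fun x => ?_, ?_⟩
  · have := periodic_of_hasDerivAt hc hf.perCont.2 x
    simpa [cx] using this
  · rw [sobolevNormSq_eq_cx]
    refine sobSq_deriv_lt_top hc hf.perCont.2 (Complex.continuous_ofReal.comp hcont) ?_
    rw [sub_add_cancel]
    exact hf.lt_top

end MemSobolev

theorem hTendsto_cx_iff {ι : Type*} {l : Filter ι} {σ : ℝ} {F : ι → ℝ → ℝ} {F₀ : ℝ → ℝ}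
    (hF : ∀ᶠ i in l, MemSobolev σ (F i)) (hF₀ : MemSobolev σ F₀) :
    HTendsto σ (fun i => cx (F i)) l (cx F₀) ↔
      Tendsto (fun i => sobolevNormSq σ (F i - F₀)) l (𝓝 0) := by
  simp only [sobolevNormSq_eq_cx, cx_sub]
  exact ⟨fun h => h.tendsto, fun h => ⟨hF.mono fun i hi => hi.perCont, hF₀.perCont, hF₀.lt_top, h⟩⟩

theorem HTendsto.cx_deriv {ι : Type*} {l : Filter ι} {σ : ℝ} (hσ : 3 / 2 < σ) {F : ι → ℝ → ℝ}
    {F₀ : ℝ → ℝ} (hF : ∀ᶠ i in l, MemSobolev σ (F i)) (hF₀ : MemSobolev σ F₀)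
    (h : HTendsto σ (fun i => cx (F i)) l (cx F₀)) :
    HTendsto (σ - 1) (fun i => cx (_root_.deriv (F i))) l (cx (_root_.deriv F₀)) := by
  rw [show σ = σ - 1 + 1 by ring] at h
  refine h.deriv ?_ (hF₀.deriv hσ).perCont.1 fun x => hasDerivAt_cx (hF₀.hasDerivAt hσ x)
  filter_upwards [hF] with i hi
  exact ⟨(hi.deriv hσ).perCont.1, fun x => hasDerivAt_cx (hi.hasDerivAt hσ x)⟩

/-! ### Curves in Sobolev spaces -/

theorem mem_nhds_of_lt {T : EReal} {t b : ℝ} (ht : 0 < t) (htb : t < b) (hb : b ∈ timeInterval T) :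
    timeInterval T ∈ 𝓝 t := by
  filter_upwards [Ioo_mem_nhds ht htb] with τ hτ
  exact ⟨hτ.1.le, (EReal.coe_lt_coe_iff.2 hτ.2).trans hb.2⟩

theorem Icc_subset_timeInterval {T : EReal} {b : ℝ} (hb : b ∈ timeInterval T) :
    Icc 0 b ⊆ timeInterval T := fun _ hτ =>
  ⟨hτ.1, (EReal.coe_le_coe_iff.2 hτ.2).trans_lt hb.2⟩

/-- The difference quotients of `v` at the time `t` converge to `w`, uniformly in space. -/
def UnifDeriv (I : Set ℝ) (v : ℝ → ℝ → ℝ) (w : ℝ → ℝ) (t : ℝ) : Prop :=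
  ∀ ε > 0, ∀ᶠ τ in 𝓝[I \ {t}] t, ∀ x, |(τ - t)⁻¹ * (v τ x - v t x) - w x| ≤ ε

theorem continuousInSobolev_iff {σ : ℝ} {T : EReal} {v : ℝ → ℝ → ℝ}
    (hv : ∀ t ∈ timeInterval T, MemSobolev σ (v t)) : ContinuousInSobolev σ T v ↔
      ∀ t ∈ timeInterval T, HTendsto σ (fun τ => cx (v τ)) (𝓝[timeInterval T] t) (cx (v t)) := by
  refine forall₂_congr fun t ht => (hTendsto_cx_iff ?_ (hv t ht)).symm
  filter_upwards [self_mem_nhdsWithin] with τ hτ using hv τ hτ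

theorem memSobolev_diffQuot {σ : ℝ} {T : EReal} {v : ℝ → ℝ → ℝ}
    (hv : ∀ t ∈ timeInterval T, MemSobolev σ (v t)) {t : ℝ} (ht : t ∈ timeInterval T) :
    ∀ᶠ τ in 𝓝[timeInterval T \ {t}] t, MemSobolev σ ((τ - t)⁻¹ • (v τ - v t)) := by
  filter_upwards [self_mem_nhdsWithin] with τ hτ using ((hv τ hτ.1).sub (hv t ht)).smul _

theorem hasDerivInSobolev_iff {σ : ℝ} {T : EReal} {v w : ℝ → ℝ → ℝ}
    (hv : ∀ t ∈ timeInterval T, MemSobolev σ (v t))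
    (hw : ∀ t ∈ timeInterval T, MemSobolev σ (w t)) : HasDerivInSobolev σ T v w ↔
      ∀ t ∈ timeInterval T, HTendsto σ (fun τ => cx ((τ - t)⁻¹ • (v τ - v t)))
        (𝓝[timeInterval T \ {t}] t) (cx (w t)) :=
  forall₂_congr fun t ht => (hTendsto_cx_iff (memSobolev_diffQuot hv ht) (hw t ht)).symm

theorem ContinuousInSobolev.deriv {σ : ℝ} (hσ : 3 / 2 < σ) {T : EReal} {v : ℝ → ℝ → ℝ}
    (hv : ∀ t ∈ timeInterval T, MemSobolev σ (v t)) (h : ContinuousInSobolev σ T v) :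
    ContinuousInSobolev (σ - 1) T (fun t => _root_.deriv (v t)) := by
  rw [continuousInSobolev_iff hv] at h
  rw [continuousInSobolev_iff fun t ht => (hv t ht).deriv hσ]
  intro t ht
  refine (h t ht).cx_deriv hσ ?_ (hv t ht)
  filter_upwards [self_mem_nhdsWithin] with τ hτ using hv τ hτ

theorem HasDerivInSobolev.deriv {σ : ℝ} (hσ : 3 / 2 < σ) {T : EReal} {v w : ℝ → ℝ → ℝ}
    (hv : ∀ t ∈ timeInterval T, MemSobolev σ (v t))
    (hw : ∀ t ∈ timeInterval T, MemSobolev σ (w t)) (h : HasDerivInSobolev σ T v w) :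
    HasDerivInSobolev (σ - 1) T (fun t => _root_.deriv (v t)) (fun t => _root_.deriv (w t)) := by
  rw [hasDerivInSobolev_iff hv hw] at h
  rw [hasDerivInSobolev_iff (fun t ht => (hv t ht).deriv hσ) fun t ht => (hw t ht).deriv hσ]
  intro t ht
  refine ((h t ht).cx_deriv hσ (memSobolev_diffQuot hv ht) (hw t ht)).congr' ?_
  filter_upwards [self_mem_nhdsWithin] with τ hτ
  congr 1
  ext x
  exact (((hv τ hτ.1).hasDerivAt hσ x).sub ((hv t ht).hasDerivAt hσ x)).const_smul _ |>.deriv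

theorem HTendsto.eventually_abs_le {ι : Type*} {l : Filter ι} {σ : ℝ} (hσ : 1 / 2 < σ)
    {F : ι → ℝ → ℝ} {F₀ : ℝ → ℝ} (h : HTendsto σ (fun i => cx (F i)) l (cx F₀)) {ε : ℝ}
    (hε : 0 < ε) : ∀ᶠ i in l, ∀ x, |F i x - F₀ x| ≤ ε := by
  filter_upwards [h.eventually_norm_le hσ hε] with i hi x
  have := hi x
  rwa [cx, cx, ← Complex.ofReal_sub, Complex.norm_real] at this

/-- A continuous curve in `H^σ`, `σ > 1/2`, is jointly continuous in time and space. -/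
theorem ContinuousInSobolev.continuousOn {σ : ℝ} (hσ : 1 / 2 < σ) {T : EReal} {v : ℝ → ℝ → ℝ}
    (hv : ∀ t ∈ timeInterval T, MemSobolev σ (v t)) (h : ContinuousInSobolev σ T v) :
    ContinuousOn (fun p : ℝ × ℝ => v p.1 p.2) (timeInterval T ×ˢ univ) := by
  rw [continuousInSobolev_iff hv] at h
  rintro ⟨t, x⟩ ⟨ht, -⟩
  rw [ContinuousWithinAt, Metric.tendsto_nhds]
  intro ε hε
  have h1 := (h t ht).eventually_abs_le hσ (half_pos hε)
  have h2 : ∀ᶠ y in 𝓝 x, |v t y - v t x| < ε / 2 := by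
    have := Metric.tendsto_nhds.1 ((hv t ht).1.tendsto x) (ε / 2) (half_pos hε)
    simpa [Real.dist_eq] using this
  rw [nhdsWithin_prod_eq, nhdsWithin_univ]
  filter_upwards [h1.prod_mk h2] with p hp
  rw [Real.dist_eq]
  calc |v p.1 p.2 - v t x| = |(v p.1 p.2 - v t p.2) + (v t p.2 - v t x)| := by ring_nf
    _ ≤ |v p.1 p.2 - v t p.2| + |v t p.2 - v t x| := abs_add_le _ _
    _ < ε := by linarith [hp.1 p.2, hp.2]

theorem HasDerivInSobolev.unifDeriv {σ : ℝ} (hσ : 1 / 2 < σ) {T : EReal} {v w : ℝ → ℝ → ℝ}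
    (hv : ∀ t ∈ timeInterval T, MemSobolev σ (v t))
    (hw : ∀ t ∈ timeInterval T, MemSobolev σ (w t)) (h : HasDerivInSobolev σ T v w) {t : ℝ}
    (ht : t ∈ timeInterval T) : UnifDeriv (timeInterval T) v (w t) t := by
  intro ε hε
  rw [hasDerivInSobolev_iff hv hw] at h
  filter_upwards [(h t ht).eventually_abs_le hσ hε] with τ hτ x
  simpa using hτ x

/-- The chain rule along a moving point. -/
theorem UnifDeriv.hasDerivWithinAt {I : Set ℝ} {v : ℝ → ℝ → ℝ} {w : ℝ → ℝ} {t : ℝ}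
    (h : UnifDeriv I v w t) (hw : Continuous w) {y : ℝ → ℝ} {v' y' : ℝ}
    (hv : HasDerivAt (v t) v' (y t)) (hy : HasDerivWithinAt y y' I t) :
    HasDerivWithinAt (fun τ => v τ (y τ)) (w (y t) + v' * y') I t := by
  rw [hasDerivWithinAt_iff_tendsto_slope]
  have h1 := hasDerivWithinAt_iff_tendsto_slope.1 (hv.comp_hasDerivWithinAt t hy)
  have h2 : Tendsto (fun τ => w (y τ)) (𝓝[I \ {t}] t) (𝓝 (w (y t))) :=
    (hw.tendsto _).comp (hy.continuousWithinAt.mono sdiff_subset)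
  have h3 : Tendsto (fun τ => (τ - t)⁻¹ * (v τ (y τ) - v t (y τ)) - w (y τ)) (𝓝[I \ {t}] t)
      (𝓝 0) := by
    rw [Metric.tendsto_nhds]
    intro ε hε
    filter_upwards [h (ε / 2) (half_pos hε)] with τ hτ
    rw [Real.dist_eq, sub_zero]
    linarith [hτ (y τ)]
  have := (h3.add h2).add h1
  rw [zero_add] at this
  refine this.congr fun τ => ?_
  simp only [slope_def_field, Function.comp_apply]
  rw [div_eq_inv_mul, div_eq_inv_mul]
  ring

/-! ### Solutions in the classical sense -/

/-- A classical solution on the time interval `I`, together with its derivatives: the equation for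
`u` is differentiated once in space, which makes the nonlocal term the constant
`½ ∫ (u_x² + ρ²)`. -/
structure ClassicalSolution (I : Set ℝ) (u ux uxx utx ρ ρx ρt : ℝ → ℝ → ℝ) : Prop where
  hasDerivAt_u : ∀ t ∈ I, ∀ x, HasDerivAt (u t) (ux t x) x
  hasDerivAt_ux : ∀ t ∈ I, ∀ x, HasDerivAt (ux t) (uxx t x) x
  hasDerivAt_ρ : ∀ t ∈ I, ∀ x, HasDerivAt (ρ t) (ρx t x) x
  cont_u : ContinuousOn (fun p : ℝ × ℝ => u p.1 p.2) (I ×ˢ univ)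
  cont_ux : ContinuousOn (fun p : ℝ × ℝ => ux p.1 p.2) (I ×ˢ univ)
  cont_uxx : ContinuousOn (fun p : ℝ × ℝ => uxx p.1 p.2) (I ×ˢ univ)
  cont_utx : ContinuousOn (fun p : ℝ × ℝ => utx p.1 p.2) (I ×ˢ univ)
  cont_ρ : ContinuousOn (fun p : ℝ × ℝ => ρ p.1 p.2) (I ×ˢ univ)
  cont_ρx : ContinuousOn (fun p : ℝ × ℝ => ρx p.1 p.2) (I ×ˢ univ)
  cont_ρt : ContinuousOn (fun p : ℝ × ℝ => ρt p.1 p.2) (I ×ˢ univ)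
  unifDeriv_ux : ∀ t ∈ I, UnifDeriv I ux (utx t) t
  unifDeriv_ρ : ∀ t ∈ I, UnifDeriv I ρ (ρt t) t
  periodic_u : ∀ t ∈ I, Function.Periodic (u t) 1
  periodic_ρ : ∀ t ∈ I, Function.Periodic (ρ t) 1
  u_zero : ∀ t ∈ I, u t 0 = 0
  eq_u : ∀ t ∈ I, ∀ x, utx t x + u t x * uxx t x =
    -(1 / 2) * ux t x ^ 2 + 1 / 2 * ρ t x ^ 2 -
      1 / 2 * ∫ y in (0 : ℝ)..1, (ux t y ^ 2 + ρ t y ^ 2)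
  eq_ρ : ∀ t ∈ I, ∀ x, ρt t x + u t x * ρx t x = -(ρ t x * ux t x)

/-- The operator `A⁻¹ ∂ₓ` in closed form. -/
theorem invA_deriv {q : ℝ → ℝ} {q' : ℝ → ℝ} (hq : ∀ x, HasDerivAt q (q' x) x)
    (hq' : Continuous q') (x : ℝ) :
    invA (deriv q) x = -(∫ y in (0 : ℝ)..x, q y) + x * ∫ y in (0 : ℝ)..1, q y := by
  have e : deriv q = q' := funext fun x => (hq x).deriv
  have hc : Continuous q := continuous_iff_continuousAt.2 fun x => (hq x).continuousAt
  have h1 : ∀ y, ∫ z in (0 : ℝ)..y, q' z = q y - q 0 := fun y =>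
    intervalIntegral.integral_eq_sub_of_hasDerivAt (fun z _ => hq z) (hq'.intervalIntegrable _ _)
  unfold invA
  simp only [e, h1]
  rw [intervalIntegral.integral_sub (hc.intervalIntegrable _ _) intervalIntegrable_const,
    intervalIntegral.integral_sub (hc.intervalIntegrable _ _) intervalIntegrable_const]
  simp only [intervalIntegral.integral_const, smul_eq_mul]
  ring

/-- A solution in the sense of `IsSolution`, together with its time derivatives. -/
structure StrongSolution (s : ℝ) (T : EReal) (u ρ ut ρt : ℝ → ℝ → ℝ) : Prop where
  mem_u : ∀ t ∈ timeInterval T, MemSobolev s (u t)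
  u_zero : ∀ t ∈ timeInterval T, u t 0 = 0
  mem_ρ : ∀ t ∈ timeInterval T, MemSobolev (s - 1) (ρ t)
  mem_ut : ∀ t ∈ timeInterval T, MemSobolev (s - 1) (ut t)
  ut_zero : ∀ t ∈ timeInterval T, ut t 0 = 0
  mem_ρt : ∀ t ∈ timeInterval T, MemSobolev (s - 2) (ρt t)
  cont_u : ContinuousInSobolev s T u
  cont_ρ : ContinuousInSobolev (s - 1) T ρ
  cont_ut : ContinuousInSobolev (s - 1) T ut
  cont_ρt : ContinuousInSobolev (s - 2) T ρt
  deriv_u : HasDerivInSobolev (s - 1) T u ut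
  deriv_ρ : HasDerivInSobolev (s - 2) T ρ ρt
  equation : ∀ t ∈ timeInterval T, ∀ x : ℝ,
    ut t x + u t x * deriv (u t) x =
      -(1 / 2) * invA (deriv fun y => deriv (u t) y ^ 2 + ρ t y ^ 2) x ∧
    ρt t x + u t x * deriv (ρ t) x = -(ρ t x * deriv (u t) x)

theorem isSolution_iff {s : ℝ} {T : EReal} {u ρ : ℝ → ℝ → ℝ} :
    IsSolution s T u ρ ↔ ∃ ut ρt, StrongSolution s T u ρ ut ρt := by
  constructor
  · rintro ⟨hmem, hcu, hcρ, ut, ρt, hmem', hcut, hcρt, hdu, hdρ, heq⟩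
    exact ⟨ut, ρt, fun t ht => (hmem t ht).1.1, fun t ht => (hmem t ht).1.2,
      fun t ht => (hmem t ht).2, fun t ht => (hmem' t ht).1.1, fun t ht => (hmem' t ht).1.2,
      fun t ht => (hmem' t ht).2, hcu, hcρ, hcut, hcρt, hdu, hdρ, heq⟩
  · rintro ⟨ut, ρt, h⟩
    exact ⟨fun t ht => ⟨⟨h.mem_u t ht, h.u_zero t ht⟩, h.mem_ρ t ht⟩, h.cont_u, h.cont_ρ, ut, ρt,
      fun t ht => ⟨⟨h.mem_ut t ht, h.ut_zero t ht⟩, h.mem_ρt t ht⟩, h.cont_ut, h.cont_ρt,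
      h.deriv_u, h.deriv_ρ, h.equation⟩

theorem StrongSolution.classicalSolution {s : ℝ} (hs : 9 / 2 < s) {T : EReal}
    {u ρ ut ρt : ℝ → ℝ → ℝ} (h : StrongSolution s T u ρ ut ρt) :
    ClassicalSolution (timeInterval T) u (fun t => deriv (u t)) (fun t => deriv (deriv (u t)))
      (fun t => deriv (ut t)) ρ (fun t => deriv (ρ t)) ρt := by
  obtain ⟨mu, u_zero, mρ, mu', ut_zero, mρt, hcu, hcρ, hcut, hcρt, hdu, hdρ, heq⟩ := h
  have mux : ∀ t ∈ timeInterval T, MemSobolev (s - 1) (deriv (u t)) := fun t ht =>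
    (mu t ht).deriv (by linarith)
  have muxx : ∀ t ∈ timeInterval T, MemSobolev (s - 1 - 1) (deriv (deriv (u t))) := fun t ht =>
    (mux t ht).deriv (by linarith)
  have mutx : ∀ t ∈ timeInterval T, MemSobolev (s - 1 - 1) (deriv (ut t)) := fun t ht =>
    (mu' t ht).deriv (by linarith)
  have mρx : ∀ t ∈ timeInterval T, MemSobolev (s - 1 - 1) (deriv (ρ t)) := fun t ht =>
    (mρ t ht).deriv (by linarith)
  have mu1 : ∀ t ∈ timeInterval T, MemSobolev (s - 1) (u t) := fun t ht =>
    (mu t ht).mono (by linarith)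
  have mρ2 : ∀ t ∈ timeInterval T, MemSobolev (s - 2) (ρ t) := fun t ht =>
    (mρ t ht).mono (by linarith)
  have cux := hcu.deriv (by linarith) mu
  refine
    { hasDerivAt_u := fun t ht x => (mu t ht).hasDerivAt (by linarith) x
      hasDerivAt_ux := fun t ht x => (mux t ht).hasDerivAt (by linarith) x
      hasDerivAt_ρ := fun t ht x => (mρ t ht).hasDerivAt (by linarith) x
      cont_u := hcu.continuousOn (by linarith) mu
      cont_ux := cux.continuousOn (by linarith) mux
      cont_uxx := (cux.deriv (by linarith) mux).continuousOn (by linarith) muxx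
      cont_utx := (hcut.deriv (by linarith) mu').continuousOn (by linarith) mutx
      cont_ρ := hcρ.continuousOn (by linarith) mρ
      cont_ρx := (hcρ.deriv (by linarith) mρ).continuousOn (by linarith) mρx
      cont_ρt := hcρt.continuousOn (by linarith) mρt
      unifDeriv_ux := fun t ht =>
        (hdu.deriv (by linarith) mu1 mu').unifDeriv (by linarith)
          (fun t ht => (mu1 t ht).deriv (by linarith)) mutx ht
      unifDeriv_ρ := fun t ht => hdρ.unifDeriv (by linarith) mρ2 mρt ht
      periodic_u := fun t ht => (mu t ht).2.1
      periodic_ρ := fun t ht => (mρ t ht).2.1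
      u_zero := u_zero
      eq_u := fun t ht x => ?_
      eq_ρ := fun t ht x => (heq t ht x).2 }
  have dux := fun x => (mux t ht).hasDerivAt (by linarith) x
  have dρ := fun x => (mρ t ht).hasDerivAt (by linarith) x
  have du := fun x => (mu t ht).hasDerivAt (by linarith) x
  have dut := fun x => (mu' t ht).hasDerivAt (by linarith) x
  set q : ℝ → ℝ := fun y => deriv (u t) y ^ 2 + ρ t y ^ 2 with hq
  have dq : ∀ x, HasDerivAt q (2 * deriv (u t) x * deriv (deriv (u t)) x +
      2 * ρ t x * deriv (ρ t) x) x := fun x => by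
    exact (((dux x).pow 2).add ((dρ x).pow 2)).congr_deriv (by simp)
  have cq : Continuous q := continuous_iff_continuousAt.2 fun x => (dq x).continuousAt
  have key : ∀ y, ut t y + u t y * deriv (u t) y =
      -(1 / 2) * (-(∫ z in (0 : ℝ)..y, q z) + y * ∫ z in (0 : ℝ)..1, q z) := fun y => by
    rw [(heq t ht y).1, invA_deriv dq]
    exact ((continuous_const.mul (mux t ht).1).mul (muxx t ht).1).add
      ((continuous_const.mul (mρ t ht).1).mul (mρx t ht).1)
  have h1 : HasDerivAt (fun y => ut t y + u t y * deriv (u t) y)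
      (deriv (ut t) x + (deriv (u t) x * deriv (u t) x + u t x * deriv (deriv (u t)) x)) x :=
    (dut x).add ((du x).mul (dux x))
  have h2 : HasDerivAt
      (fun y => -(1 / 2) * (-(∫ z in (0 : ℝ)..y, q z) + y * ∫ z in (0 : ℝ)..1, q z))
      (-(1 / 2) * (-(q x) + 1 * ∫ z in (0 : ℝ)..1, q z)) x :=
    (((cq.integral_hasStrictDerivAt 0 x).hasDerivAt.neg).add
      ((hasDerivAt_id x).mul_const _)).const_mul _
  have h3 := h1.unique ((funext key : (fun y => ut t y + u t y * deriv (u t) y) = _) ▸ h2)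
  simp only [hq] at h3 ⊢
  linear_combination h3

/-! ### Integrals depending on time -/

theorem continuous_slice {X : Type*} [TopologicalSpace X] {v : ℝ → ℝ → X} {I : Set ℝ}
    (hv : ContinuousOn (fun p : ℝ × ℝ => v p.1 p.2) (I ×ˢ univ)) {t : ℝ} (ht : t ∈ I) :
    Continuous (v t) := by
  rw [← continuousOn_univ]
  exact hv.comp (f := fun x => (t, x)) (by fun_prop) fun x _ => ⟨ht, mem_univ x⟩

section ParametricIntegral

variable {b : ℝ} {F F' : ℝ → ℝ → ℝ}

theorem continuousOn_integral (hb : 0 ≤ b)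
    (hF : ContinuousOn (fun p : ℝ × ℝ => F p.1 p.2) (Icc 0 b ×ˢ univ)) :
    ContinuousOn (fun t => ∫ x in (0 : ℝ)..1, F t x) (Icc 0 b) := by
  have h1 : Continuous (Function.uncurry fun (t x : ℝ) => F (max 0 (min t b)) x) := by
    rw [← continuousOn_univ]
    exact hF.comp (f := fun p : ℝ × ℝ => (max 0 (min p.1 b), p.2)) (by fun_prop)
      fun p _ => ⟨⟨le_max_left _ _, max_le hb (min_le_right _ _)⟩, mem_univ _⟩
  refine (intervalIntegral.continuous_parametric_intervalIntegral_of_continuous'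
    (μ := volume) h1 0 1).continuousOn.congr fun t ht => ?_
  simp only [min_eq_left ht.2, max_eq_right ht.1]

theorem hasDerivAt_integral
    (hF : ContinuousOn (fun p : ℝ × ℝ => F p.1 p.2) (Icc 0 b ×ˢ univ))
    (hF' : ContinuousOn (fun p : ℝ × ℝ => F' p.1 p.2) (Icc 0 b ×ˢ univ))
    (hd : ∀ t ∈ Ioo 0 b, ∀ x, HasDerivAt (fun τ => F τ x) (F' t x) t) {t : ℝ} (ht : t ∈ Ioo 0 b) :
    HasDerivAt (fun τ => ∫ x in (0 : ℝ)..1, F τ x) (∫ x in (0 : ℝ)..1, F' t x) t := by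
  obtain ⟨C, hC⟩ := (isCompact_Icc.prod (isCompact_Icc (a := (0 : ℝ)) (b := 1))
    ).exists_bound_of_continuousOn (hF'.mono (prod_mono_right (subset_univ _)))
  have hsub := Ioo_subset_Icc_self (a := (0 : ℝ)) (b := b)
  refine (intervalIntegral.hasDerivAt_integral_of_dominated_loc_of_deriv_le
    (bound := fun _ => C) (F := F) (F' := F') (s := Ioo 0 b) (Ioo_mem_nhds ht.1 ht.2) ?_
    ((continuous_slice hF (hsub ht)).intervalIntegrable _ _)
    (continuous_slice hF' (hsub ht)).aestronglyMeasurable ?_ intervalIntegrable_const ?_).2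
  · filter_upwards [Ioo_mem_nhds ht.1 ht.2] with τ hτ
    exact (continuous_slice hF (hsub hτ)).aestronglyMeasurable
  · refine ae_of_all _ fun x hx τ hτ => ?_
    rw [uIoc_of_le zero_le_one] at hx
    exact hC (τ, x) ⟨hsub hτ, hx.1.le, hx.2⟩
  · exact ae_of_all _ fun x _ τ hτ => hd τ hτ x

end ParametricIntegral

/-- Gronwall's lemma for a nonnegative function vanishing at time zero. -/
theorem eq_zero_of_deriv_le {E E' : ℝ → ℝ} {b K : ℝ} (hc : ContinuousOn E (Icc 0 b))
    (hd : ∀ t ∈ Ioo 0 b, HasDerivAt E (E' t) t) (hle : ∀ t ∈ Ioo 0 b, E' t ≤ K * E t)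
    (h0 : E 0 = 0) (hnn : ∀ t, 0 ≤ E t) {t : ℝ} (ht : t ∈ Icc 0 b) : E t = 0 := by
  have hexp : ∀ t, HasDerivAt (fun t => Real.exp (-K * t)) (Real.exp (-K * t) * (-K)) t :=
    fun t => by
    simpa using ((hasDerivAt_id t).const_mul (-K)).exp
  have hD : ∀ t ∈ Ioo 0 b, HasDerivAt (fun t => E t * Real.exp (-K * t))
      (E' t * Real.exp (-K * t) + E t * (Real.exp (-K * t) * (-K))) t :=
    fun t ht => (hd t ht).mul (hexp t)
  have hanti : AntitoneOn (fun t => E t * Real.exp (-K * t)) (Icc 0 b) := by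
    refine antitoneOn_of_deriv_nonpos (convex_Icc 0 b) (hc.mul (by fun_prop)) ?_ ?_
    · rw [interior_Icc]
      exact fun t ht => (hD t ht).differentiableAt.differentiableWithinAt
    · rw [interior_Icc]
      intro t ht
      rw [(hD t ht).deriv]
      nlinarith [hle t ht, Real.exp_pos (-K * t)]
  have := hanti (left_mem_Icc.2 (ht.1.trans ht.2)) ht ht.1
  simp only [h0, zero_mul] at this
  have hp := Real.exp_pos (-K * t)
  have := hnn t
  nlinarith

theorem eq_zero_of_integral_eq_zero {f : ℝ → ℝ} (hf : Continuous f) (hnn : ∀ x, 0 ≤ f x)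
    (h : ∫ x in (0 : ℝ)..1, f x = 0) {x : ℝ} (hx : x ∈ Icc (0 : ℝ) 1) : f x = 0 := by
  by_contra hne
  have := intervalIntegral.integral_pos one_pos hf.continuousOn (fun x _ => hnn x)
    ⟨x, hx, lt_of_le_of_ne (hnn x) (Ne.symm hne)⟩
  linarith

namespace ClassicalSolution

variable {T : EReal} {u ux uxx utx ρ ρx ρt : ℝ → ℝ → ℝ}

theorem hasDerivAt_comp_ux (h : ClassicalSolution (timeInterval T) u ux uxx utx ρ ρx ρt) {b t : ℝ}
    (hb : b ∈ timeInterval T) (ht : t ∈ Ioo 0 b) {y : ℝ → ℝ} {y' : ℝ} (hy : HasDerivAt y y' t) :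
    HasDerivAt (fun τ => ux τ (y τ)) (utx t (y t) + uxx t (y t) * y') t := by
  have hI := mem_nhds_of_lt ht.1 ht.2 hb
  have htI := mem_of_mem_nhds hI
  exact ((h.unifDeriv_ux t htI).hasDerivWithinAt (continuous_slice h.cont_utx htI)
    (h.hasDerivAt_ux t htI _) hy.hasDerivWithinAt).hasDerivAt hI

theorem hasDerivAt_comp_ρ (h : ClassicalSolution (timeInterval T) u ux uxx utx ρ ρx ρt) {b t : ℝ}
    (hb : b ∈ timeInterval T) (ht : t ∈ Ioo 0 b) {y : ℝ → ℝ} {y' : ℝ} (hy : HasDerivAt y y' t) :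
    HasDerivAt (fun τ => ρ τ (y τ)) (ρt t (y t) + ρx t (y t) * y') t := by
  have hI := mem_nhds_of_lt ht.1 ht.2 hb
  have htI := mem_of_mem_nhds hI
  exact ((h.unifDeriv_ρ t htI).hasDerivWithinAt (continuous_slice h.cont_ρt htI)
    (h.hasDerivAt_ρ t htI _) hy.hasDerivWithinAt).hasDerivAt hI

theorem u_one (h : ClassicalSolution (timeInterval T) u ux uxx utx ρ ρx ρt) {t : ℝ}
    (ht : t ∈ timeInterval T) : u t 1 = 0 := by
  have := h.periodic_u t ht 0
  rw [zero_add] at this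
  rw [this, h.u_zero t ht]

/-- Conservation of the energy `∫ (u_x² + ρ²)`: its density `q` satisfies
`q_t = -(u q + u ∫ q)_x`. -/
theorem energy_eq (h : ClassicalSolution (timeInterval T) u ux uxx utx ρ ρx ρt) {b : ℝ}
    (hb : b ∈ timeInterval T) : ∫ x in (0 : ℝ)..1, (ux b x ^ 2 + ρ b x ^ 2) =
      ∫ x in (0 : ℝ)..1, (ux 0 x ^ 2 + ρ 0 x ^ 2) := by
  have hsub : Icc 0 b ×ˢ (univ : Set ℝ) ⊆ timeInterval T ×ˢ univ :=
    prod_mono_left (Icc_subset_timeInterval hb)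
  set q : ℝ → ℝ → ℝ := fun t x => ux t x ^ 2 + ρ t x ^ 2 with hq
  set q' : ℝ → ℝ → ℝ := fun t x => 2 * ux t x * utx t x + 2 * ρ t x * ρt t x with hq'
  have c1 := h.cont_ux.mono hsub
  have c2 := h.cont_ρ.mono hsub
  have c3 := h.cont_utx.mono hsub
  have c4 := h.cont_ρt.mono hsub
  have hqc : ContinuousOn (fun p : ℝ × ℝ => q p.1 p.2) (Icc 0 b ×ˢ univ) := by
    simp only [hq]; fun_prop
  have hqc' : ContinuousOn (fun p : ℝ × ℝ => q' p.1 p.2) (Icc 0 b ×ˢ univ) := by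
    simp only [hq']; fun_prop
  have hd : ∀ t ∈ Ioo 0 b, ∀ x, HasDerivAt (fun τ => q τ x) (q' t x) t := by
    intro t ht x
    have d1 := h.hasDerivAt_comp_ux hb ht (hasDerivAt_const t x)
    have d2 := h.hasDerivAt_comp_ρ hb ht (hasDerivAt_const t x)
    refine ((d1.pow 2).add (d2.pow 2)).congr_deriv ?_
    simp only [hq']; ring
  have hzero : ∀ t ∈ Ioo 0 b, ∫ x in (0 : ℝ)..1, q' t x = 0 := by
    intro t ht
    have htI := Icc_subset_timeInterval hb (Ioo_subset_Icc_self ht)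
    have e : ∀ x, HasDerivAt (fun x => -(u t x * q t x + u t x * ∫ y in (0 : ℝ)..1, q t y))
        (q' t x) x := by
      intro x
      have dq := ((h.hasDerivAt_ux t htI x).pow 2).add ((h.hasDerivAt_ρ t htI x).pow 2)
      have du := h.hasDerivAt_u t htI x
      refine ((du.mul dq).add (du.mul_const _)).neg.congr_deriv ?_
      have e1 := h.eq_u t htI x
      have e2 := h.eq_ρ t htI x
      simp only [hq, hq', Pi.add_apply, Pi.pow_apply]
      push_cast
      linear_combination (-2 * ux t x) * e1 + (-2 * ρ t x) * e2
    rw [intervalIntegral.integral_eq_sub_of_hasDerivAt (fun x _ => e x)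
      ((continuous_slice hqc' (Ioo_subset_Icc_self ht)).intervalIntegrable _ _)]
    simp [h.u_one htI, h.u_zero t htI]
  have := eq_zero_of_deriv_le (E := fun t => ((∫ x in (0 : ℝ)..1, q t x) -
      ∫ x in (0 : ℝ)..1, q 0 x) ^ 2) (E' := fun _ => 0) (b := b) (K := 0)
    (((continuousOn_integral hb.1 hqc).sub continuousOn_const).pow 2)
    (fun t ht => (((hasDerivAt_integral hqc hqc' hd ht).sub_const _).pow 2).congr_deriv (by
      rw [hzero t ht]; simp)) (fun t _ => by simp) (by simp) (fun t => sq_nonneg _)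
    (right_mem_Icc.2 hb.1)
  exact sub_eq_zero.1 (pow_eq_zero_iff two_ne_zero |>.1 this)

end ClassicalSolution

/-! ### The explicit flow -/

/-- The solution `w` of `w'' = -c² w` with `w = 1` and `w' = (a + i r) / 2` at time zero. -/
def oscillator (c t a r : ℝ) : ℂ :=
  Real.cos (c * t) + Real.sin (c * t) / (2 * c) * (a + r * Complex.I)

/-- The time derivative of `oscillator`. -/
def oscillatorVel (c t a r : ℝ) : ℂ :=
  -c * Real.sin (c * t) + Real.cos (c * t) / 2 * (a + r * Complex.I)

/-- The squared modulus of `oscillator`: the Jacobian of the flow of a solution, at a point where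
the initial values of `u_x` and `ρ` are `a` and `r`. -/
def jac (c t a r : ℝ) : ℝ :=
  Real.cos (c * t) ^ 2 + Real.sin (c * t) * Real.cos (c * t) / c * a +
    Real.sin (c * t) ^ 2 / (4 * c ^ 2) * (a ^ 2 + r ^ 2)

/-- The time derivative of `jac`. -/
def jacVel (c t a r : ℝ) : ℝ :=
  -2 * c * Real.sin (c * t) * Real.cos (c * t) + (Real.cos (c * t) ^ 2 - Real.sin (c * t) ^ 2) * a +
    Real.sin (c * t) * Real.cos (c * t) / (2 * c) * (a ^ 2 + r ^ 2)

/-- The flow of a solution, at a point `x` where `u` is initially `v` and `∫₀ˣ (u_x² + ρ²)` is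
initially `e`. -/
def flow (c t x v e : ℝ) : ℝ :=
  Real.cos (c * t) ^ 2 * x + Real.sin (c * t) * Real.cos (c * t) / c * v +
    Real.sin (c * t) ^ 2 / (4 * c ^ 2) * e

/-- The time derivative of `flow`. -/
def flowVel (c t x v e : ℝ) : ℝ :=
  -2 * c * Real.sin (c * t) * Real.cos (c * t) * x +
    (Real.cos (c * t) ^ 2 - Real.sin (c * t) ^ 2) * v +
    Real.sin (c * t) * Real.cos (c * t) / (2 * c) * e

theorem hasDerivAt_sin_mul (c t : ℝ) :
    HasDerivAt (fun t => Real.sin (c * t)) (c * Real.cos (c * t)) t := by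
  have := ((hasDerivAt_id t).const_mul c).sin
  simpa [mul_comm] using this

theorem hasDerivAt_cos_mul (c t : ℝ) :
    HasDerivAt (fun t => Real.cos (c * t)) (-c * Real.sin (c * t)) t := by
  have := ((hasDerivAt_id t).const_mul c).cos
  simpa [mul_comm] using this

theorem hasDerivAt_flow {c : ℝ} (hc : c ≠ 0) (t x v e : ℝ) :
    HasDerivAt (fun t => flow c t x v e) (flowVel c t x v e) t := by
  have hs := hasDerivAt_sin_mul c t
  have hk := hasDerivAt_cos_mul c t
  refine ((((hk.pow 2).mul_const x).add (((hs.mul hk).div_const c).mul_const v)).add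
    (((hs.pow 2).div_const (4 * c ^ 2)).mul_const e)).congr_deriv ?_
  unfold flowVel
  simp only [Nat.cast_ofNat]
  field_simp
  ring

theorem hasDerivAt_oscillator {c : ℝ} (hc : c ≠ 0) (t a r : ℝ) :
    HasDerivAt (fun t => oscillator c t a r) (oscillatorVel c t a r) t := by
  have hs := (hasDerivAt_sin_mul c t).ofReal_comp
  have hk := (hasDerivAt_cos_mul c t).ofReal_comp
  refine (hk.add ((hs.div_const (2 * c : ℂ)).mul_const (a + r * Complex.I))).congr_deriv ?_
  unfold oscillatorVel
  have : (c : ℂ) ≠ 0 := by exact_mod_cast hc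
  push_cast
  field_simp

theorem hasDerivAt_oscillatorVel {c : ℝ} (hc : c ≠ 0) (t a r : ℝ) :
    HasDerivAt (fun t => oscillatorVel c t a r) (-c ^ 2 * oscillator c t a r) t := by
  have hs := (hasDerivAt_sin_mul c t).ofReal_comp
  have hk := (hasDerivAt_cos_mul c t).ofReal_comp
  refine ((hs.const_mul (-c : ℂ)).add
    ((hk.div_const (2 : ℂ)).mul_const (a + r * Complex.I))).congr_deriv ?_
  unfold oscillator
  have : (c : ℂ) ≠ 0 := by exact_mod_cast hc
  push_cast
  field_simp
  ring

theorem jac_eq_normSq {c : ℝ} (hc : c ≠ 0) (t a r : ℝ) :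
    jac c t a r = Complex.normSq (oscillator c t a r) := by
  have e : oscillator c t a r = ((Real.cos (c * t) + Real.sin (c * t) / (2 * c) * a : ℝ) : ℂ) +
      ((Real.sin (c * t) / (2 * c) * r : ℝ) : ℂ) * Complex.I := by
    unfold oscillator; push_cast; ring
  rw [e, Complex.normSq_add_mul_I]
  unfold jac
  field_simp
  ring

/-- `conj w · 2 w'` is the derivative of `|w|²` plus `i` times the Wronskian of `w` and its
conjugate, which is conserved. -/
theorem conj_oscillator_mul {c : ℝ} (hc : c ≠ 0) (t a r : ℝ) :
    (starRingEnd ℂ) (oscillator c t a r) * (2 * oscillatorVel c t a r) =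
      jacVel c t a r + r * Complex.I := by
  have hc' : (c : ℂ) ≠ 0 := by exact_mod_cast hc
  have hsc := Real.sin_sq_add_cos_sq (c * t)
  unfold oscillator oscillatorVel jacVel
  generalize Real.sin (c * t) = S at *
  generalize Real.cos (c * t) = K at *
  have hsc' : (S : ℂ) ^ 2 + (K : ℂ) ^ 2 = 1 := by exact_mod_cast hsc
  simp only [map_add, map_mul, map_div₀, Complex.conj_ofReal, Complex.conj_I, map_ofNat]
  push_cast
  field_simp
  linear_combination (2 * c * r * Complex.I) * hsc' - (K * S * r ^ 2) * Complex.I_sq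

/-- `w` and `w'` do not vanish simultaneously. -/
theorem oscillator_ne_zero_of_vel {c : ℝ} (hc : c ≠ 0) {t a r : ℝ}
    (h : oscillator c t a r = 0 → oscillatorVel c t a r = 0) : oscillator c t a r ≠ 0 := by
  intro h0
  have h1 := h h0
  have hc' : (c : ℂ) ≠ 0 := by exact_mod_cast hc
  have hsc : (Real.sin (c * t) : ℂ) ^ 2 + (Real.cos (c * t) : ℂ) ^ 2 = 1 := by
    exact_mod_cast Real.sin_sq_add_cos_sq (c * t)
  have : (Real.cos (c * t) : ℂ) * oscillator c t a r -
      Real.sin (c * t) / c * oscillatorVel c t a r = 1 := by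
    unfold oscillator oscillatorVel
    generalize (Real.sin (c * t) : ℂ) = S at *
    generalize (Real.cos (c * t) : ℂ) = K at *
    field_simp
    linear_combination 2 * c * hsc
  rw [h0, h1] at this
  simp at this

/-! ### Solutions in Lagrangian coordinates -/

/-- The initial energy `∫₀ˣ (u_x² + ρ²)` in the interval `[0, x]`. -/
def cumEnergy (a r : ℝ → ℝ) (x : ℝ) : ℝ := ∫ y in (0 : ℝ)..x, (a y ^ 2 + r y ^ 2)

theorem hasDerivAt_cumEnergy {a r : ℝ → ℝ} (ha : Continuous a) (hr : Continuous r) (x : ℝ) :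
    HasDerivAt (cumEnergy a r) (a x ^ 2 + r x ^ 2) x :=
  (((ha.pow 2).add (hr.pow 2)).integral_hasStrictDerivAt 0 x).hasDerivAt

theorem cumEnergy_zero (a r : ℝ → ℝ) : cumEnergy a r 0 = 0 := by simp [cumEnergy]

theorem hasDerivAt_flow_space (c t : ℝ) {v a r : ℝ → ℝ} (hv : ∀ x, HasDerivAt v (a x) x)
    (ha : Continuous a) (hr : Continuous r) (x : ℝ) :
    HasDerivAt (fun x => flow c t x (v x) (cumEnergy a r x)) (jac c t (a x) (r x)) x := by
  refine ((((hasDerivAt_id x).const_mul _).add ((hv x).const_mul _)).add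
    ((hasDerivAt_cumEnergy ha hr x).const_mul _)).congr_deriv ?_
  unfold jac
  ring

theorem hasDerivAt_flowVel_space (c t : ℝ) {v a r : ℝ → ℝ} (hv : ∀ x, HasDerivAt v (a x) x)
    (ha : Continuous a) (hr : Continuous r) (x : ℝ) :
    HasDerivAt (fun x => flowVel c t x (v x) (cumEnergy a r x)) (jacVel c t (a x) (r x)) x := by
  refine ((((hasDerivAt_id x).const_mul _).add ((hv x).const_mul _)).add
    ((hasDerivAt_cumEnergy ha hr x).const_mul _)).congr_deriv ?_
  unfold jacVel
  ring

theorem sq_integral_le {f : ℝ → ℝ} (hf : Continuous f) :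
    (∫ x in (0 : ℝ)..1, f x) ^ 2 ≤ ∫ x in (0 : ℝ)..1, f x ^ 2 := by
  set J := ∫ x in (0 : ℝ)..1, f x with hJ
  have h1 : 0 ≤ ∫ x in (0 : ℝ)..1, (f x - J) ^ 2 :=
    intervalIntegral.integral_nonneg zero_le_one fun x _ => sq_nonneg _
  have h2 : ∫ x in (0 : ℝ)..1, (f x - J) ^ 2 = (∫ x in (0 : ℝ)..1, f x ^ 2) - J ^ 2 := by
    have e : ∀ x, (f x - J) ^ 2 = (f x ^ 2 - 2 * J * f x) + J ^ 2 := fun x => by ring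
    simp only [e]
    have i1 : IntervalIntegrable (fun x => f x ^ 2) volume 0 1 := (hf.pow 2).intervalIntegrable _ _
    have i2 : IntervalIntegrable (fun x => 2 * J * f x) volume 0 1 :=
      (continuous_const.mul hf).intervalIntegrable _ _
    rw [intervalIntegral.integral_add (i1.sub i2) intervalIntegrable_const,
      intervalIntegral.integral_sub i1 i2, intervalIntegral.integral_const_mul, ← hJ]
    simp only [intervalIntegral.integral_const, smul_eq_mul]
    ring
  linarith

/-- A form of Gronwall's lemma for functions of time and space: the integral of `‖e‖²` over space
satisfies a linear differential inequality. -/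
theorem eq_zero_of_norm_deriv_le {b K L : ℝ} {e e' : ℝ → ℝ → ℂ} (h0b : 0 ≤ b)
    (ce : ContinuousOn (fun p : ℝ × ℝ => e p.1 p.2) (Icc 0 b ×ˢ univ))
    (ce' : ContinuousOn (fun p : ℝ × ℝ => e' p.1 p.2) (Icc 0 b ×ˢ univ))
    (dE : ∀ τ ∈ Ioo 0 b, ∀ y, HasDerivAt (fun τ => e τ y) (e' τ y) τ) (hL : 0 ≤ L)
    (hle : ∀ τ ∈ Ioo 0 b, ∀ y ∈ Icc (0 : ℝ) 1,
      ‖e' τ y‖ ≤ K * ‖e τ y‖ + L * ∫ x in (0 : ℝ)..1, ‖e τ x‖)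
    (h0 : ∀ y, e 0 y = 0) {y : ℝ} (hy : y ∈ Icc (0 : ℝ) 1) : e b y = 0 := by
  have sl : ∀ {τ}, τ ∈ Icc 0 b → Continuous (e τ) := fun hτ => continuous_slice ce hτ
  set F : ℝ → ℝ → ℝ := fun τ y => ‖e τ y‖ ^ 2 with hF
  set F' : ℝ → ℝ → ℝ := fun τ y => 2 * inner ℝ (e τ y) (e' τ y) with hF'
  have cF : ContinuousOn (fun p : ℝ × ℝ => F p.1 p.2) (Icc 0 b ×ˢ univ) := ce.norm.pow 2
  have cF' : ContinuousOn (fun p : ℝ × ℝ => F' p.1 p.2) (Icc 0 b ×ˢ univ) :=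
    continuousOn_const.mul (ContinuousOn.inner (𝕜 := ℝ) ce ce')
  have dF : ∀ τ ∈ Ioo 0 b, ∀ y, HasDerivAt (fun τ => F τ y) (F' τ y) τ := fun τ hτ y =>
    (dE τ hτ y).norm_sq
  have hle' : ∀ τ ∈ Ioo 0 b, ∫ y in (0 : ℝ)..1, F' τ y ≤
      (2 * K + 2 * L) * ∫ y in (0 : ℝ)..1, F τ y := by
    intro τ hτ
    have hτ' := Ioo_subset_Icc_self hτ
    have cn := (sl hτ').norm
    set J := ∫ x in (0 : ℝ)..1, ‖e τ x‖ with hJ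
    have hpt : ∀ y ∈ Icc (0 : ℝ) 1, F' τ y ≤ 2 * K * F τ y + 2 * L * J * ‖e τ y‖ := by
      intro y hy
      have i1 : inner ℝ (e τ y) (e' τ y) ≤ ‖e τ y‖ * ‖e' τ y‖ := real_inner_le_norm _ _
      have i3 := mul_le_mul_of_nonneg_left (hle τ hτ y hy) (norm_nonneg (e τ y))
      simp only [hF, hF']
      nlinarith
    have j1 : IntervalIntegrable (fun y => 2 * K * F τ y) volume 0 1 :=
      (continuous_const.mul (cn.pow 2)).intervalIntegrable _ _
    have j2 : IntervalIntegrable (fun y => 2 * L * J * ‖e τ y‖) volume 0 1 :=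
      (continuous_const.mul cn).intervalIntegrable _ _
    have h1 : ∫ y in (0 : ℝ)..1, F' τ y ≤
        ∫ y in (0 : ℝ)..1, (2 * K * F τ y + 2 * L * J * ‖e τ y‖) :=
      intervalIntegral.integral_mono_on zero_le_one
        ((continuous_slice cF' hτ').intervalIntegrable _ _) (j1.add j2) hpt
    rw [intervalIntegral.integral_add j1 j2, intervalIntegral.integral_const_mul (2 * K),
      intervalIntegral.integral_const_mul (2 * L * J), ← hJ] at h1
    have h2 : J ^ 2 ≤ ∫ y in (0 : ℝ)..1, F τ y := sq_integral_le cn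
    nlinarith [mul_le_mul_of_nonneg_left h2 hL]
  have hEb : ∫ y in (0 : ℝ)..1, F b y = 0 :=
    eq_zero_of_deriv_le (E := fun τ => ∫ y in (0 : ℝ)..1, F τ y)
      (continuousOn_integral h0b cF) (fun τ hτ => hasDerivAt_integral cF cF' dF hτ) hle'
      (by simp [hF, h0])
      (fun τ => intervalIntegral.integral_nonneg zero_le_one fun x _ => sq_nonneg _)
      (right_mem_Icc.2 h0b)
  have := eq_zero_of_integral_eq_zero
    (continuous_slice cF (right_mem_Icc.2 h0b)) (fun x => sq_nonneg _) hEb hy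
  simpa [hF] using this

namespace ClassicalSolution

variable {T : EReal} {u ux uxx utx ρ ρx ρt : ℝ → ℝ → ℝ}

set_option maxHeartbeats 1000000 in
/-- Along the explicit flow `φ`, the solution satisfies `u(φ) = φ_t` and
`w · (u_x + i ρ)(φ) = 2 w'`. The two defects `d = u(φ) - φ_t` and `e = w (u_x + i ρ)(φ) - 2 w'`
satisfy `d_x = Re (conj w · e)` and a linear equation
`e_t = -½ (u_x + i ρ)(φ) e - w (u_x + i ρ)_x(φ) d`, so they vanish by Gronwall's lemma. -/
theorem defect_eq_zero (h : ClassicalSolution (timeInterval T) u ux uxx utx ρ ρx ρt) {c : ℝ}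
    (hc : c ≠ 0) (hQ : ∫ x in (0 : ℝ)..1, (ux 0 x ^ 2 + ρ 0 x ^ 2) = 4 * c ^ 2) {t : ℝ}
    (ht : t ∈ timeInterval T) {x : ℝ} (hx : x ∈ Icc (0 : ℝ) 1) :
    u t (flow c t x (u 0 x) (cumEnergy (ux 0) (ρ 0) x)) =
        flowVel c t x (u 0 x) (cumEnergy (ux 0) (ρ 0) x) ∧
      oscillator c t (ux 0 x) (ρ 0 x) *
          (ux t (flow c t x (u 0 x) (cumEnergy (ux 0) (ρ 0) x)) +
            ρ t (flow c t x (u 0 x) (cumEnergy (ux 0) (ρ 0) x)) * Complex.I) =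
        2 * oscillatorVel c t (ux 0 x) (ρ 0 x) := by
  obtain ⟨b, hb⟩ : ∃ b, b = t := ⟨t, rfl⟩
  have hbI : b ∈ timeInterval T := hb ▸ ht
  have h0b : 0 ≤ b := hbI.1
  have h0I : (0 : ℝ) ∈ timeInterval T := Icc_subset_timeInterval hbI ⟨le_rfl, h0b⟩
  have hIcc := Icc_subset_timeInterval hbI
  have cA := continuous_slice h.cont_ux h0I
  have cr := continuous_slice h.cont_ρ h0I
  have cu := continuous_slice h.cont_u h0I
  have dβ := hasDerivAt_cumEnergy cA cr
  have cβ : Continuous (cumEnergy (ux 0) (ρ 0)) :=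
    continuous_iff_continuousAt.2 fun x => (dβ x).continuousAt
  set β := cumEnergy (ux 0) (ρ 0) with hβ
  set φ : ℝ → ℝ → ℝ := fun t x => flow c t x (u 0 x) (β x) with hφ
  set φt : ℝ → ℝ → ℝ := fun t x => flowVel c t x (u 0 x) (β x) with hφt
  set w : ℝ → ℝ → ℂ := fun t x => oscillator c t (ux 0 x) (ρ 0 x) with hw
  set wv : ℝ → ℝ → ℂ := fun t x => oscillatorVel c t (ux 0 x) (ρ 0 x) with hwv
  set e : ℝ → ℝ → ℂ := fun t x => w t x * (ux t (φ t x) + ρ t (φ t x) * Complex.I) - 2 * wv t x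
    with he
  set d : ℝ → ℝ → ℝ := fun t x => u t (φ t x) - φt t x with hd
  set e' : ℝ → ℝ → ℂ := fun t x => -((ux t (φ t x) + ρ t (φ t x) * Complex.I) / 2) * e t x -
    w t x * (uxx t (φ t x) + ρx t (φ t x) * Complex.I) * d t x with he'
  -- All coefficients are jointly continuous, hence bounded over one period up to the time `b`.
  have cφ : Continuous fun p : ℝ × ℝ => φ p.1 p.2 := by
    simp only [hφ, flow]; fun_prop
  have cφt : Continuous fun p : ℝ × ℝ => φt p.1 p.2 := by
    simp only [hφt, flowVel]; fun_prop
  have cw : Continuous fun p : ℝ × ℝ => w p.1 p.2 := by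
    simp only [hw, oscillator]; fun_prop
  have cwv : Continuous fun p : ℝ × ℝ => wv p.1 p.2 := by
    simp only [hwv, oscillatorVel]; fun_prop
  have ccomp : ∀ v : ℝ → ℝ → ℝ,
      ContinuousOn (fun p : ℝ × ℝ => v p.1 p.2) (timeInterval T ×ˢ univ) →
      ContinuousOn (fun p : ℝ × ℝ => v p.1 (φ p.1 p.2)) (Icc 0 b ×ˢ univ) := fun v hv =>
    hv.comp (f := fun p : ℝ × ℝ => (p.1, φ p.1 p.2)) (by fun_prop)
      fun p hp => ⟨hIcc hp.1, mem_univ _⟩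
  have ccompC : ∀ v : ℝ → ℝ → ℝ,
      ContinuousOn (fun p : ℝ × ℝ => v p.1 p.2) (timeInterval T ×ˢ univ) →
      ContinuousOn (fun p : ℝ × ℝ => (v p.1 (φ p.1 p.2) : ℂ)) (Icc 0 b ×ˢ univ) := fun v hv =>
    Complex.continuous_ofReal.comp_continuousOn (ccomp v hv)
  have c1 := ccompC ux h.cont_ux
  have c2 := ccompC ρ h.cont_ρ
  have c3 := ccompC uxx h.cont_uxx
  have c4 := ccompC ρx h.cont_ρx
  have c5 := ccomp u h.cont_u
  have ce : ContinuousOn (fun p : ℝ × ℝ => e p.1 p.2) (Icc 0 b ×ˢ univ) := by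
    simp only [he]
    exact (cw.continuousOn.mul (c1.add (c2.mul continuousOn_const))).sub
      (continuousOn_const.mul cwv.continuousOn)
  have cd : ContinuousOn (fun p : ℝ × ℝ => d p.1 p.2) (Icc 0 b ×ˢ univ) := by
    simp only [hd]
    exact c5.sub cφt.continuousOn
  have cz : ContinuousOn (fun p : ℝ × ℝ =>
      (ux p.1 (φ p.1 p.2) + ρ p.1 (φ p.1 p.2) * Complex.I : ℂ)) (Icc 0 b ×ˢ univ) :=
    c1.add (c2.mul continuousOn_const)
  have czx : ContinuousOn (fun p : ℝ × ℝ =>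
      (uxx p.1 (φ p.1 p.2) + ρx p.1 (φ p.1 p.2) * Complex.I : ℂ)) (Icc 0 b ×ˢ univ) :=
    c3.add (c4.mul continuousOn_const)
  have ce' : ContinuousOn (fun p : ℝ × ℝ => e' p.1 p.2) (Icc 0 b ×ˢ univ) := by
    simp only [he']
    exact ((cz.div_const 2).neg.mul ce).sub ((cw.continuousOn.mul czx).mul
      (Complex.continuous_ofReal.comp_continuousOn cd))
  have sl : ∀ {v : ℝ → ℝ → ℂ}, ContinuousOn (fun p : ℝ × ℝ => v p.1 p.2) (Icc 0 b ×ˢ univ) →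
      ∀ {τ}, τ ∈ Icc 0 b → Continuous (v τ) := fun {_} hv {_} hτ =>
    continuous_slice hv hτ
  -- `e` satisfies its linear equation by the two Hunter-Saxton equations at the point `φ`; the term
  -- `∫ (u_x² + ρ²)` is `4 c²`, which cancels against `w'' = -c² w`.
  have dE : ∀ τ ∈ Ioo 0 b, ∀ y, HasDerivAt (fun τ => e τ y) (e' τ y) τ := by
    intro τ hτ y
    have hτI := hIcc (Ioo_subset_Icc_self hτ)
    have dφ := hasDerivAt_flow hc τ y (u 0 y) (β y)
    have d1 := (h.hasDerivAt_comp_ux hbI hτ dφ).ofReal_comp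
    have d2 := (h.hasDerivAt_comp_ρ hbI hτ dφ).ofReal_comp
    have d3 := hasDerivAt_oscillator hc τ (ux 0 y) (ρ 0 y)
    have d4 := hasDerivAt_oscillatorVel hc τ (ux 0 y) (ρ 0 y)
    refine ((d3.mul (d1.add (d2.mul_const Complex.I))).sub (d4.const_mul 2)).congr_deriv ?_
    have e1 := h.eq_u τ hτI (φ τ y)
    rw [h.energy_eq hτI, hQ] at e1
    have e2 := h.eq_ρ τ hτI (φ τ y)
    have e1c : (utx τ (φ τ y) : ℂ) + u τ (φ τ y) * uxx τ (φ τ y) =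
      -(1 / 2) * (ux τ (φ τ y) : ℂ) ^ 2 + 1 / 2 * (ρ τ (φ τ y) : ℂ) ^ 2 -
        1 / 2 * (4 * (c : ℂ) ^ 2) := by
      have := congrArg (fun r : ℝ => (r : ℂ)) e1
      push_cast at this
      exact this
    have e2c : (ρt τ (φ τ y) : ℂ) + u τ (φ τ y) * ρx τ (φ τ y) =
      -(ρ τ (φ τ y) * ux τ (φ τ y)) := by exact_mod_cast e2
    simp only [he', he, hd, hw, hwv, hφ, hφt, Pi.add_apply] at e1c e2c ⊢
    push_cast
    linear_combination oscillator c τ (ux 0 y) (ρ 0 y) * e1c +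
      oscillator c τ (ux 0 y) (ρ 0 y) * Complex.I * e2c +
      (1 / 2) * oscillator c τ (ux 0 y) (ρ 0 y) *
        (ρ τ (flow c τ y (u 0 y) (β y)) : ℂ) ^ 2 * Complex.I_sq
  -- `conj w · e` is `(u_x + i ρ)(φ) |w|² - 2 conj w · w'`, whose real part is `(u(φ) - φ_t)_x`.
  have dd : ∀ τ ∈ Icc 0 b, ∀ y,
      HasDerivAt (d τ) ((starRingEnd ℂ (w τ y) * e τ y).re) y := by
    intro τ hτ y
    have hτI := hIcc hτ
    have dφ := hasDerivAt_flow_space c τ (h.hasDerivAt_u 0 h0I) cA cr y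
    have dφt := hasDerivAt_flowVel_space c τ (h.hasDerivAt_u 0 h0I) cA cr y
    refine (((h.hasDerivAt_u τ hτI _).comp y dφ).sub dφt).congr_deriv ?_
    have k1 : starRingEnd ℂ (w τ y) * w τ y = (jac c τ (ux 0 y) (ρ 0 y) : ℂ) := by
      rw [jac_eq_normSq hc, Complex.normSq_eq_conj_mul_self]
    have k2 := conj_oscillator_mul hc τ (ux 0 y) (ρ 0 y)
    have k3 : starRingEnd ℂ (w τ y) * e τ y =
        ((ux τ (φ τ y) * jac c τ (ux 0 y) (ρ 0 y) - jacVel c τ (ux 0 y) (ρ 0 y) : ℝ) : ℂ) +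
        ((ρ τ (φ τ y) * jac c τ (ux 0 y) (ρ 0 y) - ρ 0 y : ℝ) : ℂ) * Complex.I := by
      simp only [he, mul_sub, ← mul_assoc, k1]
      simp only [hw, hwv, mul_assoc] at k2 ⊢
      rw [k2]
      push_cast
      ring
    rw [k3]
    simp [hφ, hβ]
  have d0 : ∀ τ ∈ Icc 0 b, d τ 0 = 0 := by
    intro τ hτ
    have := h.u_zero τ (hIcc hτ)
    simp [hd, hφ, hφt, flow, flowVel, h.u_zero 0 h0I, hβ, cumEnergy_zero, this]
  -- Since `d` vanishes at the base point, it is bounded by the integral of `|e|`.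
  have hcpt := isCompact_Icc (a := (0 : ℝ)) (b := b) |>.prod (isCompact_Icc (a := (0 : ℝ)) (b := 1))
  have hsub : Icc 0 b ×ˢ Icc (0 : ℝ) 1 ⊆ Icc 0 b ×ˢ univ := prod_mono_right (subset_univ _)
  obtain ⟨K1, hK1⟩ := hcpt.exists_bound_of_continuousOn cw.continuousOn
  obtain ⟨K2, hK2⟩ := hcpt.exists_bound_of_continuousOn (cz.mono hsub)
  obtain ⟨K3, hK3⟩ := hcpt.exists_bound_of_continuousOn (czx.mono hsub)
  have n1 : 0 ≤ K1 := (norm_nonneg _).trans (hK1 (0, 0) ⟨⟨le_rfl, h0b⟩, ⟨le_rfl, zero_le_one⟩⟩)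
  have n2 : 0 ≤ K2 := (norm_nonneg _).trans (hK2 (0, 0) ⟨⟨le_rfl, h0b⟩, ⟨le_rfl, zero_le_one⟩⟩)
  have n3 : 0 ≤ K3 := (norm_nonneg _).trans (hK3 (0, 0) ⟨⟨le_rfl, h0b⟩, ⟨le_rfl, zero_le_one⟩⟩)
  have slw : ∀ τ, Continuous (w τ) := fun τ => cw.comp (Continuous.prodMk_right τ)
  have hdle : ∀ τ ∈ Icc 0 b, ∀ y ∈ Icc (0 : ℝ) 1, |d τ y| ≤ K1 * ∫ x in (0 : ℝ)..1, ‖e τ x‖ := by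
    intro τ hτ y hy
    have cI : Continuous fun y => (starRingEnd ℂ (w τ y) * e τ y).re :=
      Complex.continuous_re.comp ((Complex.continuous_conj.comp (slw τ)).mul (sl ce hτ))
    have h1 := intervalIntegral.integral_eq_sub_of_hasDerivAt (a := 0) (b := y)
      (fun y _ => dd τ hτ y) (cI.intervalIntegrable _ _)
    rw [d0 τ hτ, sub_zero] at h1
    rw [← h1, ← intervalIntegral.integral_const_mul]
    have h2 := intervalIntegral.norm_integral_le_of_norm_le (μ := volume)
      (a := (0 : ℝ)) (b := y) hy.1
      (f := fun y => (starRingEnd ℂ (w τ y) * e τ y).re) (g := fun x => K1 * ‖e τ x‖)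
      (ae_of_all _ fun x hx => by
        refine (Complex.abs_re_le_norm _).trans ?_
        rw [norm_mul, RCLike.norm_conj]
        gcongr
        exact hK1 (τ, x) ⟨hτ, hx.1.le, hx.2.trans hy.2⟩)
      ((continuous_const.mul (sl ce hτ).norm).intervalIntegrable _ _)
    refine h2.trans ?_
    exact intervalIntegral.integral_mono_interval (μ := volume) le_rfl hy.1 hy.2
      (ae_of_all _ fun y => by positivity)
      ((continuous_const.mul (sl ce hτ).norm).intervalIntegrable _ _)
  have heb : ∀ y ∈ Icc (0 : ℝ) 1, e b y = 0 := by
    intro y₀ hy₀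
    refine eq_zero_of_norm_deriv_le h0b ce ce' dE (K := K2 / 2) (L := K1 * K3 * K1) (by positivity)
      (fun τ hτ y hy => ?_) (fun y => ?_) hy₀
    · have hτ' := Ioo_subset_Icc_self hτ
      refine (norm_sub_le _ _).trans ?_
      rw [norm_mul, norm_neg, norm_div, norm_mul, norm_mul, Complex.norm_real, Complex.norm_ofNat,
        mul_assoc (K1 * K3)]
      gcongr
      · exact hK2 (τ, y) ⟨hτ', hy⟩
      · exact hK1 (τ, y) ⟨hτ', hy⟩
      · exact hK3 (τ, y) ⟨hτ', hy⟩
      · exact hdle τ hτ' y hy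
    · simp [he, hw, hwv, hφ, flow, oscillator, oscillatorVel]
  have hJb : ∫ x in (0 : ℝ)..1, ‖e b x‖ = 0 := by
    rw [intervalIntegral.integral_congr (g := fun _ => (0 : ℝ)) fun y hy => by
      rw [uIcc_of_le zero_le_one] at hy
      simp [heb y hy]]
    simp
  have hdb := hdle b (right_mem_Icc.2 h0b) x hx
  rw [hJb, mul_zero] at hdb
  subst hb
  exact ⟨sub_eq_zero.1 (abs_nonpos_iff.1 hdb), sub_eq_zero.1 (heb x hx)⟩

end ClassicalSolution

/-- Initial values `v`, `a = v'` and `r` of `u`, `u_x` and `ρ`, of speed `c > 0`. -/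
structure InitialData (c : ℝ) (v a r : ℝ → ℝ) : Prop where
  pos : 0 < c
  hasDerivAt : ∀ x, HasDerivAt v (a x) x
  cont_a : Continuous a
  cont_r : Continuous r
  periodic_v : Function.Periodic v 1
  periodic_a : Function.Periodic a 1
  periodic_r : Function.Periodic r 1
  zero : v 0 = 0
  energy : ∫ x in (0 : ℝ)..1, (a x ^ 2 + r x ^ 2) = 4 * c ^ 2

/-- Two functions of period one which agree on `[0, 1]` are equal. -/
theorem eq_of_periodic_of_eqOn {f g : ℝ → ℝ} (hf : Function.Periodic f 1)
    (hg : Function.Periodic g 1) (h : ∀ x ∈ Icc (0 : ℝ) 1, f x = g x) : f = g := by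
  ext x
  have e1 : f (x - ⌊x⌋) = f x := by simpa using hf.sub_zsmul_eq ⌊x⌋ (x := x)
  have e2 : g (x - ⌊x⌋) = g x := by simpa using hg.sub_zsmul_eq ⌊x⌋ (x := x)
  rw [← e1, ← e2]
  exact h _ ⟨by linarith [Int.floor_le x], by linarith [Int.lt_floor_add_one x]⟩

namespace InitialData

variable {c : ℝ} {v a r : ℝ → ℝ}

theorem cumEnergy_add_one (h : InitialData c v a r) (x : ℝ) :
    cumEnergy a r (x + 1) = cumEnergy a r x + 4 * c ^ 2 := by
  have hc : Continuous fun y => a y ^ 2 + r y ^ 2 := (h.cont_a.pow 2).add (h.cont_r.pow 2)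
  have hp : Function.Periodic (fun y => a y ^ 2 + r y ^ 2) 1 := fun y => by
    simp [h.periodic_a y, h.periodic_r y]
  have h1 := hp.intervalIntegral_add_eq x 0
  rw [zero_add, h.energy] at h1
  unfold cumEnergy
  rw [← h1, intervalIntegral.integral_add_adjacent_intervals (hc.intervalIntegrable _ _)
    (hc.intervalIntegrable _ _)]

theorem flow_add_one (h : InitialData c v a r) (t x : ℝ) :
    flow c t (x + 1) (v (x + 1)) (cumEnergy a r (x + 1)) =
      flow c t x (v x) (cumEnergy a r x) + 1 := by
  rw [h.cumEnergy_add_one, h.periodic_v x]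
  have := Real.sin_sq_add_cos_sq (c * t)
  have hc := h.pos.ne'
  unfold flow
  field_simp
  linear_combination 4 * c ^ 2 * this

theorem flow_zero (h : InitialData c v a r) (t : ℝ) : flow c t 0 (v 0) (cumEnergy a r 0) = 0 := by
  simp [flow, h.zero, cumEnergy_zero]

theorem hasDerivAt_flow_space (h : InitialData c v a r) (t x : ℝ) :
    HasDerivAt (fun x => flow c t x (v x) (cumEnergy a r x)) (jac c t (a x) (r x)) x :=
  HunterSaxton.hasDerivAt_flow_space c t h.hasDerivAt h.cont_a h.cont_r x

theorem continuous_flow (h : InitialData c v a r) (t : ℝ) :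
    Continuous fun x => flow c t x (v x) (cumEnergy a r x) :=
  continuous_iff_continuousAt.2 fun x => (h.hasDerivAt_flow_space t x).continuousAt

theorem exists_flow_eq (h : InitialData c v a r) (t : ℝ) {y : ℝ} (hy : y ∈ Icc (0 : ℝ) 1) :
    ∃ x ∈ Icc (0 : ℝ) 1, flow c t x (v x) (cumEnergy a r x) = y := by
  have h1 := intermediate_value_Icc zero_le_one (h.continuous_flow t).continuousOn
  have h2 := h.flow_add_one t 0
  rw [h.flow_zero, zero_add] at h2
  rw [h.flow_zero, h2] at h1
  exact h1 hy

end InitialData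

theorem sin_add_period {c : ℝ} (hc : c ≠ 0) (t : ℝ) :
    Real.sin (c * (t + Real.pi / c)) = -Real.sin (c * t) := by
  rw [mul_add, mul_div_cancel₀ _ hc, Real.sin_add_pi]

theorem cos_add_period {c : ℝ} (hc : c ≠ 0) (t : ℝ) :
    Real.cos (c * (t + Real.pi / c)) = -Real.cos (c * t) := by
  rw [mul_add, mul_div_cancel₀ _ hc, Real.cos_add_pi]

theorem flow_add_period {c : ℝ} (hc : c ≠ 0) (t x v e : ℝ) :
    flow c (t + Real.pi / c) x v e = flow c t x v e := by
  unfold flow; rw [sin_add_period hc, cos_add_period hc]; ring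

theorem flowVel_add_period {c : ℝ} (hc : c ≠ 0) (t x v e : ℝ) :
    flowVel c (t + Real.pi / c) x v e = flowVel c t x v e := by
  unfold flowVel; rw [sin_add_period hc, cos_add_period hc]; ring

theorem jac_add_period {c : ℝ} (hc : c ≠ 0) (t a r : ℝ) :
    jac c (t + Real.pi / c) a r = jac c t a r := by
  unfold jac; rw [sin_add_period hc, cos_add_period hc]; ring

namespace ClassicalSolution

variable {T : EReal} {u ux uxx utx ρ ρx ρt : ℝ → ℝ → ℝ} {c : ℝ}

theorem periodic_ux (h : ClassicalSolution (timeInterval T) u ux uxx utx ρ ρx ρt) {t : ℝ}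
    (ht : t ∈ timeInterval T) : Function.Periodic (ux t) 1 :=
  periodic_of_hasDerivAt (h.hasDerivAt_u t ht) (h.periodic_u t ht)

theorem initialData (h : ClassicalSolution (timeInterval T) u ux uxx utx ρ ρx ρt) (hT : 0 < T)
    (hc : 0 < c) (hQ : ∫ x in (0 : ℝ)..1, (ux 0 x ^ 2 + ρ 0 x ^ 2) = 4 * c ^ 2) :
    InitialData c (u 0) (ux 0) (ρ 0) :=
  have h0 : (0 : ℝ) ∈ timeInterval T := ⟨le_rfl, by simpa using hT⟩
  { pos := hc
    hasDerivAt := h.hasDerivAt_u 0 h0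
    cont_a := continuous_slice h.cont_ux h0
    cont_r := continuous_slice h.cont_ρ h0
    periodic_v := h.periodic_u 0 h0
    periodic_a := h.periodic_ux h0
    periodic_r := h.periodic_ρ 0 h0
    zero := h.u_zero 0 h0
    energy := hQ }

/-- A solution in Lagrangian coordinates. In particular the flow of a solution is a diffeomorphism
as long as the solution exists. -/
theorem lagrangian (h : ClassicalSolution (timeInterval T) u ux uxx utx ρ ρx ρt)
    (hc : 0 < c) (hQ : ∫ x in (0 : ℝ)..1, (ux 0 x ^ 2 + ρ 0 x ^ 2) = 4 * c ^ 2) {t : ℝ}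
    (ht : t ∈ timeInterval T) {x : ℝ} (hx : x ∈ Icc (0 : ℝ) 1) :
    0 < jac c t (ux 0 x) (ρ 0 x) ∧
      u t (flow c t x (u 0 x) (cumEnergy (ux 0) (ρ 0) x)) =
        flowVel c t x (u 0 x) (cumEnergy (ux 0) (ρ 0) x) ∧
      ux t (flow c t x (u 0 x) (cumEnergy (ux 0) (ρ 0) x)) =
        jacVel c t (ux 0 x) (ρ 0 x) / jac c t (ux 0 x) (ρ 0 x) ∧
      ρ t (flow c t x (u 0 x) (cumEnergy (ux 0) (ρ 0) x)) =
        ρ 0 x / jac c t (ux 0 x) (ρ 0 x) := by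
  obtain ⟨h1, h2⟩ := h.defect_eq_zero hc.ne' hQ ht hx
  have hw : oscillator c t (ux 0 x) (ρ 0 x) ≠ 0 := by
    refine oscillator_ne_zero_of_vel hc.ne' fun h0 => ?_
    rw [h0, zero_mul] at h2
    simpa using h2.symm
  have hj : 0 < jac c t (ux 0 x) (ρ 0 x) := by
    rw [jac_eq_normSq hc.ne']
    exact Complex.normSq_pos.2 hw
  have k1 : (starRingEnd ℂ) (oscillator c t (ux 0 x) (ρ 0 x)) * oscillator c t (ux 0 x) (ρ 0 x) =
      (jac c t (ux 0 x) (ρ 0 x) : ℂ) := by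
    rw [jac_eq_normSq hc.ne', Complex.normSq_eq_conj_mul_self]
  have k2 := conj_oscillator_mul hc.ne' t (ux 0 x) (ρ 0 x)
  rw [← h2, ← mul_assoc, k1] at k2
  have k3 := congrArg Complex.re k2
  have k4 := congrArg Complex.im k2
  simp at k3 k4
  refine ⟨hj, h1, ?_, ?_⟩
  · rw [eq_div_iff hj.ne', mul_comm]; exact k3
  · rw [eq_div_iff hj.ne', mul_comm]; exact k4

/-- Solutions are periodic in time with period `π / c`: the explicit flow, its velocity and its
Jacobian are quadratic in `sin (c t)` and `cos (c t)`. -/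
theorem eq_add_period (h : ClassicalSolution (timeInterval T) u ux uxx utx ρ ρx ρt) (hT : 0 < T)
    (hc : 0 < c) (hQ : ∫ x in (0 : ℝ)..1, (ux 0 x ^ 2 + ρ 0 x ^ 2) = 4 * c ^ 2) {t : ℝ}
    (ht : t ∈ timeInterval T) (ht' : t + Real.pi / c ∈ timeInterval T) :
    u (t + Real.pi / c) = u t ∧ ρ (t + Real.pi / c) = ρ t := by
  have hd := h.initialData hT hc hQ
  constructor
  · refine eq_of_periodic_of_eqOn (h.periodic_u _ ht') (h.periodic_u _ ht) fun y hy => ?_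
    obtain ⟨x, hx, rfl⟩ := hd.exists_flow_eq t hy
    have e1 := (h.lagrangian hc hQ ht hx).2.1
    have e2 := (h.lagrangian hc hQ ht' hx).2.1
    rw [flow_add_period hc.ne', flowVel_add_period hc.ne'] at e2
    rw [e1, e2]
  · refine eq_of_periodic_of_eqOn (h.periodic_ρ _ ht') (h.periodic_ρ _ ht) fun y hy => ?_
    obtain ⟨x, hx, rfl⟩ := hd.exists_flow_eq t hy
    have e1 := (h.lagrangian hc hQ ht hx).2.2.2
    have e2 := (h.lagrangian hc hQ ht' hx).2.2.2
    rw [flow_add_period hc.ne', jac_add_period hc.ne'] at e2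
    rw [e1, e2]

/-- Solutions of speed zero vanish. -/
theorem eq_zero (h : ClassicalSolution (timeInterval T) u ux uxx utx ρ ρx ρt)
    (hQ : ∫ x in (0 : ℝ)..1, (ux 0 x ^ 2 + ρ 0 x ^ 2) = 0) {t : ℝ}
    (ht : t ∈ timeInterval T) : u t = 0 ∧ ρ t = 0 := by
  have cux := continuous_slice h.cont_ux ht
  have cρ := continuous_slice h.cont_ρ ht
  have hz : ∀ x ∈ Icc (0 : ℝ) 1, ux t x ^ 2 + ρ t x ^ 2 = 0 := fun x hx =>
    eq_zero_of_integral_eq_zero (f := fun x => ux t x ^ 2 + ρ t x ^ 2)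
      ((cux.pow 2).add (cρ.pow 2)) (fun x => by positivity) ((h.energy_eq ht).trans hQ) hx
  have p0 : Function.Periodic (0 : ℝ → ℝ) 1 := fun x => rfl
  have hux : ux t = 0 := eq_of_periodic_of_eqOn (h.periodic_ux ht) p0 fun x hx => by
    have := hz x hx
    simpa using (by nlinarith [sq_nonneg (ux t x), sq_nonneg (ρ t x)] : ux t x ^ 2 = 0)
  have hρ : ρ t = 0 := eq_of_periodic_of_eqOn (h.periodic_ρ t ht) p0 fun x hx => by
    have := hz x hx
    simpa using (by nlinarith [sq_nonneg (ux t x), sq_nonneg (ρ t x)] : ρ t x ^ 2 = 0)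
  refine ⟨?_, hρ⟩
  ext x
  have := is_const_of_deriv_eq_zero (f := u t)
    (fun x => (h.hasDerivAt_u t ht x).differentiableAt)
    (fun x => by rw [(h.hasDerivAt_u t ht x).deriv, hux]; rfl) x 0
  rw [this, h.u_zero t ht]; rfl

end ClassicalSolution

/-- The zero solution exists for all times. -/
theorem isSolution_zero (s : ℝ) : IsSolution s ⊤ 0 0 := by
  have hn : ∀ σ, sobolevNormSq σ 0 = 0 := fun σ => by
    have e : cx 0 = fun _ => (0 : ℂ) := by ext; simp [cx]
    rw [sobolevNormSq_eq_cx, e, sobSq_const]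
    simp
  have hm : ∀ σ, MemSobolev σ 0 := fun σ =>
    ⟨continuous_const, fun _ => rfl, by rw [hn]; exact ENNReal.zero_lt_top⟩
  have hc : ∀ σ, ContinuousInSobolev σ ⊤ 0 := fun σ t ht => by
    simp [hn, tendsto_const_nhds]
  have hd : ∀ σ, HasDerivInSobolev σ ⊤ 0 0 := fun σ t ht => by
    simp [hn, tendsto_const_nhds]
  refine ⟨fun t ht => ⟨⟨hm s, rfl⟩, hm _⟩, hc s, hc _, 0, 0, fun t ht => ⟨⟨hm _, rfl⟩, hm _⟩,
    hc _, hc _, hd _, hd _, fun t ht x => ?_⟩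
  have e : (fun y : ℝ => deriv ((0 : ℝ → ℝ → ℝ) t) y ^ 2 + (0 : ℝ → ℝ → ℝ) t y ^ 2) =
      fun _ => 0 := by
    ext y; simp
  rw [e]
  simp [invA]

/-! ### The solution near the end of a period -/

theorem exists_abs_sin_mul_le {p q : ℝ → ℝ} (hp : Continuous p) (hp' : Function.Periodic p 1)
    (hq : Continuous q) (hq' : Function.Periodic q 1) :
    ∃ K, 0 ≤ K ∧
      ∀ θ x, |Real.sin θ * (Real.cos θ * p x + Real.sin θ * q x)| ≤ K * |Real.sin θ| := by
  have hb : ∀ f : ℝ → ℝ, Continuous f → Function.Periodic f 1 → ∃ B, ∀ x, |f x| ≤ B := by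
    intro f hf hf'
    obtain ⟨B, hB⟩ := PerCont.bounded (f := cx f)
      ⟨Complex.continuous_ofReal.comp hf, fun x => by simp [cx, hf' x]⟩
    exact ⟨B, fun x => by simpa [cx] using hB x⟩
  obtain ⟨B, hB⟩ := hb p hp hp'
  obtain ⟨C, hC⟩ := hb q hq hq'
  have hB0 := (abs_nonneg _).trans (hB 0)
  have hC0 := (abs_nonneg _).trans (hC 0)
  refine ⟨B + C, by positivity, fun θ x => ?_⟩
  rw [abs_mul, mul_comm]
  gcongr
  refine (abs_add_le _ _).trans ?_
  rw [abs_mul, abs_mul]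
  have h1 := mul_le_mul (Real.abs_cos_le_one θ) (hB x) (abs_nonneg _) zero_le_one
  have h2 := mul_le_mul (Real.abs_sin_le_one θ) (hC x) (abs_nonneg _) zero_le_one
  linarith

/-- The space derivative of the Jacobian. -/
def jacSpace (c t a r a' r' : ℝ) : ℝ :=
  Real.sin (c * t) * Real.cos (c * t) / c * a' +
    Real.sin (c * t) ^ 2 / (4 * c ^ 2) * (2 * a * a' + 2 * r * r')

namespace InitialData

variable {c : ℝ} {v a r a' r' : ℝ → ℝ}

/-- The inverse of the flow at the time `t` is `O(sin (c t))`-close to the identity, since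
`jac - 1`, `flow - id` and `jacSpace` all contain the factor `sin (c t)`. The
Jacobian is positive as soon as `sin (c t)` is small, so the flow is invertible whether or not the
solution exists up to the time `t`. -/
theorem exists_nearId (h : InitialData c v a r) (ha : ∀ x, HasDerivAt a (a' x) x)
    (hr : ∀ x, HasDerivAt r (r' x) x) (ca' : Continuous a') (cr' : Continuous r') :
    ∃ K, ∀ t, K * |Real.sin (c * t)| ≤ 1 / 2 → ∃ ψ : ℝ → ℝ,
      (∀ x, ψ (flow c t x (v x) (cumEnergy a r x)) = x) ∧
      NearId (K * |Real.sin (c * t)|) ψ (fun x => (jac c t (a x) (r x))⁻¹)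
        (fun x => -jacSpace c t (a x) (r x) (a' x) (r' x) / jac c t (a x) (r x) ^ 2) := by
  have hc := h.pos.ne'
  have pa' := periodic_of_hasDerivAt ha h.periodic_a
  have pr' := periodic_of_hasDerivAt hr h.periodic_r
  have cv : Continuous v := continuous_iff_continuousAt.2 fun x => (h.hasDerivAt x).continuousAt
  have ce : Continuous (cumEnergy a r) := continuous_iff_continuousAt.2 fun x =>
    (hasDerivAt_cumEnergy h.cont_a h.cont_r x).continuousAt
  have ca := h.cont_a
  have cr := h.cont_r
  obtain ⟨K₁, hK₁, b₁⟩ := exists_abs_sin_mul_le (p := fun x => a x / c)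
    (q := fun x => (a x ^ 2 + r x ^ 2) / (4 * c ^ 2) - 1)
    (by fun_prop) (fun x => by simp [h.periodic_a x]) (by fun_prop)
    (fun x => by simp [h.periodic_a x, h.periodic_r x])
  obtain ⟨K₂, hK₂, b₂⟩ := exists_abs_sin_mul_le (p := fun x => v x / c)
    (q := fun x => cumEnergy a r x / (4 * c ^ 2) - x)
    (by fun_prop) (fun x => by simp [h.periodic_v x]) (by fun_prop)
    (fun x => by simp only [h.cumEnergy_add_one]; field_simp; ring)
  obtain ⟨K₃, hK₃, b₃⟩ := exists_abs_sin_mul_le (p := fun x => a' x / c)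
    (q := fun x => (2 * a x * a' x + 2 * r x * r' x) / (4 * c ^ 2))
    (by fun_prop) (fun x => by simp [pa' x]) (by fun_prop)
    (fun x => by simp [h.periodic_a x, h.periodic_r x, pa' x, pr' x])
  refine ⟨2 * K₁ + K₂ + 4 * K₃, fun t ht => ?_⟩
  set S := |Real.sin (c * t)| with hS
  have hS0 : 0 ≤ S := abs_nonneg _
  have m₁ := mul_nonneg hK₁ hS0
  have m₂ := mul_nonneg hK₂ hS0
  have m₃ := mul_nonneg hK₃ hS0
  have hsc := Real.sin_sq_add_cos_sq (c * t)
  have e₁ : ∀ x, |jac c t (a x) (r x) - 1| ≤ K₁ * S := fun x => by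
    refine le_trans (le_of_eq ?_) (b₁ (c * t) x)
    congr 1
    unfold jac
    field_simp
    linear_combination 4 * c ^ 2 * hsc
  have e₂ : ∀ x, |flow c t x (v x) (cumEnergy a r x) - x| ≤ K₂ * S := fun x => by
    refine le_trans (le_of_eq ?_) (b₂ (c * t) x)
    congr 1
    unfold flow
    field_simp
    linear_combination 4 * c ^ 2 * x * hsc
  have e₃ : ∀ x, |jacSpace c t (a x) (r x) (a' x) (r' x)| ≤ K₃ * S := fun x => by
    refine le_trans (le_of_eq ?_) (b₃ (c * t) x)
    congr 1
    unfold jacSpace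
    field_simp
  have hj : ∀ x, 1 / 2 ≤ jac c t (a x) (r x) := fun x => by
    have := (abs_le.1 (e₁ x)).1
    nlinarith
  have hj0 : ∀ x, 0 < jac c t (a x) (r x) := fun x => by linarith [hj x]
  have hinv : ∀ x, (jac c t (a x) (r x))⁻¹ ≤ 2 := fun x => by
    rw [inv_le_comm₀ (hj0 x) two_pos]; linarith [hj x]
  set Φ : ℝ → ℝ := fun x => flow c t x (v x) (cumEnergy a r x) with hΦ
  have dΦ := h.hasDerivAt_flow_space t
  have mono : StrictMono Φ := strictMono_of_hasDerivAt_pos dΦ hj0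
  have surj : Function.Surjective Φ := by
    refine (h.continuous_flow t).surjective ?_ ?_
    · refine tendsto_atTop_mono (fun x => ?_)
        (tendsto_atTop_add_const_right _ (-(1 / 2)) tendsto_id)
      have := (abs_le.1 (e₂ x)).1
      simp only [id]
      nlinarith
    · refine tendsto_atBot_mono (fun x => ?_) (tendsto_atBot_add_const_right _ (1 / 2) tendsto_id)
      have := (abs_le.1 (e₂ x)).2
      simp only [id]
      nlinarith
  set ψ : ℝ → ℝ := ⇑(mono.orderIsoOfSurjective Φ surj).symm with hψ
  have r1 : ∀ y, Φ (ψ y) = y := fun y => mono.orderIsoOfSurjective_self_symm_apply Φ surj y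
  have r2 : ∀ x, ψ (Φ x) = x := fun x => mono.orderIsoOfSurjective_symm_apply_self Φ surj x
  have cψ : Continuous ψ := (mono.orderIsoOfSurjective Φ surj).symm.continuous
  have djac : ∀ x, HasDerivAt (fun x => jac c t (a x) (r x))
      (jacSpace c t (a x) (r x) (a' x) (r' x)) x := fun x => by
    unfold jac jacSpace
    refine ((((ha x).const_mul _).const_add _).add
      ((((ha x).pow 2).add ((hr x).pow 2)).const_mul _)).congr_deriv ?_
    simp
  refine ⟨ψ, r2,
    { hasDerivAt := fun y => HasDerivAt.of_local_left_inverse cψ.continuousAt (dΦ (ψ y))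
        (hj0 _).ne' (Eventually.of_forall r1)
      map_add_one := fun y => mono.injective ?_
      hasDerivAt_g := fun x => (djac x).inv (hj0 x).ne'
      periodic_g := fun x => by simp [h.periodic_a x, h.periodic_r x]
      periodic_g' := fun x => by simp [h.periodic_a x, h.periodic_r x, pa' x, pr' x]
      continuous_g' := ?_
      abs_sub_id := fun y => ?_
      abs_g := fun x => ?_
      abs_g' := fun x => ?_
      le_half := ht }⟩
  · rw [r1]
    simp only [hΦ]
    rw [h.flow_add_one]
    exact (congrArg (· + 1) (r1 y)).symm
  · refine Continuous.div ?_ ?_ fun x => (pow_pos (hj0 x) 2).ne'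
    · unfold jacSpace; fun_prop
    · unfold jac; fun_prop
  · have := e₂ (ψ y)
    rw [show flow c t (ψ y) (v (ψ y)) (cumEnergy a r (ψ y)) = y from r1 y, abs_sub_comm] at this
    nlinarith
  · have h1 : (jac c t (a x) (r x))⁻¹ - 1 =
        -((jac c t (a x) (r x))⁻¹ * (jac c t (a x) (r x) - 1)) := by
      have := (hj0 x).ne'
      field_simp
      ring
    rw [h1, abs_neg, abs_mul, abs_of_pos (inv_pos.2 (hj0 x))]
    have := mul_le_mul (hinv x) (e₁ x) (abs_nonneg _) zero_le_two
    nlinarith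
  · rw [abs_div, abs_neg, abs_of_pos (pow_pos (hj0 x) 2), div_eq_mul_inv, ← inv_pow]
    have h1 := pow_le_pow_left₀ (inv_pos.2 (hj0 x)).le (hinv x) 2
    have := mul_le_mul (e₃ x) h1 (by positivity) m₃
    nlinarith

end InitialData

section Limit

variable {ι : Type*} {l : Filter ι} {σ c : ℝ} {v a r : ℝ → ℝ} {τ : ι → ℝ}

theorem tendsto_cos_sq (hl : Tendsto (fun i => Real.sin (c * τ i)) l (𝓝 0)) :
    Tendsto (fun i => Real.cos (c * τ i) ^ 2) l (𝓝 1) := by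
  have := (hl.pow 2).const_sub 1
  simp only [ne_eq, OfNat.ofNat_ne_zero, not_false_eq_true, zero_pow, sub_zero] at this
  exact this.congr fun i => by rw [Real.cos_sq']

theorem tendsto_sin_mul_cos (hl : Tendsto (fun i => Real.sin (c * τ i)) l (𝓝 0)) :
    Tendsto (fun i => Real.sin (c * τ i) * Real.cos (c * τ i)) l (𝓝 0) := by
  refine squeeze_zero_norm (fun i => ?_) (tendsto_zero_iff_norm_tendsto_zero.1 hl)
  rw [norm_mul]
  exact mul_le_of_le_one_right (norm_nonneg _) (Real.abs_cos_le_one _)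

/-- Linear combinations with convergent real coefficients of three functions. -/
theorem hTendsto_lincomb (hσ : 1 / 2 < σ) {f₁ f₂ f₃ : ℝ → ℝ} (h₁ : MemSobolev σ f₁)
    (h₂ : MemSobolev σ f₂) (h₃ : MemSobolev σ f₃) {p₁ p₂ p₃ : ι → ℝ} {q₁ q₂ q₃ : ℝ}
    (t₁ : Tendsto p₁ l (𝓝 q₁)) (t₂ : Tendsto p₂ l (𝓝 q₂)) (t₃ : Tendsto p₃ l (𝓝 q₃)) :
    HTendsto σ (fun i => cx fun x => p₁ i * f₁ x + p₂ i * f₂ x + p₃ i * f₃ x) l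
      (cx fun x => q₁ * f₁ x + q₂ * f₂ x + q₃ * f₃ x) := by
  have key : ∀ {f : ℝ → ℝ} {p : ι → ℝ} {q : ℝ}, MemSobolev σ f → Tendsto p l (𝓝 q) →
      HTendsto σ (fun i => (p i : ℂ) • cx f) l ((q : ℂ) • cx f) := fun hf ht =>
    HTendsto.smul hσ ((Complex.continuous_ofReal.tendsto _).comp ht) (.const hf.perCont hf.lt_top)
  have e : ∀ p₁ p₂ p₃ : ℝ, (cx fun x => p₁ * f₁ x + p₂ * f₂ x + p₃ * f₃ x) =
      (p₁ : ℂ) • cx f₁ + (p₂ : ℂ) • cx f₂ + (p₃ : ℂ) • cx f₃ := fun p₁ p₂ p₃ => by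
    ext x; simp [cx]
  simp only [e]
  exact ((key h₁ t₁).add (key h₂ t₂)).add (key h₃ t₃)

theorem memSobolev_one (σ : ℝ) : MemSobolev σ fun _ => (1 : ℝ) :=
  ⟨continuous_const, fun _ => rfl, sobSq_const_lt_top σ _⟩

theorem memSobolev_energyDensity (hσ : 1 / 2 < σ) (ma : MemSobolev σ a) (mr : MemSobolev σ r) :
    MemSobolev σ fun x => a x ^ 2 + r x ^ 2 := by
  have := (ma.mul hσ ma).add (mr.mul hσ mr)
  have e : (fun x => a x ^ 2 + r x ^ 2) = a * a + r * r := by ext x; simp [sq]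
  rwa [e]

theorem hTendsto_jac (hσ : 1 / 2 < σ) (ma : MemSobolev σ a) (mr : MemSobolev σ r)
    (hl : Tendsto (fun i => Real.sin (c * τ i)) l (𝓝 0)) :
    HTendsto σ (fun i => cx fun x => jac c (τ i) (a x) (r x)) l 1 := by
  have := hTendsto_lincomb hσ (memSobolev_one σ) ma (memSobolev_energyDensity hσ ma mr)
    (tendsto_cos_sq hl) ((tendsto_sin_mul_cos hl).div_const c)
    ((hl.pow 2).div_const (4 * c ^ 2))
  convert this using 1
  · ext i x; simp [jac, cx]
  · ext x; simp [cx]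

theorem hTendsto_jacVel (hσ : 1 / 2 < σ) (ma : MemSobolev σ a) (mr : MemSobolev σ r)
    (hl : Tendsto (fun i => Real.sin (c * τ i)) l (𝓝 0)) :
    HTendsto σ (fun i => cx fun x => jacVel c (τ i) (a x) (r x)) l (cx a) := by
  have := hTendsto_lincomb hσ (memSobolev_one σ) ma (memSobolev_energyDensity hσ ma mr)
    ((tendsto_sin_mul_cos hl).const_mul (-2 * c)) ((tendsto_cos_sq hl).sub (hl.pow 2))
    ((tendsto_sin_mul_cos hl).div_const (2 * c))
  convert this using 1
  · ext i x; simp [jacVel, cx]; ring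
  · ext x; simp [cx]

/-- If the flow at the times `τ i` tends to the identity, then `u_x` and `ρ` tend to their initial
values in `H^σ`: by the Lagrangian formulas they are compositions of convergent functions with the
inverse of the flow. -/
theorem ClassicalSolution.hTendsto_initial {T : EReal} {u ux uxx utx ρ ρx ρt : ℝ → ℝ → ℝ}
    (h : ClassicalSolution (timeInterval T) u ux uxx utx ρ ρx ρt) (hT : 0 < T)
    (hc : 0 < c) (hQ : ∫ x in (0 : ℝ)..1, (ux 0 x ^ 2 + ρ 0 x ^ 2) = 4 * c ^ 2) (hσ : 1 / 2 < σ)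
    (ma : MemSobolev σ (ux 0)) (mr : MemSobolev σ (ρ 0))
    (hl : Tendsto (fun i => Real.sin (c * τ i)) l (𝓝 0)) (hτ : ∀ᶠ i in l, τ i ∈ timeInterval T) :
    HTendsto σ (fun i => cx (ux (τ i))) l (cx (ux 0)) ∧
      HTendsto σ (fun i => cx (ρ (τ i))) l (cx (ρ 0)) := by
  have hd := h.initialData hT hc hQ
  have h0 : (0 : ℝ) ∈ timeInterval T := ⟨le_rfl, by simpa using hT⟩
  obtain ⟨K, hK⟩ := hd.exists_nearId (h.hasDerivAt_ux 0 h0) (h.hasDerivAt_ρ 0 h0)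
    (continuous_slice h.cont_uxx h0) (continuous_slice h.cont_ρx h0)
  have tδ : Tendsto (fun i => K * |Real.sin (c * τ i)|) l (𝓝 0) := by
    simpa using hl.abs.const_mul K
  have hδ : ∀ᶠ i in l, K * |Real.sin (c * τ i)| ≤ 1 / 2 :=
    tδ.eventually_le_const (by norm_num)
  have hex : ∀ i, ∃ ψ : ℝ → ℝ, K * |Real.sin (c * τ i)| ≤ 1 / 2 →
      (∀ x, ψ (flow c (τ i) x (u 0 x) (cumEnergy (ux 0) (ρ 0) x)) = x) ∧
      NearId (K * |Real.sin (c * τ i)|) ψ (fun x => (jac c (τ i) (ux 0 x) (ρ 0 x))⁻¹)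
        (fun x => -jacSpace c (τ i) (ux 0 x) (ρ 0 x) (uxx 0 x) (ρx 0 x) /
          jac c (τ i) (ux 0 x) (ρ 0 x) ^ 2) := fun i => by
    by_cases hi : K * |Real.sin (c * τ i)| ≤ 1 / 2
    · obtain ⟨ψ, hψ⟩ := hK _ hi
      exact ⟨ψ, fun _ => hψ⟩
    · exact ⟨id, fun h => absurd h hi⟩
  choose ψ hψ using hex
  have tg : HTendsto σ (fun i => cx fun x => (jac c (τ i) (ux 0 x) (ρ 0 x))⁻¹) l 1 := by
    refine ((hTendsto_jac hσ ma mr hl).inv hσ).congr' (Eventually.of_forall fun i => ?_)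
    ext x; simp [cx]
  have comp := fun {F : ι → ℝ → ℂ} {F₀ : ℝ → ℂ} (hF : HTendsto σ F l F₀) =>
    HTendsto.comp (hδ.mono fun i hi => (hψ i hi).2) tδ hσ tg hF
  have t1 := (hTendsto_jacVel hσ ma mr hl).mul hσ tg
  have t2 := (HTendsto.const (l := l) mr.perCont mr.lt_top).mul hσ tg
  rw [mul_one] at t1 t2
  constructor
  · refine (comp t1).congr' ?_
    filter_upwards [hδ, hτ] with i hi hIi
    have e : (fun y => jacVel c (τ i) (ux 0 (ψ i y)) (ρ 0 (ψ i y)) *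
        (jac c (τ i) (ux 0 (ψ i y)) (ρ 0 (ψ i y)))⁻¹) = ux (τ i) := by
      refine eq_of_periodic_of_eqOn (fun y => ?_) (h.periodic_ux hIi) fun y hy => ?_
      · simp only [(hψ i hi).2.map_add_one, hd.periodic_a _, hd.periodic_r _]
      · obtain ⟨x, hx, rfl⟩ := hd.exists_flow_eq (τ i) hy
        rw [(hψ i hi).1, (h.lagrangian hc hQ hIi hx).2.2.1, div_eq_mul_inv]
    rw [← e]
    ext y; simp [cx]
  · refine (comp t2).congr' ?_
    filter_upwards [hδ, hτ] with i hi hIi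
    have e : (fun y => ρ 0 (ψ i y) * (jac c (τ i) (ux 0 (ψ i y)) (ρ 0 (ψ i y)))⁻¹) = ρ (τ i) := by
      refine eq_of_periodic_of_eqOn (fun y => ?_) (h.periodic_ρ _ hIi) fun y hy => ?_
      · simp only [(hψ i hi).2.map_add_one, hd.periodic_a _, hd.periodic_r _]
      · obtain ⟨x, hx, rfl⟩ := hd.exists_flow_eq (τ i) hy
        rw [(hψ i hi).1, (h.lagrangian hc hQ hIi hx).2.2.2, div_eq_mul_inv]
    rw [← e]
    ext y; simp [cx]

end Limit

/-! ### One-sided derivatives as limits of derivatives -/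

/-- The Fourier coefficients with frequencies in `S`, weighted by the `H^σ` norm. -/
def weightedCoeff (σ : ℝ) (S : Finset ℤ) (f : ℝ → ℂ) : EuclideanSpace ℂ S :=
  WithLp.toLp 2 fun n => (Real.sqrt ((1 + ((n : ℤ) : ℝ) ^ 2) ^ σ) : ℂ) * coeff f n

theorem enorm_weightedCoeff_sq (σ : ℝ) (S : Finset ℤ) (f : ℝ → ℂ) :
    ENNReal.ofReal (‖weightedCoeff σ S f‖ ^ 2) = ∑ n ∈ S, wt σ n * ‖coeff f n‖ₑ ^ 2 := by
  rw [EuclideanSpace.norm_sq_eq, ENNReal.ofReal_sum_of_nonneg fun n _ => by positivity,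
    ← Finset.sum_coe_sort S]
  refine Finset.sum_congr rfl fun n _ => ?_
  have h0 : (0 : ℝ) ≤ (1 + ((n : ℤ) : ℝ) ^ 2) ^ σ := by positivity
  simp only [weightedCoeff]
  rw [norm_mul, mul_pow, Complex.norm_real, Real.norm_eq_abs, sq_abs, Real.sq_sqrt h0,
    ENNReal.ofReal_mul h0, enorm_sq_eq, wt]

theorem norm_weightedCoeff_le {σ : ℝ} {f : ℝ → ℂ} {C : ℝ} (hC : 0 ≤ C)
    (h : sobSq σ f ≤ ENNReal.ofReal (C ^ 2)) (S : Finset ℤ) : ‖weightedCoeff σ S f‖ ≤ C := by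
  have h1 : ∑ n ∈ S, wt σ n * ‖coeff f n‖ₑ ^ 2 ≤ sobSq σ f := ENNReal.sum_le_tsum S
  rw [← enorm_weightedCoeff_sq] at h1
  have := (ENNReal.ofReal_le_ofReal_iff (by positivity)).1 (h1.trans h)
  exact le_of_sq_le_sq this hC

theorem sobSq_le_of_norm_weightedCoeff_le {σ : ℝ} {f : ℝ → ℂ} {C : ℝ}
    (h : ∀ S, ‖weightedCoeff σ S f‖ ≤ C) : sobSq σ f ≤ ENNReal.ofReal (C ^ 2) := by
  unfold sobSq
  rw [ENNReal.tsum_eq_iSup_sum]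
  refine iSup_le fun S => ?_
  rw [← enorm_weightedCoeff_sq]
  exact ENNReal.ofReal_le_ofReal (pow_le_pow_left₀ (norm_nonneg _) (h S) 2)

theorem weightedCoeff_sub {f g : ℝ → ℂ} (hf : Continuous f) (hg : Continuous g) (σ : ℝ)
    (S : Finset ℤ) : weightedCoeff σ S (f - g) = weightedCoeff σ S f - weightedCoeff σ S g := by
  ext n; simp [weightedCoeff, coeff_sub hf hg, mul_sub]

theorem weightedCoeff_smul (a : ℝ) (f : ℝ → ℂ) (σ : ℝ)
    (S : Finset ℤ) : weightedCoeff σ S ((a : ℂ) • f) = a • weightedCoeff σ S f := by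
  ext n
  simp only [weightedCoeff, coeff_smul, PiLp.smul_apply, Complex.real_smul]
  ring

theorem HTendsto.weightedCoeff {ι : Type*} {l : Filter ι} {σ : ℝ} {F : ι → ℝ → ℂ} {F₀ : ℝ → ℂ}
    (h : HTendsto σ F l F₀) (S : Finset ℤ) :
    Tendsto (fun i => weightedCoeff σ S (F i)) l (𝓝 (weightedCoeff σ S F₀)) := by
  rw [Metric.tendsto_nhds]
  intro ε hε
  filter_upwards [h.perCont, h.tendsto.eventually_le_const
    (u := ENNReal.ofReal ((ε / 2) ^ 2)) (by positivity)] with i h1 h2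
  rw [dist_eq_norm, ← weightedCoeff_sub h1.1 h.perCont_lim.1]
  exact (norm_weightedCoeff_le (by positivity) h2 S).trans_lt (by linarith)

/-- If a curve and its derivative on `[0, b)` converge at `b` to `v₀` and `w₀`, then `w₀` is the
left derivative at `b` of the curve extended by `v₀`. The mean value inequality is used for finitely
many Fourier coefficients at a time. -/
theorem HasDerivInSobolev.hTendsto_left {σ : ℝ} {b : ℝ} (hb : 0 < b) {T : EReal}
    (hbT : (b : EReal) ≤ T)
    {v w : ℝ → ℝ → ℝ} {v₀ w₀ : ℝ → ℝ}
    (hv : ∀ t ∈ timeInterval T, MemSobolev σ (v t)) (hw : ∀ t ∈ timeInterval T, MemSobolev σ (w t))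
    (hd : HasDerivInSobolev σ T v w) (hv₀ : MemSobolev σ v₀) (hw₀ : MemSobolev σ w₀)
    (tv : HTendsto σ (fun t => cx (v t)) (𝓝[<] b) (cx v₀))
    (tw : HTendsto σ (fun t => cx (w t)) (𝓝[<] b) (cx w₀)) :
    HTendsto σ (fun t => cx ((t - b)⁻¹ • (v t - v₀))) (𝓝[<] b) (cx w₀) := by
  have hI : ∀ t, 0 ≤ t → t < b → t ∈ timeInterval T := fun t h0 h1 =>
    ⟨h0, (EReal.coe_lt_coe_iff.2 h1).trans_le hbT⟩
  have hIe : ∀ᶠ t in 𝓝[<] b, t ∈ timeInterval T := by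
    filter_upwards [Ioo_mem_nhdsLT hb] with t ht using hI t ht.1.le ht.2
  rw [hTendsto_cx_iff (by
    filter_upwards [hIe] with t ht using ((hv t ht).sub hv₀).smul _) hw₀]
  rw [hasDerivInSobolev_iff hv hw] at hd
  rw [ENNReal.tendsto_nhds_zero]
  intro ε hε
  obtain ⟨C, hC, hCε⟩ : ∃ C : ℝ, 0 < C ∧ ENNReal.ofReal (C ^ 2) ≤ ε := by
    by_cases hε' : ε = ⊤
    · exact ⟨1, one_pos, by rw [hε']; exact le_top⟩
    · refine ⟨Real.sqrt ε.toReal, Real.sqrt_pos.2 (ENNReal.toReal_pos hε.ne' hε'), ?_⟩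
      rw [Real.sq_sqrt ENNReal.toReal_nonneg, ENNReal.ofReal_toReal hε']
  have ev := tw.tendsto.eventually_le_const (u := ENNReal.ofReal (C ^ 2)) (by positivity)
  obtain ⟨a₀, ha₀, hmem⟩ := (mem_nhdsLT_iff_exists_Ioo_subset).1 ev
  filter_upwards [Ioo_mem_nhdsLT (max_lt hb ha₀)] with t ht
  have ht0 : 0 < t := (le_max_left _ _).trans_lt ht.1
  have hta : a₀ < t := (le_max_right _ _).trans_lt ht.1
  have htb : t < b := ht.2
  refine le_trans ?_ hCε
  rw [sobolevNormSq_eq_cx]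
  refine sobSq_le_of_norm_weightedCoeff_le fun S => ?_
  -- `γ` extends continuously to `b`, and its derivative is bounded by `C` on `[t, b)`.
  set γ : ℝ → EuclideanSpace ℂ S := fun τ =>
    weightedCoeff σ S (cx (v τ)) - τ • weightedCoeff σ S (cx w₀) with hγ
  have dγ : ∀ τ ∈ Ico t b, HasDerivWithinAt γ
      (weightedCoeff σ S (cx (w τ)) - (1 : ℝ) • weightedCoeff σ S (cx w₀)) (Ico t b) τ := by
    intro τ hτ
    have hτI := hI τ (ht0.le.trans hτ.1) hτ.2
    refine HasDerivWithinAt.sub ?_ ((hasDerivWithinAt_id _ _).smul_const _)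
    rw [hasDerivWithinAt_iff_tendsto_slope]
    have sub : Ico t b ⊆ timeInterval T := fun x hx => hI x (ht0.le.trans hx.1) hx.2
    refine (((hd τ hτI).mono_filter (nhdsWithin_mono _ (sdiff_subset_sdiff_left sub))).weightedCoeff
      S).congr' ?_
    filter_upwards [self_mem_nhdsWithin] with x hx
    rw [cx_smul, weightedCoeff_smul, cx_sub,
      weightedCoeff_sub (hv x (sub hx.1)).perCont.1 (hv τ hτI).perCont.1]
    rfl
  have bγ : ∀ τ ∈ Ico t b,
      ‖weightedCoeff σ S (cx (w τ)) - (1 : ℝ) • weightedCoeff σ S (cx w₀)‖ ≤ C := by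
    intro τ hτ
    rw [one_smul,
      ← weightedCoeff_sub (hw τ (hI τ (ht0.le.trans hτ.1) hτ.2)).perCont.1 hw₀.perCont.1]
    exact norm_weightedCoeff_le hC.le (hmem ⟨hta.trans_le hτ.1, hτ.2⟩) S
  have hmv : ∀ᶠ τ in 𝓝[<] b, ‖γ τ - γ t‖ ≤ C * ‖τ - t‖ := by
    filter_upwards [Ioo_mem_nhdsLT htb] with τ hτ
    exact (convex_Ico t b).norm_image_sub_le_of_norm_hasDerivWithin_le dγ bγ ⟨le_rfl, htb⟩
      ⟨hτ.1.le, hτ.2⟩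
  have hid : Tendsto (fun τ : ℝ => τ) (𝓝[<] b) (𝓝 b) := tendsto_id.mono_left nhdsWithin_le_nhds
  have lim := le_of_tendsto_of_tendsto
    (((tv.weightedCoeff S).sub (hid.smul_const (weightedCoeff σ S (cx w₀)))).sub_const (γ t)).norm
    ((hid.sub_const t).norm.const_mul C) hmv
  have hneg : t - b < 0 := by linarith
  have e : weightedCoeff σ S (cx ((t - b)⁻¹ • (v t - v₀) - w₀)) =
      (b - t)⁻¹ • (weightedCoeff σ S (cx v₀) - b • weightedCoeff σ S (cx w₀) - γ t) := by
    have ht' := hv t (hI t ht0.le htb)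
    rw [cx_sub, weightedCoeff_sub (((ht'.sub hv₀).smul _).perCont.1) hw₀.perCont.1, cx_smul,
      weightedCoeff_smul, cx_sub, weightedCoeff_sub ht'.perCont.1 hv₀.perCont.1]
    have h1 : b - t ≠ 0 := by linarith
    have h2 : t - b = -(b - t) := by ring
    rw [h2, inv_neg]
    simp only [hγ]
    have h3 : (b - t)⁻¹ • (b - t) • weightedCoeff σ S (cx w₀) = weightedCoeff σ S (cx w₀) := by
      rw [smul_smul, inv_mul_cancel₀ h1, one_smul]
    conv_lhs => rw [← h3]
    module
  have hp : 0 < b - t := by linarith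
  rw [e, norm_smul, norm_inv, Real.norm_of_nonneg hp.le]
  rw [Real.norm_of_nonneg hp.le] at lim
  rw [inv_mul_le_iff₀ hp]
  linarith

/-! ### Return of a solution to its initial values -/

namespace StrongSolution

variable {s : ℝ} {T : EReal} {u ρ ut ρt : ℝ → ℝ → ℝ} {c : ℝ} {l : Filter ℝ}

/-- As `sin (c t)` tends to zero, the solution and its time derivatives tend to their initial
values. -/
theorem hTendsto_initial (h : StrongSolution s T u ρ ut ρt) (hs : 9 / 2 < s) (hT : 0 < T)
    (hc : 0 < c) (hQ : ∫ x in (0 : ℝ)..1, (deriv (u 0) x ^ 2 + ρ 0 x ^ 2) = 4 * c ^ 2)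
    (hl : Tendsto (fun t => Real.sin (c * t)) l (𝓝 0)) (hI : ∀ᶠ t in l, t ∈ timeInterval T) :
    HTendsto s (fun t => cx (u t)) l (cx (u 0)) ∧
      HTendsto (s - 1) (fun t => cx (ρ t)) l (cx (ρ 0)) ∧
      HTendsto (s - 1) (fun t => cx (ut t)) l (cx (ut 0)) ∧
      HTendsto (s - 2) (fun t => cx (ρt t)) l (cx (ρt 0)) := by
  have h0 : (0 : ℝ) ∈ timeInterval T := ⟨le_rfl, by simpa using hT⟩
  have hcl := h.classicalSolution hs
  obtain ⟨tux, tρ⟩ := hcl.hTendsto_initial hT hc hQ (σ := s - 1) (by linarith)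
    ((h.mem_u 0 h0).deriv (by linarith)) (h.mem_ρ 0 h0) hl hI
  have mux : ∀ t ∈ timeInterval T, MemSobolev (s - 1) (deriv (u t)) := fun t ht =>
    (h.mem_u t ht).deriv (by linarith)
  have tu : HTendsto s (fun t => cx (u t)) l (cx (u 0)) := by
    have := tux.succ_of_deriv_of_zero (by linarith) (F := fun t => cx (u t)) (F₀ := cx (u 0))
      (by
        filter_upwards [hI] with t ht
        exact ⟨(h.mem_u t ht).perCont.2, by simp [cx, h.u_zero t ht],
          fun x => hasDerivAt_cx (hcl.hasDerivAt_u t ht x)⟩)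
      (h.mem_u 0 h0).perCont.2 (by simp [cx, h.u_zero 0 h0])
      fun x => hasDerivAt_cx (hcl.hasDerivAt_u 0 h0 x)
    rwa [sub_add_cancel] at this
  have tuxx := tux.cx_deriv (by linarith) (hI.mono mux) (mux 0 h0)
  have tρx := tρ.cx_deriv (by linarith) (hI.mono h.mem_ρ) (h.mem_ρ 0 h0)
  rw [show s - 1 - 1 = s - 2 by ring] at tuxx tρx
  have hσ : 1 / 2 < s - 2 := by linarith
  have tu2 := tu.mono (show s - 2 ≤ s by linarith)
  have tux2 := tux.mono (show s - 2 ≤ s - 1 by linarith)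
  have tρ2 := tρ.mono (show s - 2 ≤ s - 1 by linarith)
  have neg1 : Tendsto (fun _ : ℝ => (-1 : ℂ)) l (𝓝 (-1)) := tendsto_const_nhds
  refine ⟨tu, tρ, ?_, ?_⟩
  · have half : Tendsto (fun _ : ℝ => (1 / 2 : ℂ)) l (𝓝 (1 / 2)) := tendsto_const_nhds
    have nhalf : Tendsto (fun _ : ℝ => (-(1 / 2) : ℂ)) l (𝓝 (-(1 / 2))) := tendsto_const_nhds
    have const : Tendsto (fun _ : ℝ => (-(2 * c ^ 2) : ℂ)) l (𝓝 (-(2 * c ^ 2))) :=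
      tendsto_const_nhds
    have tutx := (((tu2.mul hσ tuxx).smul hσ neg1).add ((tux2.mul hσ tux2).smul hσ nhalf)).add
      (((tρ2.mul hσ tρ2).smul hσ half).add (HTendsto.of_scalar const))
    have e : ∀ t ∈ timeInterval T, cx (deriv (ut t)) =
        (-1 : ℂ) • (cx (u t) * cx (deriv (deriv (u t)))) +
          (-(1 / 2) : ℂ) • (cx (deriv (u t)) * cx (deriv (u t))) +
          ((1 / 2 : ℂ) • (cx (ρ t) * cx (ρ t)) + fun _ => (-(2 * c ^ 2) : ℂ)) := fun t ht => by
      ext x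
      have h1 := hcl.eq_u t ht x
      rw [(hcl.energy_eq ht).trans hQ] at h1
      have h2 : deriv (ut t) x = (-1) * (u t x * deriv (deriv (u t)) x) +
          (-(1 / 2)) * (deriv (u t) x * deriv (u t) x) +
          (1 / 2 * (ρ t x * ρ t x) + -(2 * c ^ 2)) := by linear_combination h1
      simp only [cx, Pi.add_apply, Pi.smul_apply, Pi.mul_apply, smul_eq_mul]
      rw [h2]
      push_cast
      ring
    rw [← e 0 h0] at tutx
    have tutx' := tutx.congr' (G := fun t => cx (deriv (ut t))) (hI.mono fun t ht => (e t ht).symm)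
    have := tutx'.succ_of_deriv_of_zero hσ (F := fun t => cx (ut t)) (F₀ := cx (ut 0))
      (by
        filter_upwards [hI] with t ht
        exact ⟨(h.mem_ut t ht).perCont.2, by simp [cx, h.ut_zero t ht],
          fun x => hasDerivAt_cx ((h.mem_ut t ht).hasDerivAt (by linarith) x)⟩)
      (h.mem_ut 0 h0).perCont.2 (by simp [cx, h.ut_zero 0 h0])
      fun x => hasDerivAt_cx ((h.mem_ut 0 h0).hasDerivAt (by linarith) x)
    rwa [show s - 2 + 1 = s - 1 by ring] at this
  · have tt := ((tu2.mul hσ tρx).smul hσ neg1).add ((tρ2.mul hσ tux2).smul hσ neg1)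
    have e : ∀ t ∈ timeInterval T, cx (ρt t) = (-1 : ℂ) • (cx (u t) * cx (deriv (ρ t))) +
        (-1 : ℂ) • (cx (ρ t) * cx (deriv (u t))) := fun t ht => by
      ext x
      have h2 : ρt t x = (-1) * (u t x * deriv (ρ t) x) + (-1) * (ρ t x * deriv (u t) x) := by
        linear_combination hcl.eq_ρ t ht x
      simp only [cx, Pi.add_apply, Pi.smul_apply, Pi.mul_apply, smul_eq_mul]
      rw [h2]
      push_cast
      ring
    rw [← e 0 h0] at tt
    exact tt.congr' (hI.mono fun t ht => (e t ht).symm)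

end StrongSolution

/-! ### Extension of a solution by its period -/

theorem mem_timeInterval_coe {b t : ℝ} : t ∈ timeInterval (b : EReal) ↔ 0 ≤ t ∧ t < b := by
  simp [timeInterval]

/-- The curve `v` on `[0, p)`, continued from the time `p` on by starting again at the time `0`. -/
def restart (p : ℝ) (v : ℝ → ℝ → ℝ) (t : ℝ) : ℝ → ℝ := if t < p then v t else v (t - p)

theorem restart_of_lt {p t : ℝ} (v : ℝ → ℝ → ℝ) (h : t < p) : restart p v t = v t := if_pos h

theorem restart_of_le {p t : ℝ} (v : ℝ → ℝ → ℝ) (h : p ≤ t) : restart p v t = v (t - p) :=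
  if_neg h.not_gt

theorem HTendsto.sup {ι : Type*} {l l' : Filter ι} {σ : ℝ} {F : ι → ℝ → ℂ} {F₀ : ℝ → ℂ}
    (h : HTendsto σ F l F₀) (h' : HTendsto σ F l' F₀) : HTendsto σ F (l ⊔ l') F₀ :=
  ⟨eventually_sup.2 ⟨h.perCont, h'.perCont⟩, h.perCont_lim, h.lt_top, h.tendsto.sup h'.tendsto⟩

theorem HTendsto.comp_tendsto {ι κ : Type*} {l : Filter ι} {k : Filter κ} {σ : ℝ}
    {F : ι → ℝ → ℂ} {F₀ : ℝ → ℂ} (h : HTendsto σ F l F₀) {τ : κ → ι} (hτ : Tendsto τ k l) :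
    HTendsto σ (fun i => F (τ i)) k F₀ :=
  ⟨hτ.eventually h.perCont, h.perCont_lim, h.lt_top, h.tendsto.comp hτ⟩

section Restart

variable {σ b p : ℝ} {v w : ℝ → ℝ → ℝ}

/-- A property of all the values of a curve passes to the restarted curve. -/
theorem forall_restart {P : (ℝ → ℝ) → Prop} (hpb : p ≤ b)
    (h : ∀ t ∈ timeInterval (b : EReal), P (v t)) :
    ∀ t ∈ timeInterval ((b + p : ℝ) : EReal), P (restart p v t) := by
  intro t ht
  rw [mem_timeInterval_coe] at ht
  rcases lt_or_ge t p with htp | htp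
  · rw [restart_of_lt _ htp]
    exact h t (mem_timeInterval_coe.2 ⟨ht.1, htp.trans_le hpb⟩)
  · rw [restart_of_le _ htp]
    exact h _ (mem_timeInterval_coe.2 ⟨by linarith, by linarith⟩)

theorem tendsto_sub_period (p b t : ℝ) :
    Tendsto (fun τ => τ - p) (𝓝[timeInterval ((b + p : ℝ) : EReal) ∩ Ici p] t)
      (𝓝[timeInterval (b : EReal)] (t - p)) := by
  refine tendsto_nhdsWithin_iff.2
    ⟨((continuous_id.sub continuous_const).tendsto t).mono_left nhdsWithin_le_nhds, ?_⟩
  filter_upwards [self_mem_nhdsWithin] with τ hτ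
  have := (mem_timeInterval_coe.1 hτ.1).2
  exact mem_timeInterval_coe.2 ⟨by linarith [mem_Ici.1 hτ.2], by linarith⟩

theorem tendsto_sub_period_ne (p b t : ℝ) :
    Tendsto (fun τ => τ - p) (𝓝[(timeInterval ((b + p : ℝ) : EReal) \ {t}) ∩ Ici p] t)
      (𝓝[timeInterval (b : EReal) \ {t - p}] (t - p)) := by
  refine tendsto_nhdsWithin_iff.2
    ⟨((continuous_id.sub continuous_const).tendsto t).mono_left nhdsWithin_le_nhds, ?_⟩
  filter_upwards [self_mem_nhdsWithin] with τ hτ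
  have := (mem_timeInterval_coe.1 hτ.1.1).2
  refine ⟨mem_timeInterval_coe.2 ⟨by linarith [mem_Ici.1 hτ.2], by linarith⟩, fun h => hτ.1.2 ?_⟩
  have h' : τ - p = t - p := h
  have : τ = t := by linarith
  exact this

/-- To converge at the time `t` within `S` is to converge before `p` and from `p` on. -/
theorem hTendsto_of_before_after {S : Set ℝ} {t : ℝ} {F : ℝ → ℝ → ℂ} {F₀ : ℝ → ℂ}
    (before : t ≤ p → HTendsto σ F (𝓝[S ∩ Iio p] t) F₀)
    (after : p ≤ t → HTendsto σ F (𝓝[S ∩ Ici p] t) F₀) : HTendsto σ F (𝓝[S] t) F₀ := by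
  rcases lt_trichotomy t p with htp | rfl | htp
  · refine (before htp.le).mono_filter (le_of_eq ?_)
    rw [inter_comm, nhdsWithin_inter_of_mem (mem_nhdsWithin_of_mem_nhds (Iio_mem_nhds htp))]
  · refine ((before le_rfl).sup (after le_rfl)).mono_filter (le_of_eq ?_)
    rw [← nhdsWithin_union, ← inter_union_distrib_left, Iio_union_Ici, inter_univ]
  · refine (after htp.le).mono_filter (le_of_eq ?_)
    rw [inter_comm, nhdsWithin_inter_of_mem (mem_nhdsWithin_of_mem_nhds (Ici_mem_nhds htp))]

/-- Restarting a continuous curve which closes up at the time `p` gives a continuous curve. -/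
theorem continuousInSobolev_restart (hpb : p ≤ b)
    (hv : ∀ t ∈ timeInterval (b : EReal), MemSobolev σ (v t))
    (h : ContinuousInSobolev σ (b : EReal) v)
    (hl : HTendsto σ (fun t => cx (v t)) (𝓝[<] p) (cx (v 0))) :
    ContinuousInSobolev σ ((b + p : ℝ) : EReal) (restart p v) := by
  rw [continuousInSobolev_iff hv] at h
  rw [continuousInSobolev_iff (forall_restart hpb hv)]
  intro t ht
  have ht' := mem_timeInterval_coe.1 ht
  refine hTendsto_of_before_after (p := p) (fun htp => ?_) fun htp => ?_
  · have key : HTendsto σ (fun τ => cx (v τ))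
        (𝓝[timeInterval ((b + p : ℝ) : EReal) ∩ Iio p] t) (cx (restart p v t)) := by
      rcases htp.lt_or_eq with htp | rfl
      · rw [restart_of_lt v htp]
        refine (h t (mem_timeInterval_coe.2 ⟨ht'.1, htp.trans_le hpb⟩)).mono_filter
          (nhdsWithin_mono t fun τ hτ => ?_)
        exact mem_timeInterval_coe.2 ⟨hτ.1.1, (mem_Iio.1 hτ.2).trans_le hpb⟩
      · rw [restart_of_le v le_rfl, sub_self]
        exact hl.mono_filter (nhdsWithin_mono _ inter_subset_right)
    refine key.congr' ?_
    filter_upwards [self_mem_nhdsWithin] with τ hτ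
    rw [restart_of_lt v hτ.2]
  · rw [restart_of_le v htp]
    refine ((h (t - p) (mem_timeInterval_coe.2 ⟨by linarith, by linarith⟩)).comp_tendsto
      (tendsto_sub_period p b t)).congr' ?_
    filter_upwards [self_mem_nhdsWithin] with τ hτ
    rw [restart_of_le v hτ.2]

/-- Restarting a differentiable curve which closes up at the time `p`, together with its derivative,
gives a differentiable curve. -/
theorem hasDerivInSobolev_restart (hp : 0 < p) (hpb : p ≤ b)
    (hv : ∀ t ∈ timeInterval (b : EReal), MemSobolev σ (v t))
    (hw : ∀ t ∈ timeInterval (b : EReal), MemSobolev σ (w t))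
    (h : HasDerivInSobolev σ (b : EReal) v w)
    (hl : HTendsto σ (fun t => cx (v t)) (𝓝[<] p) (cx (v 0)))
    (hl' : HTendsto σ (fun t => cx (w t)) (𝓝[<] p) (cx (w 0))) :
    HasDerivInSobolev σ ((b + p : ℝ) : EReal) (restart p v) (restart p w) := by
  have h0 : (0 : ℝ) ∈ timeInterval (b : EReal) :=
    mem_timeInterval_coe.2 ⟨le_rfl, hp.trans_le hpb⟩
  have left := h.hTendsto_left hp (by exact_mod_cast hpb) hv hw (hv 0 h0) (hw 0 h0) hl hl'
  rw [hasDerivInSobolev_iff hv hw] at h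
  rw [hasDerivInSobolev_iff (forall_restart hpb hv) (forall_restart hpb hw)]
  intro t ht
  have ht' := mem_timeInterval_coe.1 ht
  refine hTendsto_of_before_after (p := p) (fun htp => ?_) fun htp => ?_
  · have key : HTendsto σ (fun τ => cx ((τ - t)⁻¹ • (v τ - restart p v t)))
        (𝓝[(timeInterval ((b + p : ℝ) : EReal) \ {t}) ∩ Iio p] t) (cx (restart p w t)) := by
      rcases htp.lt_or_eq with htp | rfl
      · rw [restart_of_lt v htp, restart_of_lt w htp]
        refine (h t (mem_timeInterval_coe.2 ⟨ht'.1, htp.trans_le hpb⟩)).mono_filter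
          (nhdsWithin_mono t fun τ hτ => ⟨?_, hτ.1.2⟩)
        exact mem_timeInterval_coe.2 ⟨hτ.1.1.1, (mem_Iio.1 hτ.2).trans_le hpb⟩
      · rw [restart_of_le v le_rfl, restart_of_le w le_rfl, sub_self]
        exact left.mono_filter (nhdsWithin_mono _ inter_subset_right)
    refine key.congr' ?_
    filter_upwards [self_mem_nhdsWithin] with τ hτ
    rw [restart_of_lt v hτ.2]
  · rw [restart_of_le v htp, restart_of_le w htp]
    refine ((h (t - p) (mem_timeInterval_coe.2 ⟨by linarith, by linarith⟩)).comp_tendsto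
      (tendsto_sub_period_ne p b t)).congr' ?_
    filter_upwards [self_mem_nhdsWithin] with τ hτ
    rw [restart_of_le v hτ.2, sub_sub_sub_cancel_right]

end Restart

/-- A solution which exists for the time `π / c` can be restarted there from its initial values. -/
theorem StrongSolution.restart {s b c : ℝ} {u ρ ut ρt : ℝ → ℝ → ℝ} (hs : 9 / 2 < s)
    (h : StrongSolution s (b : EReal) u ρ ut ρt) (hc : 0 < c) (hb : Real.pi / c ≤ b)
    (hQ : ∫ x in (0 : ℝ)..1, (deriv (u 0) x ^ 2 + ρ 0 x ^ 2) = 4 * c ^ 2) :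
    StrongSolution s ((b + Real.pi / c : ℝ) : EReal) (restart (Real.pi / c) u)
      (restart (Real.pi / c) ρ) (restart (Real.pi / c) ut) (restart (Real.pi / c) ρt) := by
  have hp : 0 < Real.pi / c := div_pos Real.pi_pos hc
  set p := Real.pi / c with hpdef
  have hsin : Tendsto (fun t => Real.sin (c * t)) (𝓝[<] p) (𝓝 0) := by
    have h1 : ContinuousAt (fun t => Real.sin (c * t)) p := by fun_prop
    have h2 := h1.tendsto.mono_left (nhdsWithin_le_nhds (s := Iio p))
    simpa [hpdef, mul_div_cancel₀ _ hc.ne'] using h2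
  have hI : ∀ᶠ t in 𝓝[<] p, t ∈ timeInterval (b : EReal) := by
    filter_upwards [Ioo_mem_nhdsLT hp] with t ht
    exact mem_timeInterval_coe.2 ⟨ht.1.le, ht.2.trans_le hb⟩
  obtain ⟨tu, tρ, tut, tρt⟩ :=
    h.hTendsto_initial hs (by exact_mod_cast hp.trans_le hb) hc hQ hsin hI
  exact
    { mem_u := forall_restart hb h.mem_u
      u_zero := forall_restart (P := fun f => f 0 = 0) hb h.u_zero
      mem_ρ := forall_restart hb h.mem_ρ
      mem_ut := forall_restart hb h.mem_ut
      ut_zero := forall_restart (P := fun f => f 0 = 0) hb h.ut_zero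
      mem_ρt := forall_restart hb h.mem_ρt
      cont_u := continuousInSobolev_restart hb h.mem_u h.cont_u tu
      cont_ρ := continuousInSobolev_restart hb h.mem_ρ h.cont_ρ tρ
      cont_ut := continuousInSobolev_restart hb h.mem_ut h.cont_ut tut
      cont_ρt := continuousInSobolev_restart hb h.mem_ρt h.cont_ρt tρt
      deriv_u := hasDerivInSobolev_restart hp hb (fun t ht => (h.mem_u t ht).mono (by linarith))
        h.mem_ut h.deriv_u (tu.mono (by linarith)) tut
      deriv_ρ := hasDerivInSobolev_restart hp hb (fun t ht => (h.mem_ρ t ht).mono (by linarith))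
        h.mem_ρt h.deriv_ρ (tρ.mono (by linarith)) tρt
      equation := fun t ht => by
        have ht' := mem_timeInterval_coe.1 ht
        rcases lt_or_ge t p with htp | htp
        · simp only [restart_of_lt _ htp]
          exact h.equation t (mem_timeInterval_coe.2 ⟨ht'.1, htp.trans_le hb⟩)
        · simp only [restart_of_le _ htp]
          exact h.equation (t - p) (mem_timeInterval_coe.2 ⟨by linarith, by linarith⟩) }

/-- A solution of speed `c > 0` on a bounded time interval `[0, T)` with `π / c ≤ T` is not
maximal. -/
theorem IsMaximalSolution.eq_top_or_lt {s c : ℝ} (hs : 9 / 2 < s) {T : EReal} (hT : 0 < T)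
    {u ρ : ℝ → ℝ → ℝ} (h : IsMaximalSolution s T u ρ) (hc : 0 < c)
    (hQ : ∫ x in (0 : ℝ)..1, (deriv (u 0) x ^ 2 + ρ 0 x ^ 2) = 4 * c ^ 2) :
    T = ⊤ ∨ T < ((Real.pi / c : ℝ) : EReal) := by
  by_contra! hcon
  obtain ⟨hne, hle⟩ := hcon
  have hp : 0 < Real.pi / c := div_pos Real.pi_pos hc
  lift T to ℝ using ⟨hne, (bot_le.trans_lt hT).ne'⟩ with b
  rw [EReal.coe_le_coe_iff] at hle
  obtain ⟨ut, ρt, hsol⟩ := isSolution_iff.1 h.1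
  refine h.2 ((b + Real.pi / c : ℝ) : EReal) _ _ (by exact_mod_cast lt_add_of_pos_right b hp)
    (isSolution_iff.2 ⟨_, _, hsol.restart hs hc hle hQ⟩) fun t ht => ?_
  rcases lt_or_ge t (Real.pi / c) with htp | htp
  · simp only [restart_of_lt _ htp, and_self]
  · simp only [restart_of_le _ htp]
    have ht' := mem_timeInterval_coe.1 ht
    have e := (hsol.classicalSolution hs).eq_add_period hT hc hQ (t := t - Real.pi / c)
      (mem_timeInterval_coe.2 ⟨by linarith, by linarith⟩) (by rwa [sub_add_cancel])
    rw [sub_add_cancel] at e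
    exact ⟨e.1.symm, e.2.symm⟩

end HunterSaxton

end

theorem corollary4p3 (s : ℝ) (hs : 9 / 2 < s) (T : EReal) (hT : 0 < T) (u ρ : ℝ → ℝ → ℝ)
    (hsol : HunterSaxton.IsSolution s T u ρ) (c : ℝ) (hc : c = HunterSaxton.speed (u 0) (ρ 0)) :
    (0 < c →
      (∀ t : ℝ, 0 ≤ t → ((t + 2 * Real.pi / c : ℝ) : EReal) < T →
        u (t + 2 * Real.pi / c) = u t ∧ ρ (t + 2 * Real.pi / c) = ρ t) ∧
      (HunterSaxton.IsMaximalSolution s T u ρ →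
        T = ⊤ ∨ T < ((Real.pi / c : ℝ) : EReal))) ∧
    (c = 0 →
      (∀ t ∈ HunterSaxton.timeInterval T, u t = 0 ∧ ρ t = 0) ∧
      (HunterSaxton.IsMaximalSolution s T u ρ → T = ⊤)) := by
  obtain ⟨ut, ρt, hstrong⟩ := HunterSaxton.isSolution_iff.1 hsol
  have hcl := hstrong.classicalSolution hs
  have hnn : 0 ≤ ∫ x in (0 : ℝ)..1, (deriv (u 0) x ^ 2 + ρ 0 x ^ 2) :=
    intervalIntegral.integral_nonneg zero_le_one fun x _ => by positivity
  have hQ : ∫ x in (0 : ℝ)..1, (deriv (u 0) x ^ 2 + ρ 0 x ^ 2) = 4 * c ^ 2 := by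
    rw [hc, HunterSaxton.speed, Real.sq_sqrt (by positivity)]
    ring
  refine ⟨fun hc0 => ⟨fun t ht htT => ?_, fun hmax => hmax.eq_top_or_lt hs hT hc0 hQ⟩,
    fun hc0 => ?_⟩
  · have hp : 0 < Real.pi / c := div_pos Real.pi_pos hc0
    have e : t + 2 * Real.pi / c = t + Real.pi / c + Real.pi / c := by ring
    rw [e] at htT ⊢
    have m2 : t + Real.pi / c + Real.pi / c ∈ HunterSaxton.timeInterval T :=
      ⟨by linarith, htT⟩
    have m1 : t + Real.pi / c ∈ HunterSaxton.timeInterval T :=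
      HunterSaxton.Icc_subset_timeInterval m2 ⟨by linarith, by linarith⟩
    have m0 : t ∈ HunterSaxton.timeInterval T :=
      HunterSaxton.Icc_subset_timeInterval m1 ⟨ht, by linarith⟩
    have e1 := hcl.eq_add_period hT hc0 hQ m0 m1
    have e2 := hcl.eq_add_period hT hc0 hQ m1 m2
    exact ⟨e2.1.trans e1.1, e2.2.trans e1.2⟩
  · have hz : ∀ t ∈ HunterSaxton.timeInterval T, u t = 0 ∧ ρ t = 0 := fun t ht =>
      hcl.eq_zero (by rw [hQ, hc0]; ring) ht
    refine ⟨hz, fun hmax => ?_⟩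
    by_contra hne
    refine hmax.2 ⊤ 0 0 (lt_top_iff_ne_top.2 hne) (HunterSaxton.isSolution_zero s) fun t ht => ?_
    exact ⟨(hz t ht).1.symm, (hz t ht).2.symm⟩
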